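/- For coprime integers $p,q$ with $q>0$ odd let $K_{p/q}$ be the corresponding 2-bridge knot. A 2-bridge knot is not distinguished from its mirror image, so $K_{p/q}=K_{p'/q'}$ if and only if $q'=q$ and $p'\equiv\pm p$ or $p'\equiv\pm p^{-1}\pmod q$; the unknot $K_{0/1}$ is included. Let $\mathcal S_{even}$ be the set of integer vectors $(a_1,\dots,a_k)$ of even length $k\ge 0$ with all $a_i\in\{-2,0,2\}$, with $a_1\neq 0$ and $a_k\neq 0$ if $k>0$, and such that $a_i=0$ implies $a_{i-1}=a_{i+1}=\pm2$. For a vector $\mathbf a$ let $\mathbf a^{-1}$ be $\mathbf a$ read backwards, let $\hat{\mathbf a}$ be the class consisting of $\pm\mathbf a$ and $\pm\mathbf a^{-1}$, and let $(\mathbf a,\mathbf b,\dots)$ denote concatenation. For $\mathbf a\in\mathcal S_{even}$ put $\Phi(\hat{\mathbf a})=K_{p/q}$, where $\frac pq=[a_1,\dots,a_k]=\cfrac{1}{a_1+\cfrac{1}{\ddots+\cfrac{1}{a_k}}}$ (and $\frac pq=\frac01$ if $k=0$). For an even integer $m$ let $\mathbf m$ be the vector $\pm(2,0,2,\dots,0,2)$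 with sum $m$ if $m\ne0$, and $\mathbf m=(0)$ if $m=0$. A vector $\mathbf c$ parses with respect to $\mathbf a$ if, for some $N\ge1$, $$\mathbf c=(\epsilon_1\mathbf a,\mathbf{2c_1},\epsilon_2\mathbf a^{-1},\mathbf{2c_2},\epsilon_3\mathbf a,\dots,\epsilon_N\mathbf a^{(-1)^{N-1}})$$ with $\epsilon_1=1$, all $\epsilon_i=\pm1$, integers $c_i$, and $\epsilon_i=\epsilon_{i+1}$ whenever $c_i=0$; and $\hat{\mathbf c}$ parses with respect to $\hat{\mathbf a}$ if some representative of $\hat{\mathbf c}$ parses with respect to some representative of $\hat{\mathbf a}$. The Ohtsuki-Riley-Sakuma order on 2-bridge knots is defined by $\Phi(\hat{\mathbf c})\ge\Phi(\hat{\mathbf a})$ if $\hat{\mathbf c}$ parses with respect to $\hat{\mathbf a}$. **Theorem.** Let $K_1=\Phi(\hat{\mathbf a}_1),\dots,K_l=\Phi(\hat{\mathbf a}_l)$ be 2-bridge knots, where $\mathbf a_1,\dots,\mathbf a_l\in\mathcal S_{even}$. Then the following are equivalent. 1. $K_1,\dots,K_l$ are pairwise incomparable (for $i\ne j$, $K_i\not\ge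 K_j$), and there is a 2-bridge knot $J$ with $J\ge K_i$ for all $i$. 2. There are a (possibly empty) vector $\mathbf e\in\mathcal S_{even}$, even integers $m,n$ and integers $p_1,\dots,p_l\ge0$ such that, with $\mathbf w=(\mathbf e,\mathbf m,\mathbf e^{-1},\mathbf n)$, for each $i$ the class $\hat{\mathbf a}_i$ is represented by $$(\mathbf w^{p_i},\mathbf e)=(\underbrace{\mathbf w,\dots,\mathbf w}_{p_i},\mathbf e),$$ and $2p_i+1$ does not divide $2p_j+1$ for all $i\neq j$. -/

import Mathlib

/-! ## Continued fractions and 2-bridge knots -/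

/-- The continued fraction `[a₁, a₂, …, aₙ] = 1 / (a₁ + 1 / (a₂ + ⋯ + 1 / aₙ))`;
the empty one is `0`. -/
def contFrac : List ℤ → ℚ
  | [] => 0
  | x :: a => 1 / ((x : ℚ) + contFrac a)

/-- The reduced fractions `p / q` (with `q > 0`) whose denominator `q` is odd. -/
def OddFraction : Type := {x : ℚ // Odd x.den}

/-- `K_{p/q}` and `K_{p'/q'}` are equivalent (isotopic, up to mirror image) if and only if
`q' = q` and `p' ≡ ± p` or `p' ≡ ± p⁻¹` modulo `q`. -/
def KnotEquiv (x y : OddFraction) : Prop :=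
  y.1.den = x.1.den ∧
    (y.1.num ≡ x.1.num [ZMOD x.1.den] ∨ y.1.num ≡ -x.1.num [ZMOD x.1.den] ∨
      x.1.num * y.1.num ≡ 1 [ZMOD x.1.den] ∨ x.1.num * y.1.num ≡ -1 [ZMOD x.1.den])

theorem knotEquiv_iff (x y : OddFraction) : KnotEquiv x y ↔
    y.1.den = x.1.den ∧ ∃ s : ZMod x.1.den, s * s = 1 ∧
      ((y.1.num : ZMod x.1.den) = s * x.1.num ∨
        (x.1.num * y.1.num : ZMod x.1.den) = s) ∧ (s = 1 ∨ s = -1) := by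
  unfold KnotEquiv
  simp only [← ZMod.intCast_eq_intCast_iff]
  push_cast
  constructor
  · rintro ⟨h, h1 | h1 | h1 | h1⟩
    · exact ⟨h, 1, by ring, Or.inl (by rw [h1]; ring), Or.inl rfl⟩
    · exact ⟨h, -1, by ring, Or.inl (by rw [h1]; ring), Or.inr rfl⟩
    · exact ⟨h, 1, by ring, Or.inr h1, Or.inl rfl⟩
    · exact ⟨h, -1, by ring, Or.inr h1, Or.inr rfl⟩
  · rintro ⟨h, s, -, h1 | h1, rfl | rfl⟩ <;> refine ⟨h, ?_⟩ <;> simp_all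

/-- The equivalence of fractions above is an equivalence relation. -/
instance knotSetoid : Setoid OddFraction where
  r := KnotEquiv
  iseqv := by
    refine ⟨fun x => ⟨rfl, Or.inl rfl⟩, fun {x y} h => ?_, fun {x y z} h k => ?_⟩
    · obtain ⟨hq, h⟩ := h
      refine ⟨hq.symm, ?_⟩
      rw [hq]
      rcases h with h | h | h | h
      · exact Or.inl h.symm
      · exact Or.inr (Or.inl (by simpa using h.symm.neg))
      · exact Or.inr (Or.inr (Or.inl (by rwa [mul_comm])))
      · exact Or.inr (Or.inr (Or.inr (by rwa [mul_comm])))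
    · rw [knotEquiv_iff] at h k ⊢
      obtain ⟨hq, s, hs, h, hs'⟩ := h
      obtain ⟨hq', t, ht, k, ht'⟩ := k
      generalize hQ : y.1.den = Q at *
      subst hq
      refine ⟨hq', s * t, ?_, ?_, ?_⟩
      · linear_combination (t * t) * hs + ht
      · rcases h with h | h <;> rcases k with k | k
        · left; linear_combination k + t * h
        · right
          have h2 : (x.1.num : ZMod x.1.den) = s * y.1.num := by
            linear_combination (-(x.1.num : ZMod x.1.den)) * hs - s * h
          rw [h2]; linear_combination s * k
        · right; linear_combination (x.1.num : ZMod x.1.den) * k + t * h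
        · left
          have h2 : t * (x.1.num : ZMod x.1.den) = s * z.1.num := by
            linear_combination (z.1.num : ZMod x.1.den) * h - (x.1.num : ZMod x.1.den) * k
          linear_combination (-(z.1.num : ZMod x.1.den)) * hs - s * h2
      · rcases hs' with rfl | rfl <;> rcases ht' with rfl | rfl <;> simp

/-- The 2-bridge knots, up to isotopy and mirror image: the knots `K_{p/q}` with `p`, `q` coprime
and `q` odd, up to equivalence. -/
def TwoBridgeKnot : Type := Quotient knotSetoid

/-! ## Expanded even vectors -/

/-- The set `𝒮` of expanded even vectors: all entries are `-2`, `0` or `2`, the first and the last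
entry are not `0`, and the two neighbours of an entry `0` are equal and are `± 2`.
(The empty vector is included.) -/
structure IsExpandedEven (a : List ℤ) : Prop where
  entries : ∀ x ∈ a, x = -2 ∨ x = 0 ∨ x = 2
  first_ne : a.head? ≠ some 0
  last_ne : a.getLast? ≠ some 0
  zero_entry : ∀ (i : ℕ) (h : i + 2 < a.length), a[i + 1] = 0 →
    a[i] = a[i + 2] ∧ (a[i] = 2 ∨ a[i] = -2)

/-- The set `𝒮_even` of expanded even vectors of even length. -/
def SEven : Type := {a : List ℤ // IsExpandedEven a ∧ Even a.length}

/-- The vector `ε a`. -/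
def smulVec (ε : ℤ) (a : List ℤ) : List ℤ := a.map (ε * ·)

/-- Equivalence of vectors: `a = ± b` or `a = ± b⁻¹`, where `b⁻¹` is `b` read backwards. -/
def VecEquiv (a b : List ℤ) : Prop :=
  ∃ ε : ℤ, (ε = 1 ∨ ε = -1) ∧ (a = smulVec ε b ∨ a = smulVec ε b.reverse)

/-- If the first entry is not zero, then the continued fraction does not vanish, has the sign of
the first entry, and is less than `1` in absolute value. -/
theorem contFrac_bounds : ∀ (n : ℕ) (x : ℤ) (a : List ℤ), a.length = n →
    (∀ y ∈ x :: a, y = -2 ∨ y = 0 ∨ y = 2) → x ≠ 0 → (x :: a).getLast? ≠ some 0 →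
    (∀ (i : ℕ) (h : i + 2 < (x :: a).length), (x :: a)[i + 1] = 0 →
      (x :: a)[i] = (x :: a)[i + 2] ∧ ((x :: a)[i] = 2 ∨ (x :: a)[i] = -2)) →
    (x = 2 → 0 < contFrac (x :: a) ∧ contFrac (x :: a) < 1) ∧
      (x = -2 → contFrac (x :: a) < 0 ∧ -1 < contFrac (x :: a)) := by
  intro n
  induction n using Nat.strong_induction_on with
  | _ n ih =>
    intro x a hn hent hx hlast hzero
    have key : ∀ t : ℚ, (x = 2 → -1 < t) → (x = -2 → t < 1) →
        (x = 2 → 0 < 1 / ((x : ℚ) + t) ∧ 1 / ((x : ℚ) + t) < 1) ∧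
        (x = -2 → 1 / ((x : ℚ) + t) < 0 ∧ -1 < 1 / ((x : ℚ) + t)) := by
      intro t h1 h2
      constructor
      · intro hx2
        have := h1 hx2
        subst hx2
        push_cast
        have h3 : (1 : ℚ) < 2 + t := by linarith
        exact ⟨by positivity, by rw [div_lt_one (by linarith)]; exact h3⟩
      · intro hx2
        have := h2 hx2
        subst hx2
        push_cast
        have h3 : (1 : ℚ) < 2 - t := by linarith
        have h4 : (1 : ℚ) / (-2 + t) = -(1 / (2 - t)) := by
          rw [← neg_sub t 2, div_neg, neg_neg]; ring_nf
        have h5 : 1 / (2 - t) < 1 := by rw [div_lt_one (by linarith)]; exact h3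
        have h6 : 0 < 1 / (2 - t) := by positivity
        rw [h4]
        exact ⟨by linarith, by linarith⟩
    rw [contFrac]
    match a, hn with
    | [], _ => exact key _ (by simp [contFrac]) (by simp [contFrac])
    | y :: b, hn =>
      by_cases hy : y = 0
      · subst hy
        match b, hn with
        | [], _ => simp at hlast
        | z :: b, hn =>
          have hz := hzero 0 (by simp) (by simp)
          simp at hz
          have := ih b.length (by simp at hn; omega) z b rfl
            (fun w hw => hent w (by simp at hw ⊢; tauto)) (by omega)
            (by simpa [List.getLast?_cons_cons] using hlast)
            (fun i h h0 => hzero (i + 2) (by simpa using h) h0)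
          rw [contFrac]
          refine key _ (fun h => ?_) (fun h => ?_)
          · have h1 := (this.1 (by omega)).1
            have : 0 < 1 / ((0 : ℤ) + contFrac (z :: b)) := by simpa using h1
            linarith
          · have h1 := (this.2 (by omega)).1
            have : 1 / ((0 : ℤ) + contFrac (z :: b)) < 0 := by simpa using h1
            linarith
      · have := ih b.length (by simp at hn; omega) y b rfl
          (fun w hw => hent w (by simp at hw ⊢; tauto)) hy
          (by simpa [List.getLast?_cons_cons] using hlast)
          (fun i h h0 => hzero (i + 1) (by simpa using h) h0)
        have hy' := hent y (by simp)
        refine key _ (fun h => ?_) (fun h => ?_)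
        · rcases hy' with h1 | h1 | h1
          · exact (this.2 h1).2
          · exact absurd h1 hy
          · linarith [(this.1 h1).1]
        · rcases hy' with h1 | h1 | h1
          · linarith [(this.2 h1).1]
          · exact absurd h1 hy
          · exact (this.1 h1).2

theorem odd_den_of_eq {x : ℚ} {p q : ℤ} (hp : Even p) (hq : Odd q) (h : x = p / q) :
    Even x.num ∧ Odd x.den := by
  have hq0 : (q : ℚ) ≠ 0 := by
    intro h0
    have : q = 0 := by exact_mod_cast h0
    subst this
    simp at hq
  have h1 : x.num * q = p * x.den := by
    have : (x.num : ℚ) / x.den = p / q := by rw [Rat.num_div_den, h]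
    rw [div_eq_div_iff (by exact_mod_cast x.den_nz) hq0] at this
    exact_mod_cast this
  have h2 : Even x.num := by
    have : Even (x.num * q) := h1 ▸ hp.mul_right _
    rcases Int.even_mul.1 this with h | h
    · exact h
    · exact absurd h (Int.not_even_iff_odd.2 hq)
  refine ⟨h2, ?_⟩
  by_contra hd
  rw [Nat.not_odd_iff_even] at hd
  have h3 : 2 ∣ Nat.gcd x.num.natAbs x.den :=
    Nat.dvd_gcd (Int.natAbs_dvd_natAbs.2 h2.two_dvd) hd.two_dvd
  rw [x.reduced.gcd_eq_one] at h3
  omega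

theorem contFrac_parity : ∀ (n : ℕ) (a : List ℤ), a.length = n + n →
    (∀ y ∈ a, y = -2 ∨ y = 0 ∨ y = 2) → a.getLast? ≠ some 0 →
    (∀ (i : ℕ) (h : i + 2 < a.length), a[i + 1] = 0 →
      a[i] = a[i + 2] ∧ (a[i] = 2 ∨ a[i] = -2)) →
    Even (contFrac a).num ∧ Odd (contFrac a).den := by
  intro n
  induction n with
  | zero =>
    intro a ha _ _ _
    have : a = [] := by simpa using ha
    subst this
    exact ⟨by decide, by decide⟩
  | succ n ih =>
    intro a ha hent hlast hzero
    match a, ha with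
    | [], ha => simp at ha
    | [_], ha => simp at ha; omega
    | x :: y :: b, ha =>
      have hb : b.length = n + n := by simp at ha; omega
      have hentb : ∀ w ∈ b, w = -2 ∨ w = 0 ∨ w = 2 :=
        fun w hw => hent w (by simp; tauto)
      have hlastb : b.getLast? ≠ some 0 := by
        match b with
        | [] => simp
        | z :: b => simpa [List.getLast?_cons_cons] using hlast
      obtain ⟨hp, hq⟩ := ih b hb hentb hlastb
        (fun i h h0 => hzero (i + 2) (by simp at h ⊢; omega) h0)
      have hne : (y : ℚ) + contFrac b ≠ 0 := by
        by_cases hy : y = 0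
        · subst hy
          match b, hb with
          | [], _ => simp at hlast
          | z :: b, _ =>
            have hz := hzero 0 (by simp) (by simp)
            simp at hz
            have := contFrac_bounds b.length z b rfl hentb (by omega) hlastb
              (fun i h h0 => hzero (i + 2) (by simp at h ⊢; omega) h0)
            rcases hentb z (by simp) with h | h | h
            · simpa using (this.2 h).1.ne
            · omega
            · simpa using (this.1 h).1.ne'
        · have := contFrac_bounds b.length y b rfl
            (fun w hw => hent w (by simp at hw ⊢; tauto)) hy
            (by simpa [List.getLast?_cons_cons] using hlast)
            (fun i h h0 => hzero (i + 1) (by simp at h ⊢; omega) h0)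
          rw [contFrac] at this
          intro h0
          rw [h0] at this
          rcases hent y (by simp) with h | h | h
          · exact absurd (this.2 h).1 (by simp)
          · exact hy h
          · exact absurd (this.1 h).1 (by simp)
      have hx : Even x := by
        rcases hent x (by simp) with h | h | h <;> rw [h] <;> decide
      have hye : Even y := by
        rcases hent y (by simp) with h | h | h <;> rw [h] <;> decide
      set t := contFrac b with ht
      have hqz : Odd (t.den : ℤ) := by exact_mod_cast hq
      have hP : Even (y * t.den + t.num) := (hye.mul_right _).add hp
      have hQ : Odd (x * (y * t.den + t.num) + t.den) := (hx.mul_right _).add_odd hqz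
      refine odd_den_of_eq hP hQ ?_
      have hd : (t.den : ℚ) ≠ 0 := by exact_mod_cast t.den_nz
      have hnum : t * t.den = t.num := Rat.mul_den_eq_num t
      have hQ0 : ((x * (y * t.den + t.num) + t.den : ℤ) : ℚ) ≠ 0 := by
        intro h0
        have h1 : x * (y * t.den + t.num) + t.den = 0 := by exact_mod_cast h0
        rw [h1] at hQ
        simp at hQ
      have e1 : ((y * t.den + t.num : ℤ) : ℚ) = (y + t) * t.den := by
        push_cast; rw [← hnum]; ring
      have e2 : ((x * (y * t.den + t.num) + t.den : ℤ) : ℚ) =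
          (x + 1 / (y + t)) * ((y + t) * t.den) := by
        push_cast; rw [← hnum]; field_simp
      have h3 : (x : ℚ) + 1 / (y + t) ≠ 0 := by
        intro h0; rw [e2, h0] at hQ0; simp at hQ0
      rw [e1, e2, contFrac, contFrac, ← ht]
      field_simp

/-- The 2-bridge knot `Φ(a) = K_{p/q}` with `p / q = 0 + [a]`, for `a` in `𝒮_even`. -/
def knotOf (a : SEven) : TwoBridgeKnot :=
  Quotient.mk knotSetoid ⟨contFrac a.1, by
    obtain ⟨a, ha, n, hn⟩ := a
    exact (contFrac_parity n a hn ha.entries ha.last_ne ha.zero_entry).2⟩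

/-! ## The Ohtsuki-Riley-Sakuma order -/

/-- The vector `(2, 0, 2, …, 0, 2)` with `k` entries `2`, and `(0)` if `k = 0`. -/
def alternatingVec : ℕ → List ℤ
  | 0 => [0]
  | 1 => [2]
  | k + 2 => 2 :: 0 :: alternatingVec (k + 1)

/-- For an even integer `m`, the vector `± (2, 0, 2, …, 0, 2)` whose entries add up to `m`, and
`(0)` if `m = 0`. -/
def evenVec (m : ℤ) : List ℤ := smulVec m.sign (alternatingVec (m.natAbs / 2))

/-- The `i`-th tile `ε a` or `ε a⁻¹` (counting from `i = 0`, so that `a` occurs for even `i`). -/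
def tile (a : List ℤ) (ε : ℤ) (i : ℕ) : List ℤ :=
  smulVec ε (if Even i then a else a.reverse)

/-- The vector `c` admits a parsing with respect to `a`: it is of the form
`(ε₀ a, 2c₀, ε₁ a⁻¹, 2c₁, ε₂ a, …, ε_k a^{±1})` with `ε₀ = 1`, all `ε_i = ± 1`, integers `c_i`, and
`ε_i = ε_{i+1}` whenever `c_i = 0`. -/
def ParsesWith (c a : List ℤ) : Prop :=
  ∃ (k : ℕ) (ε : ℕ → ℤ) (r : ℕ → ℤ),
    ε 0 = 1 ∧ (∀ i ≤ k, ε i = 1 ∨ ε i = -1) ∧ (∀ i < k, r i = 0 → ε i = ε (i + 1)) ∧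
    c = tile a (ε 0) 0 ++
      (List.range k).flatMap fun i => evenVec (2 * r i) ++ tile a (ε (i + 1)) (i + 1)

/-- The class of `c` parses with respect to the class of `a`: some representative of the one admits
a parsing with respect to some representative of the other. -/
def ClassParsesWith (c a : List ℤ) : Prop :=
  ∃ c' a' : List ℤ, VecEquiv c' c ∧ VecEquiv a' a ∧ ParsesWith c' a'

/-- The Ohtsuki-Riley-Sakuma order `J ≥ K` on 2-bridge knots. -/
def ORSGe (J K : TwoBridgeKnot) : Prop :=
  ∃ c a : SEven, J = knotOf c ∧ K = knotOf a ∧ ClassParsesWith c.1 a.1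

/-- The vector `(w^p, e)` with `w = (e, m, e⁻¹, n)`; here `m` and `n` are even integers that stand
for the corresponding vectors. -/
def powerVec (e : List ℤ) (m n : ℤ) (p : ℕ) : List ℤ :=
  (List.replicate p (e ++ evenVec m ++ e.reverse ++ evenVec n)).flatten ++ e

/-!
The order on 2-bridge knots is the relation "is built from" on vectors, because a knot determines
its vector up to sign and reversal (`vecEquiv_of_knotOf_eq`): the matrix product of a continued
fraction shows that reversing a vector of even length replaces `p` by the even representative of
`- p⁻¹`, and an expanded even vector can be read off from its fraction.

For the implication from the powers `(w^p, e)` to the order, a power of a power with the same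
connectors is again a power (`powerVec_powerVec`), the numbers of tiles being multiplied. So a power
with `∏ (2 p_i + 1)` tiles lies above all the given ones. Conversely a power parses with respect to
another one only if the numbers of tiles divide each other (`dvd_of_classParsesWith`), since a
connector can be recognized from the nonzero entry behind it (`evenVec_append_inj`).

The other implication is a statement on two nonempty vectors of which a common one is built
(`ParsesWith.compare`): one is built from the other, or both are powers with the same tile and the
same connectors. It is proved with words in three letters `A`, `B`, `C` (`Enc`), in which tiles
alternate between `z` and `z⁻¹`, and where an arbitrary connector becomes an arbitrary word without
the last letter of the tile before it. Reading a vector built from `a` then means to walk on the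
line that unfolds the word of `a` by reflections (`FoldedLine`), where walls let all letters but one
pass without a move (`wordChain_of_walk`, `WordChain.readable`). A shortest word that can be read
both in `a` and in `b` visits no pair of places twice; cut into its readings of `b`, it is a finite
system of walks on the line of `a`, starting at distinct places and matched in pairs at both ends
(`Ladder`, `exists_ladder`). If there is only one walk, then `b` is built from `a`. Otherwise take
the walks with the starts closest to the bottom of the line: if no walk starts at the top or ends at
the bottom, each walk is followed by another one with the same delay, so that the words are
periodic, with a period made of two palindromes (`Ladder.Core.commonPower`); in the remaining case
they alternate between blocks `A C A … A` and `B C B … B`, the powers of the empty tile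
(`Ladder.altPower_of_corner`).

For more than two knots, write one of the vectors as a power with the shortest possible tile. Every
other tile of which it is a power is then itself a power of this tile, with the same connectors
(`eq_powerVec_of_minimal`), so that one tile serves for all the vectors.
-/

/-! ### Words in three letters and walks on a folded line -/

/-- The letters of the words that encode vectors. -/
inductive Letter
  | A
  | B
  | C
  deriving DecidableEq

open Letter

/-- The exchange of the letters `A` and `B`. -/
def Letter.swap : Letter → Letter
  | A => B
  | B => A
  | C => C

@[simp] theorem Letter.swap_swap (x : Letter) : x.swap.swap = x := by cases x <;> rfl

theorem Letter.swap_inj {x y : Letter} : x.swap = y.swap ↔ x = y := by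
  cases x <;> cases y <;> simp [Letter.swap]

/-- `lam` is the labelling of the unit edges `[i, i + 1]` of the line that unfolds a word of length
`n` starting with `A` and ending with `B`: it is invariant under the reflections in the multiples
of `n`, the *walls*. Off the walls, consecutive labels are distinct. -/
structure FoldedLine (n : ℕ) (lam : ℤ → Letter) : Prop where
  pos : 0 < n
  per : ∀ i, lam (i + 2 * n) = lam i
  sym : ∀ i, lam (-1 - i) = lam i
  bot : lam 0 = A
  top : lam n = B
  ne : ∀ i, ¬ (n : ℤ) ∣ i → lam (i - 1) ≠ lam i

/-- One step of a walk to the right: the letter `x` is read along the edge to the right if this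
edge carries the label `x`; otherwise the walk pauses, which is allowed at walls only. -/
def Stp (n : ℕ) (lam : ℤ → Letter) (x : Letter) (u v : ℤ) : Prop :=
  (lam u = x ∧ v = u + 1) ∨ (lam u ≠ x ∧ (n : ℤ) ∣ u ∧ v = u)

/-- The positions `w 0, …, w m` form a walk that reads `b 0, …, b (m - 1)`. -/
def Walk (n : ℕ) (lam : ℤ → Letter) (b : ℕ → Letter) (w : ℕ → ℤ) (m : ℕ) : Prop :=
  ∀ y < m, Stp n lam (b y) (w y) (w (y + 1))

section
variable {n m : ℕ} {lam : ℤ → Letter} {b : ℕ → Letter}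

namespace FoldedLine

theorem per_mul (L : FoldedLine n lam) (i k : ℤ) : lam (i + 2 * n * k) = lam i := by
  induction k using Int.induction_on with
  | zero => simp
  | succ k ih => rw [← ih, ← L.per (i + 2 * n * k)]; ring_nf
  | pred k ih => rw [← ih, ← L.per (i + 2 * n * (-k - 1))]; ring_nf

theorem congr (L : FoldedLine n lam) {x y : ℤ} (h : x ≡ y [ZMOD 2 * n]) : lam x = lam y := by
  obtain ⟨k, hk⟩ := h.dvd
  rw [show y = x + 2 * n * k by linarith, L.per_mul]

theorem wall_cases {x : ℤ} (h : (n : ℤ) ∣ x) :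
    x ≡ 0 [ZMOD 2 * n] ∨ x ≡ n [ZMOD 2 * n] := by
  obtain ⟨k, rfl⟩ := h
  rcases Int.even_or_odd' k with ⟨j, rfl | rfl⟩
  · left; exact (Int.modEq_iff_dvd.2 ⟨-j, by ring⟩)
  · right; exact (Int.modEq_iff_dvd.2 ⟨-j, by ring⟩)

theorem dvd_of_modEq {x y : ℤ} (h : x ≡ y [ZMOD 2 * n]) : (n : ℤ) ∣ x ↔ (n : ℤ) ∣ y := by
  have := h.of_mul_left 2
  rw [Int.dvd_iff_emod_eq_zero, Int.dvd_iff_emod_eq_zero, this]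

theorem refl_wall (L : FoldedLine n lam) {v : ℤ} (h : (n : ℤ) ∣ v) (j : ℤ) :
    lam (v + j) = lam (v - 1 - j) := by
  rw [← L.sym (v + j)]
  apply L.congr
  obtain ⟨k, rfl⟩ := h
  exact Int.modEq_iff_dvd.2 ⟨k, by ring⟩

theorem wall_pred (L : FoldedLine n lam) {v : ℤ} (h : (n : ℤ) ∣ v) : lam (v - 1) = lam v := by
  have := L.refl_wall h 0
  simpa using this.symm

theorem lam_neg (L : FoldedLine n lam) (x : ℤ) : lam (-x) = lam (x - 1) := by
  rw [← L.sym (x - 1)]; ring_nf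

/-- The line of the word read backwards with `A` and `B` exchanged. -/
theorem flip (L : FoldedLine n lam) : FoldedLine n (fun x => (lam (n + x)).swap) where
  pos := L.pos
  per i := by rw [← add_assoc, L.per]
  sym i := by
    congr 1
    rw [L.refl_wall (dvd_refl _)]
    ring_nf
  bot := by simp [L.top, Letter.swap]
  top := by
    have := L.per 0
    rw [zero_add, L.bot] at this
    rw [← two_mul, this, Letter.swap]
  ne i hi := by
    rw [Ne, Letter.swap_inj, ← Ne]
    have := L.ne (n + i) (by simpa using hi)
    rwa [add_sub_assoc] at this

end FoldedLine

namespace Stp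

theorem rev (L : FoldedLine n lam) {x : Letter} {u v : ℤ} (h : Stp n lam x u v) :
    Stp n lam x (-v) (-u) := by
  rcases h with ⟨h, rfl⟩ | ⟨h, hd, rfl⟩
  · exact Or.inl ⟨by rw [← h, ← L.sym u]; ring_nf, by ring⟩
  · refine Or.inr ⟨?_, by simpa using hd, rfl⟩
    rwa [L.lam_neg, L.wall_pred hd]

theorem add (L : FoldedLine n lam) {x : Letter} {u v : ℤ} (h : Stp n lam x u v) (k : ℤ) :
    Stp n lam x (u + 2 * n * k) (v + 2 * n * k) := by
  rcases h with ⟨h, rfl⟩ | ⟨h, hd, rfl⟩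
  · exact Or.inl ⟨by rwa [L.per_mul], by ring⟩
  · refine Or.inr ⟨by rwa [L.per_mul], ?_, rfl⟩
    exact dvd_add hd ⟨2 * k, by ring⟩

theorem det {x : Letter} {u v v' : ℤ} (h : Stp n lam x u v) (h' : Stp n lam x u v') :
    v = v' := by
  rcases h with ⟨h, rfl⟩ | ⟨h, hd, rfl⟩ <;> rcases h' with ⟨h', rfl⟩ | ⟨h', hd', rfl⟩ <;>
    first | rfl | exact absurd h h' | exact absurd h' h

theorem modEq (L : FoldedLine n lam) {x : Letter} {u v u' v' : ℤ} (h : Stp n lam x u v)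
    (h' : Stp n lam x u' v') (huu : u ≡ u' [ZMOD 2 * n]) : v ≡ v' [ZMOD 2 * n] := by
  obtain ⟨k, hk⟩ := huu.dvd
  obtain rfl : u' = u + 2 * n * k := by linarith
  rw [(h.add L k).det h' |>.symm]
  exact Int.modEq_iff_dvd.2 ⟨k, by ring⟩

theorem lt (L : FoldedLine n lam) {x : Letter} {u v u' v' : ℤ} (h : Stp n lam x u v)
    (h' : Stp n lam x u' v') (huu : u < u') : v < v' := by
  rcases h with ⟨h, rfl⟩ | ⟨h, hd, rfl⟩ <;> rcases h' with ⟨h', rfl⟩ | ⟨h', hd', rfl⟩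
  · omega
  · rcases (Int.add_one_le_of_lt huu).lt_or_eq with h1 | h1
    · exact h1
    · -- the left walk cannot catch up: the two edges at a wall carry the same label
      exfalso
      apply h'
      rw [← L.wall_pred hd', ← h, ← h1]; ring_nf
  · omega
  · omega

end Stp

namespace Walk

theorem le {w : ℕ → ℤ} {m' : ℕ} (h : Walk n lam b w m) (hm : m' ≤ m) : Walk n lam b w m' :=
  fun y hy => h y (hy.trans_le hm)

theorem shift {w : ℕ → ℤ} (h : Walk n lam b w m) (t : ℕ) :
    Walk n lam (fun y => b (t + y)) (fun y => w (t + y)) (m - t) :=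
  fun y hy => by simpa [add_assoc] using h (t + y) (by omega)

theorem rev (L : FoldedLine n lam) {w : ℕ → ℤ} (h : Walk n lam b w m) :
    Walk n lam (fun y => b (m - 1 - y)) (fun y => -w (m - y)) m := by
  intro y hy
  have := (h (m - 1 - y) (by omega)).rev L
  rw [show m - 1 - y + 1 = m - y by omega] at this
  change Stp n lam (b (m - 1 - y)) (-w (m - y)) (-w (m - (y + 1)))
  rwa [show m - (y + 1) = m - 1 - y by omega]

theorem add (L : FoldedLine n lam) {w : ℕ → ℤ} (h : Walk n lam b w m) (k : ℤ) :
    Walk n lam b (fun y => w y + 2 * n * k) m :=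
  fun y hy => (h y hy).add L k

theorem congr {w : ℕ → ℤ} {b' : ℕ → Letter} (h : Walk n lam b w m) (hb : ∀ y < m, b y = b' y) :
    Walk n lam b' w m :=
  fun y hy => hb y hy ▸ h y hy

theorem modEq (L : FoldedLine n lam) {w w' : ℕ → ℤ} (h : Walk n lam b w m)
    (h' : Walk n lam b w' m) (h0 : w 0 ≡ w' 0 [ZMOD 2 * n]) :
    ∀ y ≤ m, w y ≡ w' y [ZMOD 2 * n] := by
  intro y
  induction y with
  | zero => intro _; exact h0
  | succ y ih => intro hy; exact (h y hy).modEq L (h' y hy) (ih (by omega))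

theorem eq {w w' : ℕ → ℤ} (h : Walk n lam b w m)
    (h' : Walk n lam b w' m) (h0 : w 0 = w' 0) : ∀ y ≤ m, w y = w' y := by
  intro y
  induction y with
  | zero => intro _; exact h0
  | succ y ih =>
    intro hy
    have := h y hy
    rw [ih (by omega)] at this
    exact this.det (h' y hy)

theorem modEq_back (L : FoldedLine n lam) {w w' : ℕ → ℤ} (h : Walk n lam b w m)
    (h' : Walk n lam b w' m) (h0 : w m ≡ w' m [ZMOD 2 * n]) :
    ∀ y ≤ m, w y ≡ w' y [ZMOD 2 * n] := by
  intro y hy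
  have := (h.rev L).modEq L (h'.rev L) (by simpa using h0.neg) (m - y) (by omega)
  simp only [show m - (m - y) = y by omega] at this
  simpa using this.neg

theorem lt (L : FoldedLine n lam) {w w' : ℕ → ℤ} (h : Walk n lam b w m)
    (h' : Walk n lam b w' m) (h0 : w 0 < w' 0) : ∀ y ≤ m, w y < w' y := by
  intro y
  induction y with
  | zero => intro _; exact h0
  | succ y ih => intro hy; exact (h y hy).lt L (h' y hy) (ih (by omega))

theorem mono {w : ℕ → ℤ} (h : Walk n lam b w m) {y t : ℕ} (ht : y + t ≤ m) :
    w y ≤ w (y + t) ∧ w (y + t) ≤ w y + t := by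
  induction t with
  | zero => simp
  | succ t ih =>
    have h1 := ih (by omega)
    have h2 := h (y + t) (by omega)
    rw [← add_assoc]
    rcases h2 with ⟨_, h2⟩ | ⟨_, _, h2⟩ <;> rw [h2] <;> push_cast <;> constructor <;> linarith

/-- Off the walls the motion is forced. -/
theorem forced {w : ℕ → ℤ} (h : Walk n lam b w m) {y t : ℕ} (ht : y + t ≤ m)
    (hw : ∀ i < t, ¬ (n : ℤ) ∣ w y + i) :
    w (y + t) = w y + t ∧ ∀ i < t, lam (w y + i) = b (y + i) := by
  induction t with
  | zero => simp
  | succ t ih =>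
    obtain ⟨h1, h2⟩ := ih (by omega) (fun i hi => hw i (by omega))
    have h3 := h (y + t) (by omega)
    rw [h1] at h3
    rcases h3 with ⟨h3, h4⟩ | ⟨_, h4, _⟩
    · refine ⟨by rw [← add_assoc, h4]; push_cast; ring, fun i hi => ?_⟩
      rcases Nat.lt_succ_iff_lt_or_eq.1 hi with hi | rfl
      · exact h2 i hi
      · exact h3
    · exact absurd h4 (hw t (by omega))

/-- A walk stays at a wall as long as it does not read the label of the wall. -/
theorem stay {w : ℕ → ℤ} (h : Walk n lam b w m) {y t : ℕ} (ht : y + t ≤ m)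
    (hb : ∀ i < t, lam (w y) ≠ b (y + i)) : w (y + t) = w y := by
  induction t with
  | zero => simp
  | succ t ih =>
    have h1 := ih (by omega) (fun i hi => hb i (by omega))
    have h3 := h (y + t) (by omega)
    rw [h1] at h3
    rcases h3 with ⟨h3, h4⟩ | ⟨_, _, h4⟩
    · exact absurd h3 (hb t (by omega))
    · exact h4

/-- Reading a block without the letter `X` and then `X`, a walk goes to the next edge labelled `X`
if it meets no wall before that edge. -/
theorem run {w : ℕ → ℤ} (h : Walk n lam b w m) {y κ κ' : ℕ} {X : Letter} (hκ : y + κ < m)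
    (hb : ∀ i < κ, b (y + i) ≠ X) (hb' : b (y + κ) = X)
    (hl : ∀ i < κ', lam (w y + i) ≠ X) (hl' : lam (w y + κ') = X)
    (hw : ∀ i < κ', ¬ (n : ℤ) ∣ w y + i) : w (y + κ) = w y + κ' := by
  have hle : κ' ≤ κ := by
    by_contra hlt
    obtain ⟨h1, h2⟩ := h.forced (y := y) (t := κ + 1) (by omega) (fun i hi => hw i (by omega))
    exact hl κ (by omega) (by rw [h2 κ (by omega), hb'])
  obtain ⟨h1, h2⟩ := h.forced (y := y) (t := κ') (by omega) hw
  have h3 := h.stay (y := y + κ') (t := κ - κ') (by omega) (fun i hi => by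
    rw [h1, hl']
    have := hb (κ' + i) (by omega)
    rw [← add_assoc] at this
    exact this.symm)
  rw [show y + κ' + (κ - κ') = y + κ by omega] at h3
  rw [h3, h1]

end Walk
end

/-! ### Ladders -/

/-- A ladder records how the copies of the word `b` (of length `m`), that make up a word `c` which
is built from `b` and from the word `a` (with line `lam`, of length `n`), run along the line of
`a`. The strand `r` is the walk `W r` that reads `b`; the copies of `b` in `c` that are read
backwards have been reversed. Consecutive strands of `c` are joined at their bottom (the beginning
of `b`) or at their top: `s0` and `s1` are these two matchings, and the two letters that are
missing are `X = A` at the bottom and `X = B` at the top. The first strand `i0` is unmatched at the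
bottom, the last one `iN` at the top; they are fixed by `s0` and by `s1`. -/
structure Ladder (n m : ℕ) (lam : ℤ → Letter) (b : ℕ → Letter) {ι : Type} (W : ι → ℕ → ℤ)
    (s0 s1 : ι → ι) (i0 iN : ι) : Prop where
  line : FoldedLine n lam
  pos : 0 < m
  first : b 0 = A
  last : b (m - 1) = B
  ne : ∀ y, y + 1 < m → b y ≠ b (y + 1)
  walk : ∀ r, Walk n lam b (W r) m
  start : W i0 0 ≡ 0 [ZMOD 2 * n]
  fin : W iN m ≡ n [ZMOD 2 * n]
  inj : ∀ r r', W r 0 ≡ W r' 0 [ZMOD 2 * n] → r = r'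
  bot : ∀ r, ∃ κ : ℕ, W (s0 r) 0 ≡ -W r 0 + κ [ZMOD 2 * n] ∧ ∀ i < κ, lam (-W r 0 + i) ≠ A
  top : ∀ r, ∃ κ : ℕ, -W (s1 r) m ≡ W r m + κ [ZMOD 2 * n] ∧ ∀ i < κ, lam (W r m + i) ≠ B
  bot_ne : ∀ r, r ≠ i0 → s0 r ≠ r
  top_ne : ∀ r, r ≠ iN → s1 r ≠ r
  conn : ∀ S : Set ι, i0 ∈ S → (∀ r ∈ S, s0 r ∈ S) → (∀ r ∈ S, s1 r ∈ S) → ∀ r, r ∈ S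
  conn' : ∀ S : Set ι, iN ∈ S → (∀ r ∈ S, s0 r ∈ S) → (∀ r ∈ S, s1 r ∈ S) → ∀ r, r ∈ S

namespace Ladder
variable {n m : ℕ} {lam : ℤ → Letter} {b : ℕ → Letter} {ι : Type} {W : ι → ℕ → ℤ}
  {s0 s1 : ι → ι} {i0 iN : ι}

theorem modEq_iff {x y : ℤ} : x ≡ y [ZMOD 2 * n] ↔ ∃ k : ℤ, x = y + 2 * n * k := by
  constructor
  · intro h
    obtain ⟨k, hk⟩ := h.symm.dvd
    exact ⟨k, by linarith⟩
  · rintro ⟨k, rfl⟩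
    exact Int.modEq_iff_dvd.2 ⟨-k, by ring⟩

/-- The ladder seen from the other end: all words are read backwards, with `A` and `B`
exchanged. -/
theorem flip (L : Ladder n m lam b W s0 s1 i0 iN) :
    Ladder n m (fun x => (lam (n + x)).swap) (fun y => (b (m - 1 - y)).swap)
      (fun r y => -W r (m - y) - n) s1 s0 iN i0 where
  line := L.line.flip
  pos := L.pos
  first := by simp [L.last, Letter.swap]
  last := by simp [L.first, Letter.swap]
  ne y hy := by
    rw [Ne, Letter.swap_inj, eq_comm, ← Ne]
    have := L.ne (m - 1 - (y + 1)) (by omega)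
    rwa [show m - 1 - (y + 1) + 1 = m - 1 - y by omega] at this
  walk r y hy := by
    rcases (L.walk r).rev L.line y hy with ⟨h1, h2⟩ | ⟨h1, h2, h3⟩
    · refine Or.inl ⟨?_, ?_⟩
      · simp only at h1 ⊢
        rw [← h1]; ring_nf
      · simp only at h2 ⊢
        rw [h2]; ring
    · refine Or.inr ⟨?_, ?_, ?_⟩
      · simp only at h1 ⊢
        rw [Ne, Letter.swap_inj, ← Ne]
        convert h1 using 2; ring
      · simpa using h2
      · simp only at h3 ⊢
        rw [h3]
  start := by
    obtain ⟨k, hk⟩ := modEq_iff.1 L.fin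
    exact modEq_iff.2 ⟨-k - 1, by simp only [Nat.sub_zero, hk]; ring⟩
  fin := by
    obtain ⟨k, hk⟩ := modEq_iff.1 L.start
    exact modEq_iff.2 ⟨-k - 1, by simp only [Nat.sub_self, hk]; ring⟩
  inj r r' h := by
    simp only [Nat.sub_zero] at h
    apply L.inj
    refine (L.walk r).modEq_back L.line (L.walk r') ?_ 0 (by omega)
    obtain ⟨k, hk⟩ := modEq_iff.1 h
    exact modEq_iff.2 ⟨-k, by linarith⟩
  bot r := by
    obtain ⟨κ, h1, h2⟩ := L.top r
    refine ⟨κ, ?_, fun i hi => ?_⟩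
    · obtain ⟨k, hk⟩ := modEq_iff.1 h1
      exact modEq_iff.2 ⟨k - 1, by simp only [Nat.sub_zero, hk]; ring⟩
    · have := h2 i hi
      rw [show A = B.swap from rfl, Ne, Letter.swap_inj, ← Ne]
      convert this using 1
      apply L.line.congr
      exact modEq_iff.2 ⟨1, by simp only [Nat.sub_zero]; ring⟩
  top r := by
    obtain ⟨κ, h1, h2⟩ := L.bot r
    refine ⟨κ, ?_, fun i hi => ?_⟩
    · obtain ⟨k, hk⟩ := modEq_iff.1 h1
      exact modEq_iff.2 ⟨k + 1, by simp only [Nat.sub_self, neg_sub, sub_neg_eq_add, hk]; ring⟩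
    · have := h2 i hi
      rw [show B = A.swap from rfl, Ne, Letter.swap_inj, ← Ne]
      convert this using 2
      simp only [Nat.sub_self]; ring
  bot_ne := L.top_ne
  top_ne := L.bot_ne
  conn S h0 h1 h2 := L.conn' S h0 h2 h1
  conn' S h0 h1 h2 := L.conn S h0 h2 h1

/-- If no strand starts at the top, then no wall is met on the way from a strand to its partner at
the bottom. -/
theorem bot_run (L : Ladder n m lam b W s0 s1 i0 iN) (hc : ∀ r, ¬ W r 0 ≡ n [ZMOD 2 * n]) (r : ι) :
    ∃ κ : ℕ, W (s0 r) 0 ≡ -W r 0 + κ [ZMOD 2 * n] ∧ (∀ i < κ, lam (-W r 0 + i) ≠ A) ∧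
      lam (-W r 0 + κ) = A ∧ ∀ i < κ, ¬ (n : ℤ) ∣ -W r 0 + i := by
  have hA : ∀ r, lam (W r 0) = A := by
    intro r
    rcases L.walk r 0 L.pos with ⟨h, -⟩ | ⟨h, hd, -⟩
    · rw [h, L.first]
    · rw [L.first] at h
      rcases FoldedLine.wall_cases hd with h' | h'
      · exact absurd ((L.line.congr h').trans L.line.bot) h
      · exact absurd h' (hc r)
  obtain ⟨κ, h1, h2⟩ := L.bot r
  have h3 : lam (-W r 0 + κ) = A := by rw [← L.line.congr h1, hA]
  refine ⟨κ, h1, h2, h3, fun i hi hd => ?_⟩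
  set v := -W r 0 + i with hv
  have hvn : v ≡ n [ZMOD 2 * n] := by
    rcases FoldedLine.wall_cases hd with h' | h'
    · exact absurd ((L.line.congr h').trans L.line.bot) (h2 i hi)
    · exact h'
  have e1 : lam (v - i - 1) = A := by
    rw [← hA r, ← L.line.lam_neg]
    congr 1; rw [hv]; ring
  have e2 : lam (v + i) = A := by
    rw [L.line.refl_wall hd, ← e1]; ring_nf
  have hle : κ ≤ 2 * i := by
    by_contra hlt
    apply h2 (2 * i) (by omega)
    rw [← e2]; congr 1; rw [hv]; push_cast; ring
  have hge : 2 * i ≤ κ := by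
    by_contra hlt
    have hki : (i : ℤ) < κ := by exact_mod_cast hi
    have e3 : lam (v - 1 - (κ - i)) = A := by
      rw [← L.line.refl_wall hd, ← h3]; congr 1; rw [hv]; ring
    obtain ⟨j, hj⟩ : ∃ j : ℕ, (j : ℤ) = 2 * i - κ - 1 := ⟨2 * i - κ - 1, by omega⟩
    apply h2 j (by omega)
    rw [← e3]; congr 1; rw [hv, hj]; ring
  have hk : κ = 2 * i := le_antisymm hle hge
  have h5 : s0 r = r := by
    apply L.inj
    refine h1.trans ?_
    obtain ⟨k, hk'⟩ := modEq_iff.1 hvn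
    refine modEq_iff.2 ⟨2 * k + 1, ?_⟩
    rw [hk]; push_cast; linarith
  have h6 : r = i0 := by
    by_contra h6
    exact L.bot_ne r h6 h5
  apply h2 0 (by omega)
  have : -W r 0 + (0 : ℕ) ≡ 0 [ZMOD 2 * n] := by
    have := L.start.neg
    rw [← h6] at this
    simpa using this
  rw [L.line.congr this, L.line.bot]

/-- `Lead d r s`: after `d` steps, the strand `r` is where the strand `s` starts. -/
def Lead (n : ℕ) (W : ι → ℕ → ℤ) (d : ℕ) (r s : ι) : Prop := W r d ≡ W s 0 [ZMOD 2 * n]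

/-- If the first `d` letters of `b` are a palindrome and a block without `A`, followed by `A`, then
the relation `Lead` passes to the partners at the bottom, with the roles exchanged. -/
theorem lead_bot (L : Ladder n m lam b W s0 s1 i0 iN) (hc : ∀ r, ¬ W r 0 ≡ n [ZMOD 2 * n])
    {g d : ℕ} (hg : 0 < g) (hgd : g ≤ d) (hdm : d < m)
    (hpal : ∀ i < g, b i = b (g - 1 - i)) (hnA : ∀ i, g ≤ i → i < d → b i ≠ A) (hdA : b d = A)
    {r s : ι} (h : Lead n W d r s) : Lead n W d (s0 s) (s0 r) := by
  have hgA : b (g - 1) = A := by rw [← L.first, hpal 0 hg]; rfl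
  -- the walk `r`, read backwards from the start of `s`
  obtain ⟨κ, h1, h2, h3, h4⟩ := L.bot_run hc s
  obtain ⟨k, hk⟩ := modEq_iff.1 h
  have w1 := (((L.walk r).le (Nat.le_of_lt hdm)).rev L.line).add L.line k
  have h0 : -W r (d - 0) + 2 * n * k = -W s 0 := by rw [Nat.sub_zero, hk]; ring
  have r1 := w1.run (y := 0) (κ := d - g) (κ' := κ) (X := A) (by omega)
    (fun i hi => hnA _ (by omega) (by omega))
    (by rw [← hgA]; congr 1; omega)
    (by simpa only [h0] using h2) (by simpa only [h0] using h3) (by simpa only [h0] using h4)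
  simp only [h0, zero_add, show d - (d - g) = g by omega] at r1
  -- hence `s0 s` starts where that walk enters the palindrome
  have w2 := ((L.walk r).le (show g ≤ m by omega)).rev L.line
  have w2 := w2.congr (b' := b) (fun y hy => (hpal y hy).symm)
  have e2 : (fun y => -W r (g - y)) 0 ≡ W (s0 s) 0 [ZMOD 2 * n] := by
    refine Int.ModEq.trans ?_ h1.symm
    rw [← r1]
    exact modEq_iff.2 ⟨-k, by simp⟩
  have e3 := w2.modEq L.line ((L.walk (s0 s)).le (by omega)) e2 g le_rfl
  simp only [Nat.sub_self] at e3
  obtain ⟨κ', h1', h2', h3', h4'⟩ := L.bot_run hc r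
  obtain ⟨k', hk'⟩ := modEq_iff.1 e3.symm
  have w3 := (L.walk (s0 s)).add L.line (-k')
  have h0' : W (s0 s) g + 2 * n * (-k') = -W r 0 := by rw [hk']; ring
  have r2 := w3.run (y := g) (κ := d - g) (κ' := κ') (X := A) (by omega)
    (fun i hi => hnA _ (by omega) (by omega)) (by rw [← hdA]; congr 1; omega)
    (by simpa only [h0'] using h2') (by simpa only [h0'] using h3')
    (by simpa only [h0'] using h4')
  simp only [h0', show g + (d - g) = d by omega] at r2
  refine Int.ModEq.trans ?_ h1'.symm
  rw [← r2]
  exact modEq_iff.2 ⟨k', by ring⟩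

end Ladder

/-! ### The bottom of a ladder -/

namespace Ladder
variable {n m : ℕ} {lam : ℤ → Letter} {b : ℕ → Letter} {ι : Type} {W : ι → ℕ → ℤ}
  {s0 s1 : ι → ι} {i0 iN : ι}

theorem eq_of_modEq {x y : ℤ} (h : x ≡ y [ZMOD 2 * n]) (h1 : x < y + 2 * n)
    (h2 : y < x + 2 * n) : x = y := by
  obtain ⟨k, hk⟩ := modEq_iff.1 h
  have hn : (0 : ℤ) ≤ 2 * n := by positivity
  have hk1 : k < 1 := by
    by_contra hk1
    have : (2 * n : ℤ) * 1 ≤ 2 * n * k := mul_le_mul_of_nonneg_left (by omega) hn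
    linarith
  have hk2 : -1 < k := by
    by_contra hk2
    have : (2 * n : ℤ) * k ≤ 2 * n * (-1) := mul_le_mul_of_nonneg_left (by omega) hn
    linarith
  obtain rfl : k = 0 := by omega
  linarith

theorem not_dvd_of_lt {x : ℤ} (h0 : 0 < x) (h1 : x < n) : ¬ (n : ℤ) ∣ x :=
  fun h => by have := Int.le_of_dvd h0 h; omega

/-- A walk from the bottom wall that reads a word starting with `A` runs straight to the top. -/
theorem walk_from_zero (L : FoldedLine n lam) {w : ℕ → ℤ} (h : Walk n lam b w m) (hnm : n ≤ m)
    (h0 : w 0 = 0) (hb : b 0 = A) : (∀ y ≤ n, w y = y) ∧ ∀ y < n, b y = lam y := by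
  have hn := L.pos
  have h1 : w 1 = 1 := by
    rcases h 0 (by omega) with ⟨_, h2⟩ | ⟨h2, _⟩
    · rw [h2, h0]; rfl
    · rw [h0, L.bot, hb] at h2; exact absurd rfl h2
  have key : ∀ t, t ≤ n - 1 → w (1 + t) = 1 + t ∧ ∀ i < t, lam (w 1 + i) = b (1 + i) := by
    intro t ht
    have := h.forced (y := 1) (t := t) (by omega) (fun i hi => by
      rw [h1]; exact not_dvd_of_lt (by omega) (by omega))
    rwa [h1] at this ⊢
  constructor
  · intro y hy
    rcases y with _ | y
    · exact h0
    · have := (key y (by omega)).1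
      rw [add_comm] at this; rw [this]; push_cast; ring
  · intro y hy
    rcases y with _ | y
    · rw [hb]; exact L.bot.symm
    · have := (key (n - 1) le_rfl).2 y (by omega)
      rw [h1] at this
      rw [add_comm y 1, ← this]; push_cast; rfl

theorem normalize (L : Ladder n m lam b W s0 s1 i0 iN) (k : ι → ℤ) :
    Ladder n m lam b (fun r y => W r y + 2 * n * k r) s0 s1 i0 iN where
  line := L.line
  pos := L.pos
  first := L.first
  last := L.last
  ne := L.ne
  walk r := (L.walk r).add L.line _
  start := Int.ModEq.trans (modEq_iff.2 ⟨k i0, by ring⟩) L.start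
  fin := Int.ModEq.trans (modEq_iff.2 ⟨k iN, by ring⟩) L.fin
  inj r r' h := by
    obtain ⟨j, hj⟩ := modEq_iff.1 h
    exact L.inj r r' (modEq_iff.2 ⟨j + k r' - k r, by linarith⟩)
  bot r := by
    obtain ⟨κ, h1, h2⟩ := L.bot r
    obtain ⟨j, hj⟩ := modEq_iff.1 h1
    refine ⟨κ, modEq_iff.2 ⟨j + k r + k (s0 r), by rw [hj]; ring⟩, fun i hi => ?_⟩
    rw [L.line.congr (y := -W r 0 + i) (modEq_iff.2 ⟨-k r, by ring⟩)]
    exact h2 i hi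
  top r := by
    obtain ⟨κ, h1, h2⟩ := L.top r
    obtain ⟨j, hj⟩ := modEq_iff.1 h1
    refine ⟨κ, modEq_iff.2 ⟨j - k r - k (s1 r), by linear_combination hj⟩, fun i hi => ?_⟩
    rw [L.line.congr (y := W r m + i) (modEq_iff.2 ⟨k r, by ring⟩)]
    exact h2 i hi
  bot_ne := L.bot_ne
  top_ne := L.top_ne
  conn := L.conn
  conn' := L.conn'

/-- If `b` has the period `d`, then `Lead d r s` may be tested at the end of `b`. -/
theorem lead_iff (L : Ladder n m lam b W s0 s1 i0 iN) {d : ℕ} (hd : d ≤ m)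
    (hper : ∀ y, y + d < m → b (y + d) = b y) {r s : ι} :
    Lead n W d r s ↔ W r m ≡ W s (m - d) [ZMOD 2 * n] := by
  have w1 := ((L.walk r).shift d).congr (b' := b) (fun y hy => by
    rw [add_comm]; exact hper y (by omega))
  have w2 := (L.walk s).le (Nat.sub_le m d)
  constructor
  · intro h
    have := w1.modEq L.line w2 h (m - d) le_rfl
    simpa only [show d + (m - d) = m by omega] using this
  · intro h
    exact w1.modEq_back L.line w2 (by simpa only [show d + (m - d) = m by omega] using h) 0
      (by omega)

/-- The counterpart of `lead_bot` at the top. -/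
theorem lead_top (L : Ladder n m lam b W s0 s1 i0 iN) (hc : ∀ r, ¬ W r m ≡ 0 [ZMOD 2 * n])
    {g d : ℕ} (hg : 0 < g) (hgd : g ≤ d) (hdm : d < m)
    (hper : ∀ y, y + d < m → b (y + d) = b y)
    (hpal : ∀ i < g, b (m - 1 - i) = b (m - g + i))
    (hnB : ∀ i, g ≤ i → i < d → b (m - 1 - i) ≠ B) (hdB : b (m - 1 - d) = B)
    {r s : ι} (h : Lead n W d r s) : Lead n W d (s1 s) (s1 r) := by
  have key : ∀ r s, Lead n W d r s ↔ Lead n (fun r y => -W r (m - y) - n) d s r := by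
    intro r s
    rw [L.lead_iff hdm.le hper, Lead]
    simp only [Nat.sub_zero]
    constructor
    · intro h
      exact (h.symm.neg).sub_right _
    · intro h
      have := h.add_right (n : ℤ)
      simp only [sub_add_cancel] at this
      simpa using this.symm.neg
  rw [key] at h ⊢
  refine L.flip.lead_bot (fun r hr => hc r ?_) hg hgd hdm ?_ ?_ ?_ h
  · simp only [Nat.sub_zero] at hr
    obtain ⟨k, hk⟩ := modEq_iff.1 hr
    exact modEq_iff.2 ⟨-k - 1, by linear_combination -hk⟩
  · intro i hi
    rw [Letter.swap_inj, hpal i hi]; congr 1; omega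
  · intro i hi hi'
    rw [show A = B.swap from rfl, Ne, Letter.swap_inj]
    exact hnB i hi hi'
  · rw [hdB]; rfl

/-- The situation at the bottom of a ladder none of whose strands starts at the top or ends at the
bottom: `pl` is the strand with the least positive start `d`, its partner `mi` starts at `-g`. -/
structure Core (n m : ℕ) (lam : ℤ → Letter) (b : ℕ → Letter) {ι : Type} (W : ι → ℕ → ℤ)
    (s0 s1 : ι → ι) (i0 iN mi pl : ι) (g d : ℕ) : Prop where
  ladder : Ladder n m lam b W s0 s1 i0 iN
  le : n ≤ m
  hc : ∀ r, ¬ W r 0 ≡ n [ZMOD 2 * n]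
  hcN : ∀ r, ¬ W r m ≡ 0 [ZMOD 2 * n]
  hr : ∀ r, -n < W r 0 ∧ W r 0 < n
  start : W i0 0 = 0
  hpl : W pl 0 = d
  hmi : W mi 0 = -g
  gpos : 0 < g
  hgd : g < d
  hdn : d < n
  gap : ∀ r, -g < W r 0 → W r 0 < d → r = i0
  eq : ∀ i < n, b i = lam i
  pal : ∀ i < g, b i = b (g - 1 - i)
  noA : ∀ i, g ≤ i → i < d → b i ≠ A
  isA : b d = A
  mid : W mi d = 0
  zerod : W i0 d = d
  neg : ∀ r, W r 0 < 0 → -W r 0 ≤ W (s0 r) 0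
  posi : ∀ r, 0 < W r 0 → ∃ κ : ℕ, W (s0 r) 0 = -W r 0 + κ ∧ W (s0 r) 0 < 0 ∧
      (∀ i < κ, lam (-W r 0 + i) ≠ A) ∧ lam (-W r 0 + κ) = A

theorem exists_core (L : Ladder n m lam b W s0 s1 i0 iN) (hnm : n ≤ m)
    (hc : ∀ r, ¬ W r 0 ≡ n [ZMOD 2 * n]) (hcN : ∀ r, ¬ W r m ≡ 0 [ZMOD 2 * n])
    (hr : ∀ r, -n < W r 0 ∧ W r 0 < n) (hN : ∃ r, r ≠ i0) :
    ∃ mi pl g d, Core n m lam b W s0 s1 i0 iN mi pl g d := by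
  have hn := L.line.pos
  have hstart : W i0 0 = 0 :=
    eq_of_modEq L.start (by linarith [hr i0]) (by linarith [hr i0])
  obtain ⟨hw0, hbl⟩ := walk_from_zero L.line (L.walk i0) hnm hstart L.first
  -- partners of strands with negative start
  have hneg : ∀ r, W r 0 < 0 → ∃ κ : ℕ, W (s0 r) 0 = -W r 0 + κ ∧ 0 < W (s0 r) 0 ∧
      ∀ i < κ, lam (-W r 0 + i) ≠ A := by
    intro r hr0
    obtain ⟨κ, h1, h2, h3, h4⟩ := L.bot_run hc r
    have hlt : -W r 0 + κ < n := by
      by_contra hge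
      obtain ⟨i, hi⟩ : ∃ i : ℕ, (i : ℤ) = n + W r 0 := ⟨(n + W r 0).toNat, by
        have := hr r; omega⟩
      rcases lt_or_eq_of_le (show i ≤ κ by omega) with h | h
      · exact h4 i h (by rw [hi]; simp)
      · rw [← h, hi] at h3
        rw [show -W r 0 + (n + W r 0) = n by ring, L.line.top] at h3
        cases h3
    have := eq_of_modEq h1 (by linarith [hr (s0 r)]) (by linarith [hr (s0 r)])
    exact ⟨κ, this, by rw [this]; omega, h2⟩
  have hpos : ∀ r, 0 < W r 0 → ∃ κ : ℕ, W (s0 r) 0 = -W r 0 + κ ∧ W (s0 r) 0 < 0 ∧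
      (∀ i < κ, lam (-W r 0 + i) ≠ A) ∧ lam (-W r 0 + κ) = A := by
    intro r hr0
    obtain ⟨κ, h1, h2, h3, h4⟩ := L.bot_run hc r
    have hlt : -W r 0 + κ < 0 := by
      by_contra hge
      obtain ⟨i, hi⟩ : ∃ i : ℕ, (i : ℤ) = W r 0 - 1 := ⟨(W r 0 - 1).toNat, by omega⟩
      apply h2 i (by omega)
      rw [hi, show -W r 0 + (W r 0 - 1) = -1 - 0 by ring, L.line.sym, L.line.bot]
    have := eq_of_modEq h1 (by linarith [hr (s0 r), hr r]) (by linarith [hr (s0 r), hr r])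
    exact ⟨κ, this, by rw [this]; omega, h2, h3⟩
  have hex : ∃ d : ℕ, ∃ r, W r 0 = d ∧ 0 < d := by
    obtain ⟨r, hri⟩ := hN
    have hne : W r 0 ≠ 0 := fun h => hri (L.inj _ _ (by rw [h, hstart]))
    rcases lt_or_gt_of_ne hne with h | h
    · obtain ⟨κ, -, h2, -⟩ := hneg r h
      exact ⟨(W (s0 r) 0).toNat, s0 r, by omega, by omega⟩
    · exact ⟨(W r 0).toNat, r, by omega, by omega⟩
  classical
  let d := Nat.find hex
  obtain ⟨pl, hpl, hd0⟩ : ∃ r, W r 0 = d ∧ 0 < d := Nat.find_spec hex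
  have hmin : ∀ r, 0 < W r 0 → (d : ℤ) ≤ W r 0 := by
    intro r h
    have : d ≤ (W r 0).toNat := Nat.find_min' hex ⟨r, by omega, by omega⟩
    omega
  have hdn : d < n := by have := hr pl; omega
  obtain ⟨κ, h1, h2, h3, h4⟩ := hpos pl (by omega)
  obtain ⟨g, hg⟩ : ∃ g : ℕ, (g : ℤ) = d - κ := ⟨d - κ, by omega⟩
  have hmi : W (s0 pl) 0 = -g := by rw [h1, hpl, hg]; ring
  have hg0 : 0 < g := by omega
  have hnA : ∀ i, g ≤ i → i < d → b i ≠ A := by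
    intro i hi hi'
    rw [hbl i (by omega), ← L.line.sym]
    have := h3 (d - 1 - i) (by omega)
    convert this using 2
    rw [hpl]; omega
  have hgA : b (g - 1) = A := by
    rw [hbl _ (by omega), ← L.line.sym]
    rw [← h4]; congr 1; rw [hpl]; omega
  have hdA : b d = A := by
    rw [hbl d hdn, ← hpl]
    rcases L.walk pl 0 L.pos with ⟨h, -⟩ | ⟨-, h, -⟩
    · rw [h, L.first]
    · exact absurd h (by rw [hpl]; exact not_dvd_of_lt (by omega) (by omega))
  have hgd : g < d := by
    rcases Nat.lt_or_ge g d with h | h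
    · exact h
    · exfalso
      have hgd : g = d := by omega
      apply L.ne (g - 1) (by omega)
      rw [hgA, show g - 1 + 1 = d by omega, hdA]
  obtain ⟨f1, f2⟩ := (L.walk (s0 pl)).forced (y := 0) (t := g) (by omega) (fun i hi => by
    rw [hmi, show -(g : ℤ) + i = -((g : ℤ) - i) by ring, dvd_neg]
    exact not_dvd_of_lt (by omega) (by omega))
  rw [zero_add, hmi] at f1
  have f3 := (L.walk (s0 pl)).stay (y := g) (t := d - g) (by omega) (fun i hi => by
    rw [f1, neg_add_cancel, L.line.bot]
    exact (hnA _ (by omega) (by omega)).symm)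
  refine ⟨s0 pl, pl, g, d, L, hnm, hc, hcN, hr, hstart, hpl, hmi, hg0, hgd, hdn, ?_, hbl, ?_,
    hnA, hdA, ?_, hw0 d hdn.le, ?_, hpos⟩
  · intro r h h'
    rcases lt_trichotomy (W r 0) 0 with h5 | h5 | h5
    · exfalso
      obtain ⟨κ', k1, k2, k3⟩ := hneg r h5
      have := hmin _ k2
      obtain ⟨i, hi⟩ : ∃ i : ℕ, (i : ℤ) = g - 1 + W r 0 := ⟨(g - 1 + W r 0).toNat, by omega⟩
      apply k3 i (by omega)
      rw [hi, ← hgA, hbl _ (by omega)]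
      congr 1; omega
    · exact L.inj _ _ (by rw [h5, hstart])
    · have := hmin r h5
      omega
  · intro i hi
    have := f2 i hi
    rw [zero_add] at this
    rw [← this, hbl _ (by omega), hmi, ← L.line.sym]
    congr 1; omega
  · rw [show g + (d - g) = d by omega] at f3
    rw [f3, f1]; ring
  · intro r h
    obtain ⟨κ, h1, -, -⟩ := hneg r h
    omega

end Ladder

/-! ### The period of a ladder -/

namespace Ladder
variable {n m : ℕ} {lam : ℤ → Letter} {b : ℕ → Letter} {ι : Type} {W : ι → ℕ → ℤ}
  {s0 s1 : ι → ι} {i0 iN mi pl : ι} {g d : ℕ}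

/-- Unless a strand ends at the bottom, its last step is a move. -/
theorem last_move (L : Ladder n m lam b W s0 s1 i0 iN) {r : ι} (hc : ¬ W r m ≡ 0 [ZMOD 2 * n]) :
    W r m = W r (m - 1) + 1 ∧ lam (W r m - 1) = B := by
  have hm := L.pos
  have h := L.walk r (m - 1) (by omega)
  rw [Nat.sub_add_cancel hm, L.last] at h
  rcases h with ⟨h, h'⟩ | ⟨h, hd, h'⟩
  · exact ⟨h', by rw [h', add_sub_cancel_right, h]⟩
  · exfalso
    rw [← h'] at h hd
    rcases FoldedLine.wall_cases hd with h1 | h1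
    · exact hc h1
    · exact h ((L.line.congr h1).trans L.line.top)

namespace Core

/-- The strands `mi`, `i0`, `pl` follow each other with a delay of `d` steps, and `b` has the
period `d`: two consecutive ones are never at walls at the same time. -/
theorem period (K : Core n m lam b W s0 s1 i0 iN mi pl g d) : ∀ y, y + d ≤ m →
    W mi (y + d) = W i0 y ∧ W i0 (y + d) = W pl y ∧ (y + d < m → b (y + d) = b y) := by
  have L := K.ladder
  have hb : ∀ y, y + d < m → W mi (y + d) = W i0 y → W i0 (y + d) = W pl y →
      b (y + d) = b y := by
    intro y hy h1 h2
    have hlt := (L.walk i0).lt L.line (L.walk pl) (by rw [K.start, K.hpl]; have := K.hgd; omega) y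
      (by omega)
    have hle := ((L.walk i0).mono (y := y) (t := d) hy.le).2
    have hoff : ∀ r s, W r (y + d) = W s y → ¬ (n : ℤ) ∣ W s y → b (y + d) = b y := by
      intro r s h h'
      rcases L.walk r (y + d) hy with ⟨h3, -⟩ | ⟨-, h3, -⟩
      · rcases L.walk s y (by omega) with ⟨h4, -⟩ | ⟨-, h4, -⟩
        · rw [← h3, h, h4]
        · exact absurd h4 h'
      · exact absurd (h ▸ h3) h'
    by_cases h0 : (n : ℤ) ∣ W i0 y
    · refine hoff i0 pl h2 (fun h3 => ?_)
      have hdn := K.hdn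
      exact not_dvd_of_lt (n := n) (x := W pl y - W i0 y) (by omega) (by omega) (dvd_sub h3 h0)
    · exact hoff mi i0 h1 h0
  intro y
  induction y with
  | zero =>
    intro hy
    have h1 : W mi (0 + d) = W i0 0 := by rw [zero_add, K.mid, K.start]
    have h2 : W i0 (0 + d) = W pl 0 := by rw [zero_add, K.zerod, K.hpl]
    exact ⟨h1, h2, fun h => hb 0 h h1 h2⟩
  | succ y ih =>
    intro hy
    obtain ⟨h1, h2, h3⟩ := ih (by omega)
    have h3 := h3 (by omega)
    have h1' : W mi (y + 1 + d) = W i0 (y + 1) := by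
      have e1 := L.walk mi (y + d) (by omega)
      rw [h3, h1, show y + d + 1 = y + 1 + d by ring] at e1
      exact e1.det (L.walk i0 y (by omega))
    have h2' : W i0 (y + 1 + d) = W pl (y + 1) := by
      have e1 := L.walk i0 (y + d) (by omega)
      rw [h3, h2, show y + d + 1 = y + 1 + d by ring] at e1
      exact e1.det (L.walk pl y (by omega))
    exact ⟨h1', h2', fun h => hb _ h h1' h2'⟩

theorem dm (K : Core n m lam b W s0 s1 i0 iN mi pl g d) : d < m := K.hdn.trans_le K.le

/-- The last `d` letters of `b`, seen from two strands `u`, `v` with the delay `d`, between whose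
ends there is no wall. -/
theorem suffix_of (K : Core n m lam b W s0 s1 i0 iN mi pl g d) {u v : ι}
    (hx : W v (m - d) = W u m) (hlt : W u m < W v m)
    (hno : ∀ z, W u m < z → z < W v m → ¬ (n : ℤ) ∣ z) :
    ∃ κ < d, (∀ i < κ, b (m - d + i) ≠ B) ∧ b (m - d + κ) = B ∧
      ∀ i, κ + i < d → b (m - d + κ + i) = b (m - 1 - i) := by
  have L := K.ladder
  have hdm := K.dm
  have hd0 : 0 < d := by have := K.hgd; omega
  classical
  have hex : ∃ κ, κ < d ∧ b (m - d + κ) = B :=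
    ⟨d - 1, by omega, by rw [← L.last]; congr 1; omega⟩
  obtain ⟨hκ, hκB⟩ := Nat.find_spec hex
  have hκmin : ∀ i < Nat.find hex, b (m - d + i) ≠ B := fun i hi h =>
    Nat.find_min hex hi ⟨by omega, h⟩
  set κ := Nat.find hex with hκdef
  refine ⟨κ, hκ, hκmin, hκB, ?_⟩
  -- the partner `p` of `u` at the top, which is `u` itself if `u` ends at the top
  obtain ⟨p, κ', hp, h1, h3, h2⟩ : ∃ p, ∃ κ' : ℕ, -W p m ≡ W u m + κ' [ZMOD 2 * n] ∧
      (∀ i < κ', lam (W u m + i) ≠ B) ∧ lam (W u m + κ') = B ∧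
      (∀ i < κ', ¬ (n : ℤ) ∣ W u m + i) := by
    have hBB : ∀ p, lam (-W p m) = B := fun p => by
      rw [L.line.lam_neg]; exact (L.last_move (K.hcN p)).2
    by_cases hu : (n : ℤ) ∣ W u m
    · have hn : W u m ≡ n [ZMOD 2 * n] := by
        rcases FoldedLine.wall_cases hu with h | h
        · exact absurd h (K.hcN u)
        · exact h
      refine ⟨u, 0, ?_, by simp, ?_, by simp⟩
      · obtain ⟨k, hk⟩ := modEq_iff.1 hn
        exact modEq_iff.2 ⟨-2 * k - 1, by push_cast; linear_combination -2 * hk⟩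
      · simpa using (L.line.congr hn).trans L.line.top
    · obtain ⟨κ', h1, h2⟩ := L.top u
      refine ⟨s1 u, κ', h1, h2, by rw [← L.line.congr h1, hBB], fun i hi hd => ?_⟩
      rcases Nat.eq_zero_or_pos i with rfl | hi0
      · simp at hd; exact hu hd
      · have hge : W v m ≤ W u m + i := by
          by_contra h
          exact hno _ (by omega) (by omega) hd
        obtain ⟨j, hj⟩ : ∃ j : ℕ, (j : ℤ) = W v m - 1 - W u m :=
          ⟨(W v m - 1 - W u m).toNat, by omega⟩
        apply h2 j (by omega)
        rw [← (L.last_move (K.hcN v)).2, hj]; congr 1; ring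
  have r1 := (L.walk v).run (y := m - d) (κ := κ) (κ' := κ') (X := B) (by omega) hκmin hκB
    (by rwa [hx]) (by rwa [hx]) (by rwa [hx])
  rw [hx] at r1
  -- from there on, `v` and the reverse of `p` run together up to the end of `v`
  have wv : Walk n lam (fun y => b (m - d + κ + y)) (fun y => W v (m - d + κ + y)) (d - κ) := by
    have := (L.walk v).shift (m - d + κ)
    rwa [show m - (m - d + κ) = d - κ by omega] at this
  have wp := ((L.walk p).rev L.line).le (show d - κ ≤ m by omega)
  have hbv : ∀ i < d - κ, b (m - d + κ + i) = lam (W u m + κ' + i) ∧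
      W v (m - d + κ + i) = W u m + κ' + i := by
    have first := wv 0 (by omega)
    simp only [add_zero, zero_add] at first
    rw [r1, hκB] at first
    have first : W v (m - d + κ + 1) = W u m + κ' + 1 := by
      rcases first with ⟨_, h⟩ | ⟨h, _⟩
      · exact h
      · exact absurd h3 h
    have key : ∀ i, i + 1 ≤ d - κ → W v (m - d + κ + (i + 1)) = W u m + κ' + (i + 1) ∧
        b (m - d + κ + i) = lam (W u m + κ' + i) := by
      intro i
      induction i with
      | zero => intro _; exact ⟨by simpa using first, by simpa [hκB] using h3.symm⟩
      | succ i ih =>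
        intro hi
        obtain ⟨e1, -⟩ := ih (by omega)
        have hlt2 : W v (m - d + κ + (i + 1)) < W v m := by
          have e2 := ((L.walk v).mono (y := m - d + κ + (i + 1))
            (t := d - κ - 1 - (i + 1)) (by omega)).1
          have e3 := (L.last_move (K.hcN v)).1
          rw [show m - d + κ + (i + 1) + (d - κ - 1 - (i + 1)) = m - 1 by omega] at e2
          omega
        rcases wv (i + 1) (by omega) with ⟨h, h'⟩ | ⟨_, h, _⟩
        · simp only at h h'
          rw [e1] at h h'
          refine ⟨?_, ?_⟩
          · refine h'.trans ?_
            push_cast; ring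
          · rw [← h]; push_cast; rfl
        · exfalso
          simp only at h
          rw [e1] at hlt2 h
          exact hno _ (by omega) hlt2 h
    intro i hi
    refine ⟨(key i (by omega)).2, ?_⟩
    rcases i with _ | i
    · simpa using r1
    · have := (key i (by omega)).1
      push_cast; exact this
  intro i hi
  -- the walk `p` never pauses here
  obtain ⟨k, hk⟩ := modEq_iff.1 hp
  have key : ∀ i < d - κ, -W p (m - i) = W u m + κ' + i + 2 * n * k ∧
      b (m - 1 - i) = lam (W u m + κ' + i) := by
    intro i
    induction i with
    | zero =>
      intro _
      refine ⟨by simpa using hk, ?_⟩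
      rw [Nat.sub_zero, L.last, Nat.cast_zero, add_zero, h3]
    | succ i ih =>
      intro hi
      obtain ⟨e1, e2⟩ := ih (by omega)
      have pos1 : -W p (m - (i + 1)) = W u m + κ' + (i + 1 : ℕ) + 2 * n * k := by
        rcases wp i (by omega) with ⟨_, h⟩ | ⟨h, _⟩
        · simp only at h
          rw [h, e1]; push_cast; ring
        · simp only at h
          rw [e1, e2, L.line.per_mul] at h
          exact absurd rfl h
      refine ⟨pos1, ?_⟩
      rcases wp (i + 1) (by omega) with ⟨h, _⟩ | ⟨_, h, _⟩
      · simp only at h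
        rw [pos1, L.line.per_mul] at h
        exact h.symm
      · exfalso
        simp only at h
        rw [pos1, FoldedLine.dvd_of_modEq (y := W u m + κ' + (i + 1 : ℕ))
          (modEq_iff.2 ⟨k, by ring⟩)] at h
        have hlt2 : W v (m - d + κ + (i + 1)) < W v m := by
          have e2 := ((L.walk v).mono (y := m - d + κ + (i + 1))
            (t := d - κ - 1 - (i + 1)) (by omega)).1
          have e3 := (L.last_move (K.hcN v)).1
          rw [show m - d + κ + (i + 1) + (d - κ - 1 - (i + 1)) = m - 1 by omega] at e2
          omega
        rw [(hbv (i + 1) hi).2] at hlt2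
        exact hno _ (by push_cast; omega) hlt2 h
  rw [(key i (by omega)).2, (hbv i (by omega)).1]

/-- The last `d` letters of `b` are a block without `B` and a palindrome. -/
theorem suffix (K : Core n m lam b W s0 s1 i0 iN mi pl g d) :
    ∃ κ < d, (∀ i < κ, b (m - d + i) ≠ B) ∧ b (m - d + κ) = B ∧
      ∀ i, κ + i < d → b (m - d + κ + i) = b (m - 1 - i) := by
  have L := K.ladder
  have hdm := K.dm
  have hdn := K.hdn
  have hgd := K.hgd
  have hg := K.gpos
  obtain ⟨p1, p2, -⟩ := K.period (m - d) (by omega)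
  rw [show m - d + d = m by omega] at p1 p2
  have lt1 := (L.walk mi).lt L.line (L.walk i0) (by rw [K.start, K.hmi]; omega) m le_rfl
  have lt2 := (L.walk i0).lt L.line (L.walk pl) (by rw [K.start, K.hpl]; omega) m le_rfl
  -- the strand `iN` shows that there are no odd walls between the ends
  have hodd : ∀ u v, -g ≤ W u 0 → W v 0 ≤ d → (W u 0 = 0 ∨ W v 0 = 0) →
      ∀ z, W u m < z → z < W v m → ¬ z ≡ n [ZMOD 2 * n] := by
    intro u v hu hv h0 z hz hz' hzn
    obtain ⟨k, hk⟩ := modEq_iff.1 (L.fin.trans hzn.symm)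
    have w := (L.walk iN).add L.line (-k)
    have wm : W iN m + 2 * n * (-k) = z := by rw [hk]; ring
    have h1 : W u 0 < W iN 0 + 2 * n * (-k) := by
      rcases lt_trichotomy (W u 0) (W iN 0 + 2 * n * (-k)) with h | h | h
      · exact h
      · have := (L.walk u).eq w h m le_rfl
        omega
      · have := w.lt L.line (L.walk u) h m le_rfl
        omega
    have h2 : W iN 0 + 2 * n * (-k) < W v 0 := by
      rcases lt_trichotomy (W iN 0 + 2 * n * (-k)) (W v 0) with h | h | h
      · exact h
      · have := w.eq (L.walk v) h m le_rfl
        omega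
      · have := (L.walk v).lt L.line w h m le_rfl
        omega
    have h3 : W iN 0 = W iN 0 + 2 * n * (-k) :=
      eq_of_modEq (modEq_iff.2 ⟨k, by ring⟩) (by linarith [K.hr iN]) (by linarith [K.hr iN])
    rw [← h3] at h1 h2
    have := K.gap iN (by omega) (by omega)
    rw [this, K.start] at h1 h2
    omega
  have hb1 := ((L.walk i0).mono (y := m - d) (t := d) (by omega)).2
  have hb2 := ((L.walk pl).mono (y := m - d) (t := d) (by omega)).2
  rw [show m - d + d = m by omega] at hb1 hb2
  by_cases hA : ∀ z, W mi m < z → z < W i0 m → ¬ (n : ℤ) ∣ z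
  · exact K.suffix_of p1.symm lt1 hA
  by_cases hB : ∀ z, W i0 m < z → z < W pl m → ¬ (n : ℤ) ∣ z
  · exact K.suffix_of p2.symm lt2 hB
  exfalso
  push Not at hA hB
  obtain ⟨z, z1, z2, z3⟩ := hA
  obtain ⟨z', z1', z2', z3'⟩ := hB
  have e1 : z ≡ 0 [ZMOD 2 * n] := (FoldedLine.wall_cases z3).resolve_right
    (hodd mi i0 (by rw [K.hmi]) (by rw [K.start]; omega) (Or.inr K.start) z z1 z2)
  have e2 : z' ≡ 0 [ZMOD 2 * n] := (FoldedLine.wall_cases z3').resolve_right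
    (hodd i0 pl (by rw [K.start]; omega) (by rw [K.hpl]) (Or.inl K.start) z' z1' z2')
  have := eq_of_modEq (e1.trans e2.symm) (by omega) (by omega)
  omega

/-- Every strand has a follower and is a follower. -/
theorem leads (K : Core n m lam b W s0 s1 i0 iN mi pl g d) :
    ∀ s, ∃ r t, Lead n W d r s ∧ Lead n W d s t := by
  have L := K.ladder
  have hdm := K.dm
  have hgd := K.hgd
  have hg := K.gpos
  have hper : ∀ y, y + d < m → b (y + d) = b y := fun y hy => (K.period y hy.le).2.2 hy
  obtain ⟨κ, k1, k2, k3, k4⟩ := K.suffix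
  have top : ∀ {r s}, Lead n W d r s → Lead n W d (s1 s) (s1 r) :=
    L.lead_top K.hcN (g := d - κ) (d := d) (by omega) (by omega) hdm hper
      (fun i hi => by
        have := k4 i (by omega)
        rw [← this]; congr 1; omega)
      (fun i hi hi' => by
        have := k2 (d - 1 - i) (by omega)
        rwa [show m - d + (d - 1 - i) = m - 1 - i by omega] at this)
      (by rw [← hper _ (by omega), ← L.last]; congr 1; omega)
  have bot : ∀ {r s}, Lead n W d r s → Lead n W d (s0 s) (s0 r) :=
    L.lead_bot K.hc hg hgd.le hdm K.pal K.noA K.isA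
  refine L.conn {s | ∃ r t, Lead n W d r s ∧ Lead n W d s t} ?_ ?_ ?_
  · exact ⟨mi, pl, by rw [Lead, K.mid, K.start], by rw [Lead, K.zerod, K.hpl]⟩
  · rintro s ⟨r, t, h1, h2⟩
    exact ⟨s0 t, s0 r, bot h2, bot h1⟩
  · rintro s ⟨r, t, h1, h2⟩
    exact ⟨s1 t, s1 r, top h2, top h1⟩

end Core
end Ladder

/-! ### Ladders of common powers -/

/-- The common shape of the words `b` (of length `m`) and `a` (its beginning of length `n`), if
neither of them is built from the other one. With the palindromes `z k z⁻¹ = b[0, g)`, where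
`z = b[0, q)` and `k` has no `B`, and `h = b[g, d)`, which has no `A`, they are
`(z k z⁻¹ h)^M z` and `(z k z⁻¹ h)^M' z`. -/
def CommonPower (n m : ℕ) (b : ℕ → Letter) : Prop :=
  ∃ d g q M M' : ℕ, 0 < q ∧ 2 * q < g ∧ g < d ∧ n = M * d + q ∧ m = M' * d + q ∧ 0 < M ∧ 0 < M' ∧
    (∀ y, y + d < m → b (y + d) = b y) ∧ (∀ i < g, b i = b (g - 1 - i)) ∧
    (∀ i < d - g, b (g + i) = b (d - 1 - i)) ∧ (∀ i, g ≤ i → i < d → b i ≠ A) ∧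
    (∀ i, q ≤ i → i < g - q → b i ≠ B) ∧ b (q - 1) = B

namespace Ladder.Core
variable {n m : ℕ} {lam : ℤ → Letter} {b : ℕ → Letter} {ι : Type} {W : ι → ℕ → ℤ}
  {s0 s1 : ι → ι} {i0 iN mi pl : ι} {g d : ℕ}

/-- For a strand starting to the right of the bottom, its follower is the next start of a
strand. -/
theorem next (K : Core n m lam b W s0 s1 i0 iN mi pl g d) (r : ι) (hr : 0 ≤ W r 0) (t : ι) (k : ℤ)
    (h1 : W r 0 < W t 0 + 2 * n * k) (h2 : W t 0 + 2 * n * k < W r d) : False := by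
  have L := K.ladder
  have hdm := K.dm
  have hg := K.gpos
  obtain ⟨x, hx⟩ : ∃ x : ℕ, W r 0 = x := ⟨(W r 0).toNat, by omega⟩
  induction x using Nat.strong_induction_on generalizing r t k with
  | _ x ih =>
    obtain ⟨u, -, hu, -⟩ := K.leads t
    obtain ⟨j, hj⟩ := modEq_iff.1 hu
    -- the walk of the leader `u`, shifted to pass through the start in question
    have w := (L.walk u).add L.line (k - j)
    have wd : W u d + 2 * n * (k - j) = W t 0 + 2 * n * k := by rw [hj]; ring
    have hlt : W u 0 + 2 * n * (k - j) < W r 0 := by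
      rcases lt_trichotomy (W u 0 + 2 * n * (k - j)) (W r 0) with h | h | h
      · exact h
      · have := w.eq (L.walk r) h d hdm.le
        omega
      · have := (L.walk r).lt L.line w h d hdm.le
        omega
    have hzero : W t 0 + 2 * n * k < d → False := by
      intro h
      have hdn := K.hdn
      have e : W t 0 = W t 0 + 2 * n * k :=
        eq_of_modEq (modEq_iff.2 ⟨-k, by ring⟩) (by linarith [K.hr t]) (by linarith [K.hr t])
      rw [← e] at h h1
      have := K.gap t (by omega) h
      rw [this, K.start] at h1
      omega
    rcases lt_or_ge (W u 0 + 2 * n * (k - j)) 0 with h0 | h0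
    · have := w.lt L.line (L.walk i0) (by rw [K.start]; exact h0) d hdm.le
      rw [wd, K.zerod] at this
      exact hzero this
    · have e : W u 0 = W u 0 + 2 * n * (k - j) :=
        eq_of_modEq (modEq_iff.2 ⟨-(k - j), by ring⟩) (by linarith [K.hr u, K.hr r])
          (by linarith [K.hr u, K.hr r])
      have e0 : 2 * n * (k - j) = 0 := by linarith
      rw [e0, add_zero] at hlt h0 wd
      refine ih (W u 0).toNat (by omega) u h0 r 0 (by simpa using hlt) ?_ (by omega)
      rw [mul_zero, add_zero, wd]; exact h1

theorem next_eq (K : Core n m lam b W s0 s1 i0 iN mi pl g d) {r : ι} (hr : 0 ≤ W r 0)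
    (h : W r d < n) : W r d = W r 0 + d := by
  have L := K.ladder
  have hdm := K.dm
  rcases hr.eq_or_lt with h0 | h0
  · have : r = i0 := L.inj _ _ (by rw [← h0, K.start])
    rw [this, K.zerod, K.start]; ring
  · have key : ∀ t ≤ d, W r t = W r 0 + t := by
      intro t
      induction t with
      | zero => simp
      | succ t ih =>
        intro ht
        have h1 := ih (by omega)
        have h2 := ((L.walk r).mono (y := t) (t := d - t) (by omega)).1
        rw [show t + (d - t) = d by omega] at h2
        rcases L.walk r t (by omega) with ⟨_, h3⟩ | ⟨_, h3, _⟩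
        · rw [h3, h1]; push_cast; ring
        · exact absurd h3 (not_dvd_of_lt (by omega) (by omega))
    exact key d le_rfl

theorem mul_of_nonneg (K : Core n m lam b W s0 s1 i0 iN mi pl g d) (r : ι) (hr : 0 ≤ W r 0) :
    ∃ j : ℕ, W r 0 = j * d := by
  have L := K.ladder
  have hdm := K.dm
  have hg := K.gpos
  have hgd := K.hgd
  obtain ⟨x, hx⟩ : ∃ x : ℕ, W r 0 = x := ⟨(W r 0).toNat, by omega⟩
  induction x using Nat.strong_induction_on generalizing r with
  | _ x ih =>
    rcases hr.eq_or_lt with h0 | h0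
    · exact ⟨0, by simp [← h0]⟩
    have hd : (d : ℤ) ≤ W r 0 := by
      by_contra h
      have := K.gap r (by omega) (by omega)
      rw [this, K.start] at h0
      omega
    obtain ⟨u, -, hu, -⟩ := K.leads r
    obtain ⟨j, hj⟩ := modEq_iff.1 hu
    have w := (L.walk u).add L.line (-j)
    have wd : W u d + 2 * n * (-j) = W r 0 := by rw [hj]; ring
    have hm := (w.mono (y := 0) (t := d) (by omega))
    simp only [zero_add] at hm
    rcases lt_or_ge (W u 0 + 2 * n * (-j)) 0 with h1 | h1
    · have := w.lt L.line (L.walk i0) (by rw [K.start]; exact h1) d hdm.le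
      rw [wd, K.zerod] at this
      omega
    · have e : W u 0 = W u 0 + 2 * n * (-j) :=
        eq_of_modEq (modEq_iff.2 ⟨j, by ring⟩) (by linarith [K.hr u, K.hr r])
          (by linarith [K.hr u, K.hr r])
      have e0 : 2 * n * (-j) = 0 := by linarith
      rw [e0, add_zero] at wd h1
      have e1 := K.next_eq h1 (by rw [wd]; exact (K.hr r).2)
      obtain ⟨i, hi⟩ := ih (W u 0).toNat (by omega) u h1 (by omega)
      exact ⟨i + 1, by rw [← wd, e1, hi]; push_cast; ring⟩

theorem commonPower (K : Core n m lam b W s0 s1 i0 iN mi pl g d) : CommonPower n m b := by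
  have L := K.ladder
  have hdm := K.dm
  have hdn := K.hdn
  have hnm := K.le
  have hg := K.gpos
  have hgd := K.hgd
  have hper : ∀ y, y + d < m → b (y + d) = b y := fun y hy => (K.period y hy.le).2.2 hy
  -- the last strand `τ` that starts between the bottom and the top
  classical
  let P : ℕ → Prop := fun j => ∃ r, W r 0 = j * d
  have hP1 : P 1 := ⟨pl, by rw [K.hpl]; push_cast; ring⟩
  have hbound : ∀ j, P j → j ≤ n := by
    rintro j ⟨r, hr⟩
    have h1 := (K.hr r).2
    have h2 : (j : ℤ) * 1 ≤ j * d := mul_le_mul_of_nonneg_left (by omega) (by positivity)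
    omega
  let M := Nat.findGreatest P n
  obtain ⟨τ, hτ⟩ : P M := Nat.findGreatest_spec (hbound 1 hP1) hP1
  have hM1 : 1 ≤ M := Nat.le_findGreatest (hbound 1 hP1) hP1
  have hMmax : ∀ j, P j → j ≤ M := fun j hj => Nat.le_findGreatest (hbound j hj) hj
  have hMd : (d : ℤ) ≤ M * d := by
    have : (1 : ℤ) * d ≤ M * d := mul_le_mul_of_nonneg_right (by exact_mod_cast hM1) (by positivity)
    linarith
  have hMn : (M : ℤ) * d < n := by rw [← hτ]; exact (K.hr τ).2
  have hMn' : M * d < n := by exact_mod_cast hMn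
  have hfar : ∀ r, W r 0 = M * d → (n : ℤ) < W r d := by
    intro r hr
    by_contra h
    have hne : W r d ≠ n := fun h => by
      obtain ⟨-, t, -, ht⟩ := K.leads r
      rw [Lead, h] at ht
      exact K.hc t ht.symm
    have h1 := K.next_eq (r := r) (by omega) (by omega)
    obtain ⟨-, t, -, ht⟩ := K.leads r
    have h2 : W r d = W t 0 :=
      eq_of_modEq ht (by linarith [K.hr t]) (by linarith [K.hr t])
    have := hMmax (M + 1) ⟨t, by rw [← h2, h1, hr]; push_cast; ring⟩
    omega
  obtain ⟨q, hq⟩ : ∃ q : ℕ, n = M * d + q := ⟨n - M * d, by omega⟩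
  have hqZ : (n : ℤ) = M * d + q := by exact_mod_cast hq
  have hq0 : 0 < q := by omega
  have hup := ((L.walk τ).mono (y := 0) (t := d) (by omega)).2
  rw [zero_add] at hup
  have hfarτ := hfar τ hτ
  have hqd : q < d := by omega
  have hperM : ∀ j i, i + j * d < m → b (i + j * d) = b i := by
    intro j
    induction j with
    | zero => simp
    | succ j ih =>
      intro i hi
      have h1 : i + (j + 1) * d = i + j * d + d := by ring
      rw [h1] at hi ⊢
      rw [hper _ hi, ih i (by omega)]
  -- labels just below the start of `τ`
  have hlow : ∀ i < d, lam (M * d - 1 - i) = b (d - 1 - i) := by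
    intro i hi
    have hb : M * d = d - 1 - i + (M - 1) * d + 1 + i := by
      obtain ⟨M₀, hM₀⟩ : ∃ M₀, M = M₀ + 1 := ⟨M - 1, by omega⟩
      rw [hM₀, Nat.add_sub_cancel, add_mul]; omega
    rw [← hperM (M - 1) (d - 1 - i) (by omega), K.eq _ (by omega)]
    congr 1
    have : (M : ℤ) * d = ((M * d : ℕ) : ℤ) := by push_cast; ring
    rw [this]; omega
  -- where the partner of `τ` starts
  have hpar : W (s0 τ) 0 = -(M * d) + (d - g) := by
    obtain ⟨κ, h1, h2, h3, h4⟩ := K.posi τ (by omega)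
    have hκ : κ = d - g := by
      rcases Nat.lt_trichotomy κ (d - g) with h | h | h
      · exfalso
        refine K.noA (d - 1 - κ) (by omega) (by omega) ?_
        rw [← hlow κ (by omega), ← h4, hτ, ← L.line.sym]; congr 1; ring
      · exact h
      · exfalso
        apply h3 (d - g) h
        have := hlow (d - g) (by omega)
        rw [show d - 1 - (d - g) = g - 1 - 0 by omega, ← K.pal 0 hg, L.first] at this
        rw [← this, hτ, ← L.line.sym]; congr 1; ring
    rw [h1, hτ, hκ]; omega
  -- where the follower of `τ` starts
  have hτd : W τ d = n + q + (d - g) := by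
    have hle : W τ d ≤ n + q + (d - g) := by
      by_contra h
      exact K.next τ (by omega) (s0 τ) 1 (by rw [hpar, hτ]; omega) (by rw [hpar]; omega)
    obtain ⟨-, t, -, ht⟩ := K.leads τ
    have ht' : W t 0 = W τ d - 2 * n :=
      eq_of_modEq (ht.symm.trans (modEq_iff.2 ⟨1, by ring⟩)) (by linarith [K.hr t])
        (by linarith [K.hr t])
    by_contra hne
    have hneg := K.neg t (by omega)
    obtain ⟨j, hj⟩ := K.mul_of_nonneg (s0 t) (by omega)
    have hjM := hMmax j ⟨_, hj⟩
    have hjd : (j : ℤ) * d ≤ M * d :=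
      mul_le_mul_of_nonneg_right (by exact_mod_cast hjM) (by positivity)
    have hA : lam (-W t 0 - 1) = A := by
      rcases L.walk t 0 L.pos with ⟨h, -⟩ | ⟨-, h, -⟩
      · rw [← L.line.lam_neg, neg_neg, h, L.first]
      · rw [← dvd_neg] at h
        exact absurd h (not_dvd_of_lt (by omega) (by omega))
    obtain ⟨i, hi⟩ : ∃ i : ℕ, (i : ℤ) = M * d + W t 0 := ⟨(M * d + W t 0).toNat, by omega⟩
    have := hlow i (by omega)
    rw [hi, show (M : ℤ) * d - 1 - (M * d + W t 0) = -W t 0 - 1 by ring, hA] at this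
    exact K.noA (d - 1 - i) (by omega) (by omega) this.symm
  -- the pause of `τ` at the top
  obtain ⟨f1, f2⟩ := (L.walk τ).forced (y := 0) (t := q) (by omega) (fun i hi => by
    rw [hτ]; exact not_dvd_of_lt (by omega) (by omega))
  rw [zero_add, hτ, ← hqZ] at f1
  have hex : ∃ i, q ≤ i ∧ i < d ∧ b i = B := by
    by_contra hno
    push Not at hno
    have := (L.walk τ).stay (y := q) (t := d - q) (by omega) (fun i hi => by
      rw [f1, L.line.top]; exact (hno _ (by omega) (by omega)).symm)
    rw [show q + (d - q) = d by omega, f1] at this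
    omega
  obtain ⟨hp1, hp2, hp3⟩ := Nat.find_spec hex
  have hp4 : ∀ i, q ≤ i → i < Nat.find hex → b i ≠ B := fun i h h' h'' =>
    Nat.find_min hex h' ⟨h, by omega, h''⟩
  set e := Nat.find hex
  have f3 := (L.walk τ).stay (y := q) (t := e - q) (by omega) (fun i hi => by
      rw [f1, L.line.top]; exact (hp4 _ (by omega) (by omega)).symm)
  rw [show q + (e - q) = e by omega, f1] at f3
  have f4 : W τ (e + 1) = n + 1 := by
    rcases L.walk τ e (by omega) with ⟨_, h⟩ | ⟨h, _⟩
    · rw [h, f3]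
    · rw [f3, L.line.top, hp3] at h; exact absurd rfl h
  obtain ⟨f5, f6⟩ := (L.walk τ).forced (y := e + 1) (t := d - (e + 1)) (by omega) (fun i hi => by
    rw [f4, show (n : ℤ) + 1 + i = n + (1 + i) by ring, dvd_add_right (dvd_refl _)]
    exact not_dvd_of_lt (by omega) (by omega))
  rw [show e + 1 + (d - (e + 1)) = d by omega, hτd, f4] at f5
  have heq : e + q = g := by omega
  have f7 : ∀ i < d - e, b (e + i) = lam (n + i) := by
    intro i hi
    rcases i with _ | i
    · rw [add_zero, hp3]; simpa using L.line.top.symm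
    · have := f6 i (by omega)
      rw [f4] at this
      rw [show e + (i + 1) = e + 1 + i by ring, ← this]; push_cast; ring_nf
  have hqB : b (q - 1) = B := by
    have := f2 (q - 1) (by omega)
    rw [zero_add] at this
    rw [← this, hτ, ← L.line.top, ← L.line.wall_pred (dvd_refl _)]; congr 1; omega
  have hqe : q < e := by
    rcases hp1.eq_or_lt with h | h
    · exfalso
      apply L.ne (q - 1) (by omega)
      rw [hqB, Nat.sub_add_cancel hq0, h, hp3]
    · exact h
  -- the length of `b`
  obtain ⟨M', ρ, hρ, hm⟩ : ∃ M' ρ, ρ < d ∧ m = M' * d + ρ :=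
    ⟨m / d, m % d, Nat.mod_lt _ (by omega), by rw [mul_comm]; exact (Nat.div_add_mod m d).symm⟩
  have hchain : ∀ j, j * d ≤ m → ∃ s, ∃ k : ℤ, W s (m - j * d) + 2 * n * k = n ∧
      (j * d + 1 ≤ m → W s (m - j * d - 1) + 2 * n * k = n - 1) := by
    intro j
    induction j with
    | zero =>
      intro _
      obtain ⟨k, hk⟩ := modEq_iff.1 L.fin
      have := (L.last_move (K.hcN iN)).1
      refine ⟨iN, -k, by rw [zero_mul, Nat.sub_zero, hk]; ring, fun _ => ?_⟩
      rw [zero_mul, Nat.sub_zero]; linarith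
    | succ j ih =>
      intro hj
      have hj' : (j + 1) * d = j * d + d := by ring
      rw [hj'] at hj ⊢
      obtain ⟨s, k, h1, h2⟩ := ih (by omega)
      obtain ⟨-, t, -, ht⟩ := K.leads s
      obtain ⟨i, hi⟩ := modEq_iff.1 ht
      have w1 := ((L.walk s).shift d).congr (b' := b) (fun y hy => by
        rw [add_comm]; exact hper y (by omega))
      have w2 := ((L.walk t).add L.line i).le (Nat.sub_le m d)
      have w3 := w1.eq w2 hi
      refine ⟨t, i + k, ?_, fun hj2 => ?_⟩
      · have := w3 (m - (j * d + d)) (by omega)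
        simp only [show d + (m - (j * d + d)) = m - j * d by omega] at this
        linear_combination h1 - this
      · have := w3 (m - (j * d + d) - 1) (by omega)
        simp only [show d + (m - (j * d + d) - 1) = m - j * d - 1 by omega] at this
        linear_combination h2 (by omega) - this
  have hρq : ρ = q := by
    obtain ⟨s, k, h1, h2⟩ := hchain M' (by omega)
    rw [show m - M' * d = ρ by omega] at h1 h2
    have hne : W s 0 + 2 * n * k ≠ n := fun h =>
      K.hc s (modEq_iff.2 ⟨-k, by linear_combination h⟩)
    have hρ0 : 0 < ρ := by
      rcases Nat.eq_zero_or_pos ρ with h | h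
      · rw [h] at h1; exact absurd h1 hne
      · exact h
    have h2 := h2 (by omega)
    have w := (L.walk s).add L.line k
    have m1 := w.mono (y := 0) (t := ρ) (by omega)
    simp only [zero_add] at m1
    have hk : W s 0 = W s 0 + 2 * n * k :=
      eq_of_modEq (modEq_iff.2 ⟨-k, by ring⟩) (by linarith [K.hr s]) (by linarith [K.hr s])
    have hk0 : 2 * n * k = 0 := by linarith
    rw [hk0, add_zero] at h1 h2 hne m1
    obtain ⟨j, hj⟩ := K.mul_of_nonneg s (by omega)
    have hjM := hMmax j ⟨s, hj⟩
    have m2 := (L.walk s).mono (y := ρ) (t := d - ρ) (by omega)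
    rw [show ρ + (d - ρ) = d by omega] at m2
    have m3 := ((L.walk s).mono (y := 0) (t := d) (by omega)).2
    rw [zero_add] at m3
    have hjM' : j = M := by
      by_contra h
      have : ((j + 1 : ℕ) : ℤ) * d ≤ M * d :=
        mul_le_mul_of_nonneg_right (by exact_mod_cast (by omega : j + 1 ≤ M)) (by positivity)
      push_cast at this
      rw [add_mul] at this
      omega
    have hsτ : s = τ := L.inj _ _ (by rw [hj, hτ, hjM'])
    rw [hsτ] at h1 h2 m1
    by_contra hne
    rcases Nat.lt_or_ge ρ q with h | h
    · omega
    · have := ((L.walk τ).mono (y := q) (t := ρ - 1 - q) (by omega)).1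
      rw [show q + (ρ - 1 - q) = ρ - 1 by omega] at this
      omega
  subst hρq
  refine ⟨d, g, ρ, M, M', hq0, by omega, hgd, hq, hm, hM1, ?_, hper, K.pal, ?_, K.noA, ?_, hqB⟩
  · rcases Nat.eq_zero_or_pos M' with h | h
    · rw [h] at hm; omega
    · exact h
  · intro i hi
    rw [show g + i = e + (ρ + i) by omega, f7 _ (by omega), ← hlow i (by omega)]
    rw [L.line.refl_wall (dvd_refl _)]
    congr 1; push_cast; omega
  · intro i h h'
    exact hp4 i h (by omega)

end Ladder.Core

/-! ### Ladders with a strand from the top -/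

/-- The word with period `δ` that begins with `κ` letters `A C A C …`, followed by `δ - κ` letters
`B C B C …`. -/
def altWord (κ δ y : ℤ) : Letter :=
  if y % δ < κ then (if Even (y % δ) then A else C) else (if Even (y % δ - κ) then B else C)

/-- The shape of the words `b` (of length `m`) and `a` (its beginning of length `n`), if neither
of them is built from the other one but both are built from the empty word with the same two
connectors: with `σ = A C A … A`, `β = B C B … B` and either `F` empty (`ε = 0`) or `F = C`
(`ε = 1`) both are powers of `σ F β F` without the last `F`. -/
def AltPower (n m : ℕ) (b : ℕ → Letter) : Prop :=
  ∃ κ ℓ ε M M' : ℕ, 0 < κ ∧ 0 < ℓ ∧ ε ≤ 1 ∧ Odd (κ + ε) ∧ Odd (ℓ + ε) ∧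
    n + ε = M * (κ + ℓ) ∧ m + ε = M' * (κ + ℓ) ∧ ∀ y < m, b y = altWord κ (κ + ℓ) y

section
variable {κ ℓ ε : ℕ}

theorem altWord_of_lt {δ r : ℤ} {κ : ℤ} (j : ℤ) (h0 : 0 ≤ r) (h1 : r < δ) :
    altWord κ δ (δ * j + r) =
      if r < κ then (if Even r then A else C) else (if Even (r - κ) then B else C) := by
  rw [altWord, Int.mul_add_emod_self_left, Int.emod_eq_of_lt h0 h1]

theorem altWord_add (κ δ y j : ℤ) : altWord κ δ (y + δ * j) = altWord κ δ y := by
  rw [altWord, Int.add_mul_emod_self_left, altWord]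

theorem exists_phase {δ : ℤ} (hδ : 0 < δ) (y : ℤ) : ∃ j r, y = δ * j + r ∧ 0 ≤ r ∧ r < δ :=
  ⟨y / δ, y % δ, (Int.mul_ediv_add_emod y δ).symm, Int.emod_nonneg _ hδ.ne', Int.emod_lt_of_pos _ hδ⟩

theorem altWord_reflect (hκ : 0 < κ) (hℓ : 0 < ℓ) (hε : ε ≤ 1) (h1 : Odd (κ + ε))
    (h2 : Odd (ℓ + ε)) (t : ℤ) :
    altWord κ (κ + ℓ) t = altWord κ (κ + ℓ) (κ - ε - 1 - t) := by
  obtain ⟨u, hu⟩ := h1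
  obtain ⟨v, hv⟩ := h2
  obtain ⟨j, r, rfl, hr0, hr1⟩ := exists_phase (δ := (κ : ℤ) + ℓ) (by omega) t
  rw [altWord_of_lt j hr0 hr1]
  by_cases h : r ≤ κ - ε - 1
  · rw [show (κ : ℤ) - ε - 1 - ((κ + ℓ) * j + r) = (κ + ℓ) * (-j) + (κ - ε - 1 - r) by ring,
      altWord_of_lt _ (by omega) (by omega), if_pos (show r < (κ : ℤ) by omega),
      if_pos (show (κ : ℤ) - ε - 1 - r < κ by omega)]
    have : Even r ↔ Even ((κ : ℤ) - ε - 1 - r) := by rw [Int.even_iff, Int.even_iff]; omega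
    simp only [this]
  · rw [show (κ : ℤ) - ε - 1 - ((κ + ℓ) * j + r) =
        (κ + ℓ) * (-j - 1) + (κ - ε - 1 - r + (κ + ℓ)) by ring,
      altWord_of_lt _ (by omega) (by omega)]
    by_cases h3 : r < κ
    · rw [if_pos h3, if_neg (by rw [Int.even_iff]; omega), if_neg (by omega),
        if_neg (by rw [Int.even_iff]; omega)]
    · rw [if_neg h3]
      by_cases h4 : κ - ε - 1 - r + (κ + ℓ) < (κ : ℤ)
      · rw [if_pos h4, if_neg (by rw [Int.even_iff]; omega), if_neg (by rw [Int.even_iff]; omega)]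
      · rw [if_neg h4]
        have : Even (r - κ) ↔ Even ((κ : ℤ) - ε - 1 - r + (κ + ℓ) - κ) := by
          rw [Int.even_iff, Int.even_iff]; omega
        simp only [this]

theorem altWord_swap (hκ : 0 < κ) (hℓ : 0 < ℓ) (t : ℤ) :
    (altWord κ (κ + ℓ) (κ + t)).swap = altWord ℓ (ℓ + κ) t := by
  obtain ⟨j, r, rfl, hr0, hr1⟩ := exists_phase (δ := (ℓ : ℤ) + κ) (by omega) t
  rw [altWord_of_lt j hr0 hr1]
  by_cases h : r < ℓ
  · rw [show (κ : ℤ) + ((ℓ + κ) * j + r) = (κ + ℓ) * j + (κ + r) by ring,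
      altWord_of_lt _ (by omega) (by omega), if_neg (by omega), if_pos h, add_sub_cancel_left]
    split_ifs <;> rfl
  · rw [show (κ : ℤ) + ((ℓ + κ) * j + r) = (κ + ℓ) * (j + 1) + (r - ℓ) by ring,
      altWord_of_lt _ (by omega) (by omega), if_pos (by omega), if_neg h]
    split_ifs <;> rfl

theorem AltPower.flip {n m : ℕ} {b : ℕ → Letter}
    (h : AltPower n m (fun y => (b (m - 1 - y)).swap)) : AltPower n m b := by
  obtain ⟨κ, ℓ, ε, M, M', h1, h2, h3, h4, h5, h6, h7, h8⟩ := h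
  refine ⟨ℓ, κ, ε, M, M', h2, h1, h3, h5, h4, by rw [h6]; ring, by rw [h7]; ring, fun y hy => ?_⟩
  have := h8 (m - 1 - y) (by omega)
  simp only [show m - 1 - (m - 1 - y) = y by omega] at this
  have e : ((m - 1 - y : ℕ) : ℤ) = κ - ε - 1 - (κ + y) + (κ + ℓ) * M' := by
    have : (m : ℤ) + ε = M' * (κ + ℓ) := by exact_mod_cast h7
    rw [mul_comm, ← this]
    omega
  rw [e, altWord_add, ← altWord_reflect h1 h2 h3 h4 h5] at this
  rw [← Letter.swap_swap (b y), this, altWord_swap h1 h2]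

/-- Where a maximal block without `A` that ends with `B` can start. -/
theorem altWord_phase {κ ℓ s : ℕ} (hκ : 0 < κ) (hℓ : 0 < ℓ) (hs : 0 < s) {x : ℤ}
    (h1 : altWord κ (κ + ℓ) (x - 1) = A) (h2 : ∀ i < s, altWord κ (κ + ℓ) (x + i) ≠ A)
    (h3 : altWord κ (κ + ℓ) (x + s - 1) = B) :
    ∃ j : ℤ, x = (κ + ℓ) * j + κ - ((κ + 1) % 2 : ℕ) := by
  obtain ⟨j, r, hx, hr0, hr1⟩ := exists_phase (δ := (κ : ℤ) + ℓ) (by omega) (x - 1)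
  rw [hx, altWord_of_lt j hr0 hr1] at h1
  have hrκ : r < κ := by
    by_contra h
    rw [if_neg h] at h1
    split_ifs at h1
  rw [if_pos hrκ] at h1
  have hev : Even r := by
    by_contra h
    rw [if_neg h] at h1
    cases h1
  rw [Int.even_iff] at hev
  have hlast : ¬ r + 2 < κ := by
    intro h
    rcases Nat.lt_or_ge 1 s with hs1 | hs1
    · apply h2 1 hs1
      rw [show x + (1 : ℕ) = (κ + ℓ) * j + (r + 2) by push_cast; linear_combination hx,
        altWord_of_lt j (by omega) (by omega), if_pos h, if_pos (by rw [Int.even_iff]; omega)]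
    · obtain rfl : s = 1 := by omega
      rw [show x + (1 : ℕ) - 1 = (κ + ℓ) * j + (r + 1) by push_cast; linear_combination hx,
        altWord_of_lt j (by omega) (by omega), if_pos (by omega),
        if_neg (by rw [Int.even_iff]; omega)] at h3
      cases h3
  exact ⟨j, by rw [show x = (κ + ℓ) * j + r + 1 by linear_combination hx]; omega⟩

end

namespace Ladder
variable {n m : ℕ} {lam : ℤ → Letter} {b : ℕ → Letter} {ι : Type} {W : ι → ℕ → ℤ}
  {s0 s1 : ι → ι} {i0 iN : ι}

/-- The four phases of a walk that reads `altWord`, the label of the line being the same word. -/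
def AltPhase (n κ ℓ ε : ℕ) (x y : ℤ) : Prop :=
  ∃ k j : ℤ, ∃ i : ℕ,
    (i < n ∧ x = 2 * n * k + i ∧ y = (κ + ℓ) * j + i) ∨
    (i < κ + ε ∧ x = 2 * n * k + n ∧ y = (κ + ℓ) * j - ε + i) ∨
    (i < n ∧ x = 2 * n * k + n + i ∧ y = (κ + ℓ) * j + κ + i) ∨
    (i < ℓ + ε ∧ x = 2 * n * k ∧ y = (κ + ℓ) * j + κ - ε + i)

theorem altPhase_letter_down (L : FoldedLine n lam) {κ ℓ ε M : ℕ} (hκ : 0 < κ) (hℓ : 0 < ℓ)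
    (hε : ε ≤ 1) (h1 : Odd (κ + ε)) (h2 : Odd (ℓ + ε)) (hn : n + ε = M * (κ + ℓ))
    (ha : ∀ i < n, lam (i : ℤ) = altWord κ (κ + ℓ) i) {i : ℕ} (hi : i < n) (k j : ℤ) :
    lam (2 * n * k + n + i) = altWord κ (κ + ℓ) ((κ + ℓ) * j + κ + i) := by
  have e : ((n - 1 - i : ℕ) : ℤ) = κ - ε - 1 - ((κ + ℓ) * j + κ + i) + (κ + ℓ) * (M + j) := by
    have : (n : ℤ) + ε = M * (κ + ℓ) := by exact_mod_cast hn
    rw [show ((n - 1 - i : ℕ) : ℤ) = (n + ε) - ε - 1 - i by omega, this]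
    ring
  have := ha (n - 1 - i) (by omega)
  rw [e, altWord_add, ← altWord_reflect hκ hℓ hε h1 h2, ← e] at this
  rw [← this, add_assoc, add_comm, L.per_mul, L.refl_wall (dvd_refl _)]
  congr 1; omega

theorem altPhase_letter (L : FoldedLine n lam) {κ ℓ ε M : ℕ} (hκ : 0 < κ) (hℓ : 0 < ℓ) (hε : ε ≤ 1)
    (h1 : Odd (κ + ε)) (h2 : Odd (ℓ + ε)) (hn : n + ε = M * (κ + ℓ))
    (ha : ∀ i < n, lam (i : ℤ) = altWord κ (κ + ℓ) i) {x y : ℤ} (h : AltPhase n κ ℓ ε x y)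
    (hx : ¬ (n : ℤ) ∣ x) : lam x = altWord κ (κ + ℓ) y := by
  obtain ⟨k, j, i, ⟨hi, rfl, rfl⟩ | ⟨hi, rfl, rfl⟩ | ⟨hi, rfl, rfl⟩ | ⟨hi, rfl, rfl⟩⟩ := h
  · rw [add_comm, L.per_mul, ha i hi, add_comm _ (i : ℤ), altWord_add]
  · exact absurd ⟨2 * k + 1, by ring⟩ hx
  · exact altPhase_letter_down L hκ hℓ hε h1 h2 hn ha hi k j
  · exact absurd ⟨2 * k, by ring⟩ hx

theorem altPhase_step (L : FoldedLine n lam) {κ ℓ ε M : ℕ} (hκ : 0 < κ) (hℓ : 0 < ℓ) (hε : ε ≤ 1)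
    (h1 : Odd (κ + ε)) (h2 : Odd (ℓ + ε)) (hn : n + ε = M * (κ + ℓ))
    (ha : ∀ i < n, lam (i : ℤ) = altWord κ (κ + ℓ) i) {x x' y : ℤ} (h : AltPhase n κ ℓ ε x y)
    (hs : Stp n lam (altWord κ (κ + ℓ) y) x x') :
    AltPhase n κ ℓ ε x' (y + 1) := by
  have move : lam x = altWord κ (κ + ℓ) y → x' = x + 1 := fun h => by
    rcases hs with ⟨_, h'⟩ | ⟨h', _⟩
    · exact h'
    · exact absurd h h'
  have stay : lam x ≠ altWord κ (κ + ℓ) y → x' = x := fun h => by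
    rcases hs with ⟨h', _⟩ | ⟨_, _, h'⟩
    · exact absurd h' h
    · exact h'
  have hn0 := L.pos
  have hnZ : (n : ℤ) + ε = M * (κ + ℓ) := by exact_mod_cast hn
  obtain ⟨u, hu⟩ := h1
  obtain ⟨v, hv⟩ := h2
  obtain ⟨k, j, i, ⟨hi, rfl, rfl⟩ | ⟨hi, rfl, rfl⟩ | ⟨hi, rfl, rfl⟩ | ⟨hi, rfl, rfl⟩⟩ := h
  · have e := move (by rw [add_comm, L.per_mul, ha i hi, add_comm _ (i : ℤ), altWord_add])
    rcases Nat.lt_or_ge (i + 1) n with h | h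
    · exact ⟨k, j, i + 1, Or.inl ⟨h, by rw [e]; push_cast; ring, by push_cast; ring⟩⟩
    · have hin : (i : ℤ) + 1 = n := by omega
      exact ⟨k, j + M, 0, Or.inr (Or.inl ⟨by omega, by rw [e]; linear_combination hin,
        by push_cast; linear_combination hin + hnZ⟩)⟩
  · have e := stay (by
      rw [add_comm, L.per_mul, L.top]
      by_cases h : i < ε
      · rw [show ((κ : ℤ) + ℓ) * j - ε + i = (κ + ℓ) * (j - 1) + (κ + ℓ - ε + i) by ring,
          altWord_of_lt _ (by omega) (by omega), if_neg (by omega),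
          if_neg (by rw [Int.even_iff]; omega)]
        decide
      · rw [show ((κ : ℤ) + ℓ) * j - ε + i = (κ + ℓ) * j + (i - ε) by ring,
          altWord_of_lt _ (by omega) (by omega), if_pos (by omega)]
        split_ifs <;> decide)
    rcases Nat.lt_or_ge (i + 1) (κ + ε) with h | h
    · exact ⟨k, j, i + 1, Or.inr (Or.inl ⟨h, e, by push_cast; ring⟩)⟩
    · have hin : (i : ℤ) + 1 = κ + ε := by omega
      exact ⟨k, j, 0, Or.inr (Or.inr (Or.inl ⟨hn0, by rw [e]; simp,
        by push_cast; linear_combination hin⟩))⟩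
  · have e := move (altPhase_letter_down L hκ hℓ hε ⟨u, hu⟩ ⟨v, hv⟩ hn ha hi k j)
    rcases Nat.lt_or_ge (i + 1) n with h | h
    · exact ⟨k, j, i + 1, Or.inr (Or.inr (Or.inl
        ⟨h, by rw [e]; push_cast; ring, by push_cast; ring⟩))⟩
    · have hin : (i : ℤ) + 1 = n := by omega
      exact ⟨k + 1, j + M, 0, Or.inr (Or.inr (Or.inr ⟨by omega, by rw [e]; linear_combination hin,
        by push_cast; linear_combination hin + hnZ⟩))⟩
  · have e := stay (by
      have := L.per_mul 0 k
      rw [zero_add] at this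
      rw [this, L.bot]
      by_cases h : i < ε
      · rw [show ((κ : ℤ) + ℓ) * j + κ - ε + i = (κ + ℓ) * j + (κ - ε + i) by ring,
          altWord_of_lt _ (by omega) (by omega), if_pos (by omega),
          if_neg (by rw [Int.even_iff]; omega)]
        decide
      · rw [show ((κ : ℤ) + ℓ) * j + κ - ε + i = (κ + ℓ) * j + (κ - ε + i) by ring,
          altWord_of_lt _ (by omega) (by omega), if_neg (by omega)]
        split_ifs <;> decide)
    rcases Nat.lt_or_ge (i + 1) (ℓ + ε) with h | h
    · exact ⟨k, j, i + 1, Or.inr (Or.inr (Or.inr ⟨h, e, by push_cast; ring⟩))⟩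
    · have hin : (i : ℤ) + 1 = ℓ + ε := by omega
      exact ⟨k, j + 1, 0, Or.inl ⟨hn0, by rw [e]; simp, by push_cast; linear_combination hin⟩⟩

/-- The case of a strand that starts at the top. -/
theorem altPower_of_corner (L : Ladder n m lam b W s0 s1 i0 iN) (hnm : n ≤ m)
    (hc : ∃ r, W r 0 ≡ n [ZMOD 2 * n]) : AltPower n m b := by
  have hn := L.line.pos
  have hm := L.pos
  -- three walks `X`, `Y`, `Z` from `n`, from `-p` and from `0`
  obtain ⟨r, hr⟩ := hc
  obtain ⟨p, hp0, hpn, Y, wY, Y0, hp1, hp2⟩ : ∃ p : ℕ, 0 < p ∧ p < n ∧ ∃ Y : ℕ → ℤ,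
      Walk n lam b Y m ∧ Y 0 = -p ∧ lam (-p) = A ∧ ∀ i < n - p, lam (n + i : ℤ) ≠ A := by
    obtain ⟨κ, h1, h2⟩ := L.bot r
    have hrn : -W r 0 ≡ n [ZMOD 2 * n] := by
      refine hr.neg.trans (modEq_iff.2 ⟨-1, by ring⟩)
    have h2 : ∀ i < κ, lam (n + i) ≠ A := fun i hi => by
      rw [← L.line.congr (hrn.add_right (i : ℤ))]; exact h2 i hi
    have hκ : κ < n := by
      by_contra h
      apply h2 (n - 1) (by omega)
      rw [show (n : ℤ) + (n - 1 : ℕ) = -1 - 0 + 2 * n * 1 by push_cast [hn]; omega, L.line.per_mul,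
        L.line.sym, L.line.bot]
    have h3 : W (s0 r) 0 ≡ -(n - κ : ℕ) [ZMOD 2 * n] := by
      refine h1.trans ((hrn.add_right (κ : ℤ)).trans (modEq_iff.2 ⟨1, ?_⟩))
      push_cast [hκ.le]; ring
    have hκ0 : 0 < κ := by
      rcases Nat.eq_zero_or_pos κ with h | h
      · exfalso
        have e : s0 r = r := L.inj _ _ (h1.trans (by
          rw [h, Nat.cast_zero, add_zero]; exact hrn.trans hr.symm))
        have e2 : r = i0 := by
          by_contra h; exact L.bot_ne r h e
        have := (e2 ▸ hr).symm.trans L.start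
        have h5 : (n : ℤ) = 0 := eq_of_modEq this (by omega) (by omega)
        omega
      · exact h
    obtain ⟨k, hk⟩ := modEq_iff.1 h3
    have w := (L.walk (s0 r)).add L.line (-k)
    have w0 : W (s0 r) 0 + 2 * n * (-k) = -(n - κ : ℕ) := by rw [hk]; ring
    refine ⟨n - κ, by omega, by omega, _, w, w0, ?_, fun i hi => h2 i (by omega)⟩
    rcases w 0 hm with ⟨h, -⟩ | ⟨-, h, -⟩
    · simp only [w0] at h
      rw [h, L.first]
    · simp only [w0] at h
      rw [dvd_neg] at h
      exact absurd h (not_dvd_of_lt (by omega) (by omega))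
  obtain ⟨X, wX, X0⟩ : ∃ X : ℕ → ℤ, Walk n lam b X m ∧ X 0 = n := by
    obtain ⟨k, hk⟩ := modEq_iff.1 hr
    exact ⟨_, (L.walk r).add L.line (-k), by simp only [hk]; ring⟩
  obtain ⟨Z, wZ, Z0⟩ : ∃ Z : ℕ → ℤ, Walk n lam b Z m ∧ Z 0 = 0 := by
    obtain ⟨k, hk⟩ := modEq_iff.1 L.start
    exact ⟨_, (L.walk i0).add L.line (-k), by simp only [hk]; ring⟩
  obtain ⟨hZ, hbl⟩ := walk_from_zero L.line wZ hnm Z0 L.first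
  -- `κ` is the position of the first `B`
  classical
  have hex : ∃ κ, κ < n ∧ b κ = B := ⟨n - 1, by omega, by
    rw [hbl _ (by omega), ← L.line.top, ← L.line.wall_pred (dvd_refl _)]; congr 1; omega⟩
  obtain ⟨hκn, hκB⟩ := Nat.find_spec hex
  have hκmin : ∀ i < Nat.find hex, b i ≠ B := fun i hi h =>
    Nat.find_min hex hi ⟨by omega, h⟩
  set κ := Nat.find hex
  have hκ0 : 0 < κ := by
    rcases Nat.eq_zero_or_pos κ with h | h
    · rw [h, L.first] at hκB; cases hκB
    · exact h
  obtain ⟨ℓ, hℓ⟩ : ∃ ℓ, p + ℓ = n := ⟨n - p, by omega⟩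
  have hℓ0 : 0 < ℓ := by omega
  -- what `X` and `Y` read
  have X1 := wX.stay (y := 0) (t := κ) (by omega) (fun i hi => by
    rw [X0, L.line.top, zero_add]; exact (hκmin i hi).symm)
  rw [zero_add, X0] at X1
  have X2 : X (κ + 1) = n + 1 := by
    rcases wX κ (by omega) with ⟨_, h⟩ | ⟨h, _⟩
    · rw [h, X1]
    · rw [X1, L.line.top, hκB] at h; exact absurd rfl h
  have hX : ∀ i < n, κ + i < m → b (κ + i) = lam (n + i) := by
    intro i hi him
    rcases i with _ | i
    · rw [add_zero, hκB]; simpa using L.line.top.symm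
    · have := (wX.forced (y := κ + 1) (t := i + 1) (by omega) (fun i hi => by
        rw [X2, show (n : ℤ) + 1 + i = n + (1 + i) by ring, dvd_add_right (dvd_refl _)]
        exact not_dvd_of_lt (by omega) (by omega))).2 i (by omega)
      rw [X2] at this
      rw [show κ + (i + 1) = κ + 1 + i by ring, ← this]; push_cast; ring_nf
  have hY : ∀ i < p, b i = lam (-p + i) := by
    intro i hi
    have := (wY.forced (y := 0) (t := p) (by omega) (fun i hi => by
      rw [Y0, show -(p : ℤ) + i = -((p : ℤ) - i) by ring, dvd_neg]
      exact not_dvd_of_lt (by omega) (by omega))).2 i hi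
    rw [Y0, zero_add] at this
    exact this.symm
  -- `b` starts like the alternating word
  have hAC : ∀ i < κ, b i = if Even i then A else C := by
    intro i
    induction i with
    | zero => intro _; simpa using L.first
    | succ i ih =>
      intro hi
      have h1 := ih (by omega)
      have h2 := L.ne i (by omega)
      have h3 := hκmin (i + 1) hi
      simp only [Nat.even_add_one]
      by_cases he : Even i
      · rw [if_pos he] at h1
        rw [if_neg (not_not.2 he)]
        generalize b (i + 1) = z at *
        rw [h1] at h2; cases z <;> simp_all
      · rw [if_neg he] at h1
        rw [if_pos he]
        generalize b (i + 1) = z at *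
        rw [h1] at h2; cases z <;> simp_all
  have hBC : ∀ i < ℓ, κ + i < m → b (κ + i) = if Even i then B else C := by
    intro i
    induction i with
    | zero => intro _ _; simpa using hκB
    | succ i ih =>
      intro hi him
      have h1 := ih (by omega) (by omega)
      have h2 := L.ne (κ + i) (by omega)
      have h3 := hp2 (i + 1) (by omega)
      rw [← hX (i + 1) (by omega) him] at h3
      simp only [Nat.even_add_one]
      rw [show κ + i + 1 = κ + (i + 1) by ring] at h2
      by_cases he : Even i
      · rw [if_pos he] at h1
        rw [if_neg (not_not.2 he)]
        generalize b (κ + (i + 1)) = z at *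
        rw [h1] at h2; cases z <;> simp_all
      · rw [if_neg he] at h1
        rw [if_pos he]
        generalize b (κ + (i + 1)) = z at *
        rw [h1] at h2; cases z <;> simp_all
  have hba : ∀ i < n, b i = altWord κ (κ + ℓ) i := by
    intro i
    induction i using Nat.strong_induction_on with
    | _ i ih =>
      intro hi
      rcases Nat.lt_or_ge i (κ + ℓ) with h | h
      · have := altWord_of_lt (δ := κ + ℓ) (r := i) (κ := κ) 0 (by omega) (by omega)
        rw [mul_zero, zero_add] at this
        rw [this]
        rcases Nat.lt_or_ge i κ with h' | h'
        · rw [hAC i h', if_pos (show (i : ℤ) < κ by omega)]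
          simp only [Int.even_coe_nat]
        · obtain ⟨i', rfl⟩ := Nat.exists_eq_add_of_le h'
          rw [hBC i' (by omega) (by omega), if_neg (show ¬ ((κ + i' : ℕ) : ℤ) < κ by omega)]
          simp only [Nat.cast_add, add_sub_cancel_left, Int.even_coe_nat]
      · obtain ⟨j, rfl⟩ := Nat.exists_eq_add_of_le h
        have := ih j (by omega) (by omega)
        rw [show κ + ℓ + j = κ + (ℓ + j) by ring, hX (ℓ + j) (by omega) (by omega),
          L.line.congr (y := -p + j) (modEq_iff.2 ⟨1, by push_cast; omega⟩),
          ← hY j (by omega), this, ← altWord_add κ (κ + ℓ) j 1]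
        congr 1; push_cast; ring
  have ha : ∀ i < n, lam (i : ℤ) = altWord κ (κ + ℓ) i := fun i hi => by
    rw [← hbl i hi, hba i hi]
  -- the length of `a`
  have hblock : ∀ i < ℓ, lam (p + i : ℤ) ≠ A := by
    intro i hi
    have := hp2 (ℓ - 1 - i) (by omega)
    rw [L.line.refl_wall (dvd_refl _)] at this
    convert this using 2; omega
  have hpA : lam (p - 1) = A := by rw [← L.line.lam_neg, hp1]
  have hnB : lam (n - 1 : ℤ) = B := by rw [L.line.wall_pred (dvd_refl _), L.line.top]
  obtain ⟨j, hj⟩ := altWord_phase hκ0 hℓ0 hℓ0 (x := p)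
    (by have := ha (p - 1) (by omega)
        rw [Nat.cast_sub hp0, Nat.cast_one] at this
        rw [← this, hpA])
    (fun i hi => by
      have := ha (p + i) (by omega)
      push_cast at this
      rw [← this]; exact hblock i hi)
    (by have := ha (n - 1) (by omega)
        rw [Nat.cast_sub hn, Nat.cast_one, hnB, ← hℓ] at this
        push_cast at this
        exact this.symm)
  set ε := (κ + 1) % 2 with hε
  have hε1 : ε ≤ 1 := by omega
  have hκε : Odd (κ + ε) := by rw [Nat.odd_iff]; omega
  have hnZ : (n : ℤ) + ε = (j + 1) * (κ + ℓ) := by rw [← hℓ]; push_cast; linear_combination hj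
  have hj0 : 0 < j + 1 := by
    by_contra h
    have : (j + 1) * ((κ : ℤ) + ℓ) ≤ 0 := by nlinarith
    omega
  obtain ⟨M, hM⟩ : ∃ M : ℕ, (M : ℤ) = j + 1 := ⟨(j + 1).toNat, by omega⟩
  have hnM : n + ε = M * (κ + ℓ) := by
    rw [← hM] at hnZ; exact_mod_cast hnZ
  have hℓε : Odd (ℓ + ε) := by
    have := ha (n - 1) (by omega)
    rw [Nat.cast_sub hn, Nat.cast_one, hnB, show (n : ℤ) - 1 = (κ + ℓ) * j + (κ + ℓ - 1 - ε) by
      linear_combination hnZ] at this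
    have hε2 : ε < ℓ := by
      by_contra h
      rw [altWord_of_lt _ (by omega) (by omega), if_pos (by omega)] at this
      split_ifs at this
    rw [altWord_of_lt _ (by omega) (by omega), if_neg (by omega)] at this
    have hev : Even ((κ : ℤ) + ℓ - 1 - ε - κ) := by
      by_contra h
      rw [if_neg h] at this; cases this
    rw [Nat.odd_iff]; rw [Int.even_iff] at hev
    omega
  -- all of `b` is determined, since `X`, `Y`, `Z` are never at walls simultaneously
  have main : ∀ y < m, b y = altWord κ (κ + ℓ) y ∧
      AltPhase n κ ℓ ε (X y) y ∧ AltPhase n κ ℓ ε (Y y) y ∧ AltPhase n κ ℓ ε (Z y) y := by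
    have step : ∀ y < m, AltPhase n κ ℓ ε (X y) y → AltPhase n κ ℓ ε (Y y) y →
        AltPhase n κ ℓ ε (Z y) y → b y = altWord κ (κ + ℓ) y := by
      intro y hy h1 h2 h3
      have off : ∀ w : ℕ → ℤ, Walk n lam b w m → AltPhase n κ ℓ ε (w y) y → ¬ (n : ℤ) ∣ w y →
          b y = altWord κ (κ + ℓ) y := by
        intro w hw h4 h5
        rw [← altPhase_letter L.line hκ0 hℓ0 hε1 hκε hℓε hnM ha h4 h5]
        rcases hw y hy with ⟨h, _⟩ | ⟨_, h, _⟩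
        · exact h.symm
        · exact absurd h h5
      by_cases hx : (n : ℤ) ∣ X y
      swap
      · exact off X wX h1 hx
      by_cases hy' : (n : ℤ) ∣ Y y
      swap
      · exact off Y wY h2 hy'
      by_cases hz : (n : ℤ) ∣ Z y
      swap
      · exact off Z wZ h3 hz
      exfalso
      have d1 : ¬ X y ≡ Y y [ZMOD 2 * n] := fun h => by
        have := (wX.le hy.le).modEq_back L.line (wY.le hy.le) h 0 (by omega)
        rw [X0, Y0] at this
        have : (n : ℤ) = -p := eq_of_modEq this (by omega) (by omega)
        omega
      have d2 : ¬ X y ≡ Z y [ZMOD 2 * n] := fun h => by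
        have := (wX.le hy.le).modEq_back L.line (wZ.le hy.le) h 0 (by omega)
        rw [X0, Z0] at this
        have : (n : ℤ) = 0 := eq_of_modEq this (by omega) (by omega)
        omega
      have d3 : ¬ Y y ≡ Z y [ZMOD 2 * n] := fun h => by
        have := (wY.le hy.le).modEq_back L.line (wZ.le hy.le) h 0 (by omega)
        rw [Y0, Z0] at this
        have : -(p : ℤ) = 0 := eq_of_modEq this (by omega) (by omega)
        omega
      rcases FoldedLine.wall_cases hx with e1 | e1 <;>
        rcases FoldedLine.wall_cases hy' with e2 | e2 <;>
        rcases FoldedLine.wall_cases hz with e3 | e3 <;>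
        first
        | exact d1 (e1.trans e2.symm)
        | exact d2 (e1.trans e3.symm)
        | exact d3 (e2.trans e3.symm)
    intro y
    induction y with
    | zero =>
      intro hy
      have h1 : AltPhase n κ ℓ ε (X 0) (0 : ℕ) :=
        ⟨0, 0, ε, Or.inr (Or.inl ⟨by omega, by rw [X0]; ring, by simp⟩)⟩
      have h2 : AltPhase n κ ℓ ε (Y 0) (0 : ℕ) :=
        ⟨-1, -1, ℓ, Or.inr (Or.inr (Or.inl ⟨by omega, by rw [Y0]; omega, by push_cast; ring⟩))⟩
      have h3 : AltPhase n κ ℓ ε (Z 0) (0 : ℕ) :=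
        ⟨0, 0, 0, Or.inl ⟨hn, by rw [Z0]; simp, by simp⟩⟩
      exact ⟨step 0 hy h1 h2 h3, h1, h2, h3⟩
    | succ y ih =>
      intro hy
      obtain ⟨h0, h1, h2, h3⟩ := ih (by omega)
      have nxt : ∀ w : ℕ → ℤ, Walk n lam b w m → AltPhase n κ ℓ ε (w y) y →
          AltPhase n κ ℓ ε (w (y + 1)) (y + 1 : ℕ) := by
        intro w hw h
        have h4 := hw y (by omega)
        rw [h0] at h4
        exact_mod_cast altPhase_step L.line hκ0 hℓ0 hε1 hκε hℓε hnM ha h h4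
      exact ⟨step _ hy (nxt X wX h1) (nxt Y wY h2) (nxt Z wZ h3), nxt X wX h1, nxt Y wY h2,
        nxt Z wZ h3⟩
  -- `a` is the end of `b`
  have hend : ∀ i < n, b (m - 1 - i) = lam (n + i) := by
    have w := (L.walk iN).rev L.line
    obtain ⟨k, hk⟩ := modEq_iff.1 L.fin
    have w := w.add L.line (k + 1)
    have w0 : -W iN (m - 0) + 2 * n * (k + 1) = n := by rw [Nat.sub_zero, hk]; ring
    have w1 : -W iN (m - 1) + 2 * n * (k + 1) = n + 1 := by
      rcases w 0 hm with ⟨_, h⟩ | ⟨h, _⟩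
      · simp only [w0, zero_add] at h
        exact h
      · simp only [w0] at h
        rw [L.line.top, Nat.sub_zero, L.last] at h; exact absurd rfl h
    intro i hi
    rcases i with _ | i
    · rw [Nat.sub_zero, L.last]; simpa using L.line.top.symm
    · have := (w.forced (y := 1) (t := i + 1) (by omega) (fun i hi => by
        simp only [w1]
        rw [show (n : ℤ) + 1 + i = n + (1 + i) by ring, dvd_add_right (dvd_refl _)]
        exact not_dvd_of_lt (by omega) (by omega))).2 i (by omega)
      simp only [w1] at this
      rw [add_comm i 1, ← this]; push_cast; ring_nf
  have hend' : ∀ i < n, altWord κ (κ + ℓ) (m - 1 - i) = lam (n + i) := fun i hi => by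
    rw [← hend i hi, (main (m - 1 - i) (by omega)).1]
    congr 1; omega
  obtain ⟨j', hj'⟩ := altWord_phase hκ0 hℓ0 hℓ0 (x := m - ℓ)
    (by rw [show (m : ℤ) - ℓ - 1 = m - 1 - ℓ by ring, hend' ℓ (by omega), ← hp1]
        exact L.line.congr (modEq_iff.2 ⟨1, by omega⟩))
    (fun i hi => by
      have := hend' (ℓ - 1 - i) (by omega)
      rw [show (m : ℤ) - ℓ + i = m - 1 - (ℓ - 1 - i : ℕ) by omega, this]
      exact hp2 _ (by omega))
    (by have := hend' 0 hn
        rw [show (m : ℤ) - ℓ + ℓ - 1 = m - 1 - (0 : ℕ) by push_cast; ring, this]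
        simpa using L.line.top)
  have hmZ : (m : ℤ) + ε = (j' + 1) * (κ + ℓ) := by linear_combination hj'
  have hj0' : 0 < j' + 1 := by
    by_contra h
    have : (j' + 1) * ((κ : ℤ) + ℓ) ≤ 0 := by nlinarith
    omega
  obtain ⟨M', hM'⟩ : ∃ M' : ℕ, (M' : ℤ) = j' + 1 := ⟨(j' + 1).toNat, by omega⟩
  refine ⟨κ, ℓ, ε, M, M', hκ0, hℓ0, hε1, hκε, hℓε, hnM, ?_, fun y hy => (main y hy).1⟩
  rw [← hM'] at hmZ; exact_mod_cast hmZ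

/-- The possible shapes of the two words that belong to a ladder. -/
theorem shapes (L : Ladder n m lam b W s0 s1 i0 iN) (hnm : n ≤ m) :
    (∀ i < n, b i = lam i) ∧ (i0 = iN ∨ CommonPower n m b ∨ AltPower n m b) := by
  have hn := L.line.pos
  constructor
  · obtain ⟨k, hk⟩ := modEq_iff.1 L.start
    exact (walk_from_zero L.line ((L.walk i0).add L.line (-k)) hnm
      (by simp only [hk]; ring) L.first).2
  by_cases hc : ∃ r, W r 0 ≡ n [ZMOD 2 * n]
  · exact Or.inr (Or.inr (L.altPower_of_corner hnm hc))
  by_cases hcN : ∃ r, W r m ≡ 0 [ZMOD 2 * n]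
  · refine Or.inr (Or.inr (AltPower.flip (L.flip.altPower_of_corner hnm ?_)))
    obtain ⟨r, hr⟩ := hcN
    obtain ⟨k, hk⟩ := modEq_iff.1 hr
    exact ⟨r, modEq_iff.2 ⟨-k - 1, by simp only [Nat.sub_zero, hk]; ring⟩⟩
  by_cases hN : ∃ r, r ≠ i0
  · push Not at hc hcN
    -- choose the starts between `-n` and `n`
    have hex : ∀ r, ∃ k : ℤ, -n < W r 0 + 2 * n * k ∧ W r 0 + 2 * n * k < n := by
      intro r
      refine ⟨-((W r 0 + n) / (2 * n)), ?_⟩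
      have h1 := Int.emod_nonneg (W r 0 + n) (show (2 * n : ℤ) ≠ 0 by omega)
      have h2 := Int.emod_lt_of_pos (W r 0 + n) (show (0 : ℤ) < 2 * n by omega)
      have h3 := Int.mul_ediv_add_emod (W r 0 + n) (2 * n)
      have h4 : (W r 0 + n) % (2 * n) ≠ 0 := fun h4 =>
        hc r (modEq_iff.2 ⟨(W r 0 + n) / (2 * n) - 1, by linear_combination h4 - h3⟩)
      have h5 : W r 0 + 2 * n * -((W r 0 + n) / (2 * n)) = (W r 0 + n) % (2 * n) - n := by
        linear_combination -h3
      omega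
    choose k hk using hex
    obtain ⟨mi, pl, g, d, K⟩ := exists_core (L.normalize k) hnm
      (fun r hr => hc r (Int.ModEq.trans (modEq_iff.2 ⟨-k r, by ring⟩) hr))
      (fun r hr => hcN r (Int.ModEq.trans (modEq_iff.2 ⟨-k r, by ring⟩) hr)) hk hN
    exact Or.inr (Or.inl K.commonPower)
  · push Not at hN
    exact Or.inl (hN iN).symm

end Ladder

/-! ### The ladder of a shortest common word -/

/-- A step of a path on the line, in either direction: an edge is crossed if its label is read, and
at walls all the other letters can be read without moving. -/
def FStep (n : ℕ) (lam : ℤ → Letter) (x : Letter) (u v : ℤ) : Prop :=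
  (lam u = x ∧ v = u + 1) ∨ (lam (u - 1) = x ∧ v = u - 1) ∨ (lam u ≠ x ∧ (n : ℤ) ∣ u ∧ v = u)

/-- The word `c` (of length `T`) can be read along a path, which need not be monotone, from the
bottom to the top of the line. -/
def Readable (n : ℕ) (lam : ℤ → Letter) (c : ℕ → Letter) (T : ℕ) : Prop :=
  ∃ x : ℕ → ℤ, x 0 = 0 ∧ x T ≡ n [ZMOD 2 * n] ∧ ∀ t < T, FStep n lam (c t) (x t) (x (t + 1))

/-- Congruence modulo `2 n` and up to sign, that is, equality on the folded line. -/
def FoldEq (n : ℕ) (u v : ℤ) : Prop :=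
  u ≡ v [ZMOD 2 * n] ∨ u ≡ -v [ZMOD 2 * n]

section
open Ladder (modEq_iff eq_of_modEq)
variable {n m : ℕ} {lam lamb : ℤ → Letter}

namespace FoldEq

theorem refl (u : ℤ) : FoldEq n u u := Or.inl (Int.ModEq.refl _)

theorem symm {u v : ℤ} (h : FoldEq n u v) : FoldEq n v u := by
  rcases h with h | h
  · exact Or.inl h.symm
  · exact Or.inr (by simpa using h.symm.neg)

theorem trans {u v w : ℤ} (h : FoldEq n u v) (h' : FoldEq n v w) : FoldEq n u w := by
  rcases h with h | h <;> rcases h' with h' | h'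
  · exact Or.inl (h.trans h')
  · exact Or.inr (h.trans h')
  · exact Or.inr (h.trans h'.neg)
  · exact Or.inl (h.trans (by simpa using h'.neg))

theorem top {u : ℤ} (h : FoldEq n u n) : u ≡ n [ZMOD 2 * n] := by
  rcases h with h | h
  · exact h
  · exact h.trans (modEq_iff.2 ⟨-1, by ring⟩)

/-- Reflection in a wall. -/
theorem wall {v : ℤ} (h : (n : ℤ) ∣ v) (j : ℤ) : FoldEq n (v + j) (v - j) := by
  obtain ⟨k, rfl⟩ := h
  exact Or.inr (modEq_iff.2 ⟨k, by ring⟩)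

end FoldEq

namespace FStep

theorem add (L : FoldedLine n lam) {x : Letter} {u v : ℤ} (h : FStep n lam x u v) (k : ℤ) :
    FStep n lam x (u + 2 * n * k) (v + 2 * n * k) := by
  rcases h with ⟨h, rfl⟩ | ⟨h, rfl⟩ | ⟨h, hd, rfl⟩
  · exact Or.inl ⟨by rwa [L.per_mul], by ring⟩
  · refine Or.inr (Or.inl ⟨?_, by ring⟩)
    rw [← h, ← L.per_mul (u - 1) k]; congr 1; ring
  · exact Or.inr (Or.inr ⟨by rwa [L.per_mul], dvd_add hd ⟨2 * k, by ring⟩, rfl⟩)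

theorem neg (L : FoldedLine n lam) {x : Letter} {u v : ℤ} (h : FStep n lam x u v) :
    FStep n lam x (-u) (-v) := by
  rcases h with ⟨h, rfl⟩ | ⟨h, rfl⟩ | ⟨h, hd, rfl⟩
  · refine Or.inr (Or.inl ⟨?_, by ring⟩)
    rw [← h, ← L.sym u]; congr 1; ring
  · exact Or.inl ⟨by rw [L.lam_neg, h], by ring⟩
  · exact Or.inr (Or.inr ⟨by rwa [L.lam_neg, L.wall_pred hd], by simpa using hd, rfl⟩)

/-- Reading the same letter twice leads back. -/
theorem twice (L : FoldedLine n lam) {x : Letter} {u v w : ℤ} (h : FStep n lam x u v)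
    (h' : FStep n lam x v w) : FoldEq n w u := by
  rcases h with ⟨h, rfl⟩ | ⟨h, rfl⟩ | ⟨h, hd, rfl⟩
  · rcases h' with ⟨h', rfl⟩ | ⟨h', rfl⟩ | ⟨h', hd', rfl⟩
    · by_cases hw : (n : ℤ) ∣ u + 1
      · convert FoldEq.wall hw 1 using 1; ring
      · exact absurd (by rw [add_sub_cancel_right, h, h']) (L.ne _ hw)
    · rw [add_sub_cancel_right]; exact FoldEq.refl _
    · exact absurd (by rw [← L.wall_pred hd', add_sub_cancel_right, h]) h'
  · rcases h' with ⟨h', rfl⟩ | ⟨h', rfl⟩ | ⟨h', hd', rfl⟩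
    · rw [sub_add_cancel]; exact FoldEq.refl _
    · by_cases hw : (n : ℤ) ∣ u - 1
      · convert (FoldEq.wall hw 1).symm using 1; ring
      · exact absurd (by rw [h, h']) (L.ne _ hw)
    · exact absurd h h'
  · rcases h' with ⟨h', rfl⟩ | ⟨h', rfl⟩ | ⟨h', hd', rfl⟩
    · exact absurd h' h
    · rw [L.wall_pred hd] at h'; exact absurd h' h
    · exact FoldEq.refl _

theorem lift (L : FoldedLine n lam) {x : Letter} {u v u' : ℤ} (h : FStep n lam x u v)
    (hu : FoldEq n u u') : ∃ v', FStep n lam x u' v' ∧ FoldEq n v v' := by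
  rcases hu.symm with hu | hu
  · obtain ⟨k, rfl⟩ := modEq_iff.1 hu
    exact ⟨_, h.add L k, Or.inl (modEq_iff.2 ⟨-k, by ring⟩)⟩
  · obtain ⟨k, rfl⟩ := modEq_iff.1 hu
    exact ⟨_, (h.neg L).add L k, Or.inr (modEq_iff.2 ⟨k, by ring⟩)⟩

end FStep

/-- A path that visits the same place of the folded line twice can be shortened. -/
theorem fpath_cut (L : FoldedLine n lam) {c : ℕ → Letter} {x : ℕ → ℤ} {T t s : ℕ}
    (hx : ∀ t < T, FStep n lam (c t) (x t) (x (t + 1))) (hts : t + s ≤ T)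
    (h : FoldEq n (x (t + s)) (x t)) (h0 : x 0 = 0) (hT : x T ≡ n [ZMOD 2 * n]) :
    Readable n lam (fun i => if i < t then c i else c (i + s)) (T - s) := by
  obtain ⟨x', hx0, hx', hx''⟩ : ∃ x' : ℕ → ℤ, (∀ i ≤ t, x' i = x i) ∧
      (∀ i, t ≤ i → i + s ≤ T → FoldEq n (x (i + s)) (x' i)) ∧
      ∀ i, t ≤ i → i + s < T → FStep n lam (c (i + s)) (x' i) (x' (i + 1)) := by
    rcases h.symm with h | h <;> obtain ⟨k, hk⟩ := modEq_iff.1 h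
    · refine ⟨fun i => if i ≤ t then x i else x (i + s) + 2 * n * k, fun i hi => if_pos hi, ?_, ?_⟩
      · intro i hi hi'
        have : (if i ≤ t then x i else x (i + s) + 2 * n * k) = x (i + s) + 2 * n * k := by
          split_ifs with h'
          · obtain rfl : i = t := le_antisymm h' hi
            exact hk
          · rfl
        simp only [this]
        exact Or.inl (modEq_iff.2 ⟨-k, by ring⟩)
      · intro i hi hi'
        have : (if i ≤ t then x i else x (i + s) + 2 * n * k) = x (i + s) + 2 * n * k := by
          split_ifs with h'
          · obtain rfl : i = t := le_antisymm h' hi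
            exact hk
          · rfl
        simp only [this, if_neg (show ¬ i + 1 ≤ t by omega)]
        have := (hx (i + s) hi').add L k
        rwa [show i + s + 1 = i + 1 + s by ring] at this
    · refine ⟨fun i => if i ≤ t then x i else -x (i + s) + 2 * n * k, fun i hi => if_pos hi, ?_, ?_⟩
      · intro i hi hi'
        have : (if i ≤ t then x i else -x (i + s) + 2 * n * k) = -x (i + s) + 2 * n * k := by
          split_ifs with h'
          · obtain rfl : i = t := le_antisymm h' hi
            exact hk
          · rfl
        simp only [this]
        exact Or.inr (modEq_iff.2 ⟨k, by ring⟩)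
      · intro i hi hi'
        have : (if i ≤ t then x i else -x (i + s) + 2 * n * k) = -x (i + s) + 2 * n * k := by
          split_ifs with h'
          · obtain rfl : i = t := le_antisymm h' hi
            exact hk
          · rfl
        simp only [this, if_neg (show ¬ i + 1 ≤ t by omega)]
        have := ((hx (i + s) hi').neg L).add L k
        rwa [show i + s + 1 = i + 1 + s by ring] at this
  refine ⟨x', by rw [hx0 0 (Nat.zero_le _), h0], ?_, fun i hi => ?_⟩
  · have := hx' (T - s) (by omega) (by omega)
    rw [Nat.sub_add_cancel (by omega)] at this
    exact FoldEq.top (this.symm.trans (Or.inl hT))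
  · by_cases hit : i < t
    · simp only [if_pos hit]
      rw [hx0 i hit.le, hx0 (i + 1) hit]
      exact hx i (by omega)
    · simp only [if_neg hit]
      exact hx'' i (by omega) (by omega)

/-- A path without immediate returns can be unfolded to a walk. -/
theorem exists_walk (L : FoldedLine n lam) {c : ℕ → Letter} {x : ℕ → ℤ} {T : ℕ}
    (hc : ∀ t, t + 1 < T → c t ≠ c (t + 1)) (h0 : x 0 = 0)
    (hx : ∀ t < T, FStep n lam (c t) (x t) (x (t + 1))) :
    ∃ w : ℕ → ℤ, w 0 = 0 ∧ Walk n lam c w T ∧ ∀ t ≤ T, FoldEq n (w t) (x t) := by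
  induction T with
  | zero =>
    refine ⟨fun _ => 0, rfl, fun y hy => absurd hy (by omega), fun t ht => ?_⟩
    rw [Nat.le_zero.1 ht, h0]; exact FoldEq.refl _
  | succ T ih =>
    obtain ⟨w, w0, hw, hwx⟩ := ih (fun t ht => hc t (by omega)) (fun t ht => hx t (by omega))
    obtain ⟨v, hv, hxv⟩ := (hx T (by omega)).lift L (hwx T le_rfl).symm
    obtain ⟨v', hv', hvv⟩ : ∃ v', Stp n lam (c T) (w T) v' ∧ FoldEq n v' v := by
      rcases hv with ⟨h, rfl⟩ | ⟨h, rfl⟩ | ⟨h, hd, rfl⟩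
      · exact ⟨_, Or.inl ⟨h, rfl⟩, FoldEq.refl _⟩
      · by_cases hd : (n : ℤ) ∣ w T
        · exact ⟨_, Or.inl ⟨by rw [← L.wall_pred hd, h], rfl⟩, FoldEq.wall hd 1⟩
        · exfalso
          rcases T with _ | T
          · rw [w0] at hd; exact hd (dvd_zero _)
          · rcases hw T (by omega) with ⟨h1, h2⟩ | ⟨_, h1, h2⟩
            · rw [h2, add_sub_cancel_right, h1] at h
              exact hc T (by omega) h
            · rw [← h2] at h1; exact hd h1
      · exact ⟨_, Or.inr ⟨h, hd, rfl⟩, FoldEq.refl _⟩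
    refine ⟨fun t => if t ≤ T then w t else v', by simpa using w0, fun t ht => ?_, fun t ht => ?_⟩
    · rcases Nat.lt_succ_iff_lt_or_eq.1 ht with h | rfl
      · simp only [if_pos h.le, if_pos (show t + 1 ≤ T by omega)]
        exact hw t h
      · simpa using hv'
    · rcases Nat.lt_or_ge T t with h | h
      · obtain rfl : t = T + 1 := by omega
        simp only [if_neg (show ¬ T + 1 ≤ T by omega)]
        exact hvv.trans hxv.symm
      · simp only [if_pos h]
        exact hwx t h

/-- Two words that can be read along both lines have a reading without repetitions. -/
theorem exists_minimal (La : FoldedLine n lam) (Lb : FoldedLine m lamb)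
    (h : ∃ c T, Readable n lam c T ∧ Readable m lamb c T) :
    ∃ c T, ∃ Θ Φ : ℕ → ℤ, Θ 0 = 0 ∧ Φ 0 = 0 ∧ Walk n lam c Θ T ∧ Walk m lamb c Φ T ∧
      Θ T ≡ n [ZMOD 2 * n] ∧ Φ T ≡ m [ZMOD 2 * m] ∧ (∀ t, t + 1 < T → c t ≠ c (t + 1)) ∧
      ∀ t t', t ≤ T → t' ≤ T → FoldEq n (Θ t) (Θ t') → FoldEq m (Φ t) (Φ t') → t = t' := by
  classical
  have hex : ∃ T, ∃ c, Readable n lam c T ∧ Readable m lamb c T := by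
    obtain ⟨c, T, h⟩ := h
    exact ⟨T, c, h⟩
  obtain ⟨c, ⟨x, x0, xT, hx⟩, ⟨y, y0, yT, hy⟩⟩ := Nat.find_spec hex
  have hmin : ∀ T' < Nat.find hex, ¬ ∃ c, Readable n lam c T' ∧ Readable m lamb c T' :=
    fun T' hT' => Nat.find_min hex hT'
  set T := Nat.find hex
  have hdist : ∀ t s, t + s ≤ T → 0 < s → FoldEq n (x (t + s)) (x t) →
      ¬ FoldEq m (y (t + s)) (y t) := by
    intro t s hts hs h1 h2
    exact hmin (T - s) (by omega) ⟨_, fpath_cut La hx hts h1 x0 xT, fpath_cut Lb hy hts h2 y0 yT⟩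
  have hred : ∀ t, t + 1 < T → c t ≠ c (t + 1) := by
    intro t ht he
    refine hdist t 2 (by omega) (by omega) ?_ ?_
    · exact (hx t (by omega)).twice La (he ▸ hx (t + 1) ht)
    · exact (hy t (by omega)).twice Lb (he ▸ hy (t + 1) ht)
  obtain ⟨Θ, Θ0, hΘ, hΘx⟩ := exists_walk La hred x0 hx
  obtain ⟨Φ, Φ0, hΦ, hΦy⟩ := exists_walk Lb hred y0 hy
  have hlt : ∀ t t', t < t' → t' ≤ T → FoldEq n (Θ t) (Θ t') → ¬ FoldEq m (Φ t) (Φ t') := by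
    intro t t' h1 h2 h3 h4
    obtain ⟨s, rfl⟩ := Nat.exists_eq_add_of_lt h1
    refine hdist t (s + 1) (by omega) (by omega) ?_ ?_
    · exact ((hΘx _ h2).symm.trans h3.symm).trans (hΘx _ (by omega))
    · exact ((hΦy _ h2).symm.trans h4.symm).trans (hΦy _ (by omega))
  refine ⟨c, T, Θ, Φ, Θ0, Φ0, hΘ, hΦ, FoldEq.top ((hΘx T le_rfl).trans (Or.inl xT)),
    FoldEq.top ((hΦy T le_rfl).trans (Or.inl yT)), hred, fun t t' ht ht' h1 h2 => ?_⟩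
  rcases Nat.lt_trichotomy t t' with h | h | h
  · exact absurd h2 (hlt t t' h ht' h1)
  · exact h
  · exact absurd h2.symm (hlt t' t h ht h1.symm)

theorem Walk.exists_eq {b : ℕ → Letter} {w : ℕ → ℤ} {T : ℕ} (hw : Walk n lam b w T) {v : ℤ}
    (h0 : w 0 ≤ v) (hT : v ≤ w T) : ∃ t ≤ T, w t = v := by
  induction T with
  | zero => exact ⟨0, le_rfl, le_antisymm h0 hT⟩
  | succ T ih =>
    by_cases h : v ≤ w T
    · obtain ⟨t, ht, h'⟩ := ih (hw.le (by omega)) h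
      exact ⟨t, by omega, h'⟩
    · refine ⟨T + 1, le_rfl, ?_⟩
      rcases hw T (by omega) with ⟨_, h1⟩ | ⟨_, _, h1⟩ <;> omega

end

/-! ### The existence of ladders -/

section
open Ladder (modEq_iff eq_of_modEq)
variable {n m : ℕ} {lam lamb : ℤ → Letter}

theorem FoldedLine.even_wall (L : FoldedLine n lam) {r : ℕ} (hr : Even r) :
    lam ((r : ℤ) * n) = A := by
  obtain ⟨k, rfl⟩ := hr
  rw [← L.bot, ← L.per_mul 0 k]; congr 1; push_cast; ring

theorem FoldedLine.odd_wall (L : FoldedLine n lam) {r : ℕ} (hr : ¬ Even r) :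
    lam ((r : ℤ) * n) = B := by
  obtain ⟨k, rfl⟩ := Nat.not_even_iff_odd.1 hr
  rw [← L.top, ← L.per_mul n k]; congr 1; push_cast; ring

/-- A common reading of two words without repetitions is a ladder: its strands are the `N`
readings of the second word. -/
theorem exists_ladder (La : FoldedLine n lam) (Lb : FoldedLine m lamb)
    (h : ∃ c T, Readable n lam c T ∧ Readable m lamb c T) :
    ∃ (N : ℕ) (W : Fin N → ℕ → ℤ) (s0 s1 : Fin N → Fin N) (i0 iN : Fin N),
      Ladder n m lam (fun y => lamb y) W s0 s1 i0 iN := by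
  obtain ⟨c, T, Θ, Φ, Θ0, Φ0, hΘ, hΦ, ΘT, ΦT, hred, hdist⟩ := exists_minimal La Lb h
  have hm := Lb.pos
  have hmZ : (0 : ℤ) < m := by exact_mod_cast hm
  have hmono : ∀ t t', t ≤ t' → t' ≤ T → Φ t ≤ Φ t' := fun t t' h h' => by
    have := (hΦ.mono (y := t) (t := t' - t) (by omega)).1
    rwa [show t + (t' - t) = t' by omega] at this
  obtain ⟨K, hK⟩ : ∃ K : ℕ, Φ T = ((2 * K + 1 : ℕ) : ℤ) * m := by
    obtain ⟨k, hk⟩ := modEq_iff.1 ΦT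
    have h1 := hmono 0 T (Nat.zero_le _) le_rfl
    rw [Φ0, hk] at h1
    have h2 : 0 ≤ k := by
      by_contra h
      have : (m : ℤ) * (2 * k + 1) < 0 := mul_neg_of_pos_of_neg hmZ (by omega)
      linarith
    exact ⟨k.toNat, by rw [hk]; push_cast; rw [Int.toNat_of_nonneg h2]; ring⟩
  generalize hN : 2 * K + 1 = N at hK
  -- the time at which the `r`-th reading starts
  classical
  let dep : ℕ → ℕ := fun r => Nat.findGreatest (fun t => Φ t = r * m) T
  have dep_le : ∀ r, dep r ≤ T := fun r => Nat.findGreatest_le T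
  have le_dep : ∀ r t : ℕ, t ≤ T → Φ t = r * m → t ≤ dep r := fun r t h1 h2 =>
    Nat.le_findGreatest (P := fun t => Φ t = r * m) h1 h2
  have hdep : ∀ r : ℕ, r ≤ N → Φ (dep r) = r * m := by
    intro r hr
    obtain ⟨t, ht, h⟩ := hΦ.exists_eq (v := r * m) (by rw [Φ0]; positivity) (by
      rw [hK]; exact mul_le_mul_of_nonneg_right (by exact_mod_cast hr) hmZ.le)
    exact Nat.findGreatest_spec (P := fun t => Φ t = r * m) ht h
  have hrun : ∀ r : ℕ, r < N → dep r + m ≤ T ∧ (∀ y ≤ m, Φ (dep r + y) = r * m + y) ∧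
      ∀ y < m, c (dep r + y) = lamb (r * m + y) := by
    intro r hr
    have hlt : (r : ℤ) * m + m ≤ N * m := by
      have : ((r + 1 : ℕ) : ℤ) * m ≤ N * m :=
        mul_le_mul_of_nonneg_right (by exact_mod_cast hr) hmZ.le
      push_cast at this; linarith
    have key : ∀ y ≤ m, dep r + y ≤ T ∧ Φ (dep r + y) = r * m + y ∧
        (0 < y → c (dep r + (y - 1)) = lamb (r * m + (y - 1 : ℕ))) := by
      intro y
      induction y with
      | zero => intro _; exact ⟨dep_le r, by simpa using hdep r hr.le, by simp⟩
      | succ y ih =>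
        intro hy
        obtain ⟨h1, h2, -⟩ := ih (by omega)
        have h3 : dep r + y < T := by
          rcases h1.eq_or_lt with h | h
          · rw [h, hK] at h2; omega
          · exact h
        rcases hΦ _ h3 with ⟨h4, h5⟩ | ⟨_, h4, h5⟩
        · exact ⟨h3, by rw [← add_assoc, h5, h2]; push_cast; ring, fun _ => by
            rw [Nat.add_sub_cancel, ← h4, h2]⟩
        · exfalso
          rcases Nat.eq_zero_or_pos y with rfl | hy0
          · have := le_dep r (dep r + 0 + 1) h3 (by rw [h5, h2]; simp)
            omega
          · rw [h2, dvd_add_right (dvd_mul_left _ _)] at h4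
            exact Ladder.not_dvd_of_lt (by omega) (by omega) h4
    refine ⟨(key m le_rfl).1, fun y hy => (key y hy).2.1, fun y hy => ?_⟩
    have := (key (y + 1) hy).2.2 (by omega)
    simpa using this
  -- between two readings the second walk pauses, and the first one moves
  have hgap : ∀ r : ℕ, r + 1 < N → dep r + m ≤ dep (r + 1) ∧ ∃ κ : ℕ,
      dep (r + 1) = dep r + m + κ ∧ Θ (dep (r + 1)) = Θ (dep r + m) + κ ∧
      ∀ i < κ, lam (Θ (dep r + m) + i) ≠ lamb (((r + 1 : ℕ) : ℤ) * m) := by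
    intro r hr
    obtain ⟨h1, h2, h3⟩ := hrun r (by omega)
    have h4 : Φ (dep r + m) = ((r + 1 : ℕ) : ℤ) * m := by rw [h2 m le_rfl]; push_cast; ring
    have h5 := le_dep (r + 1) _ h1 h4
    refine ⟨h5, dep (r + 1) - (dep r + m), by omega, ?_⟩
    have key : ∀ i, dep r + m + i ≤ dep (r + 1) → Θ (dep r + m + i) = Θ (dep r + m) + i ∧
        (0 < i → lam (Θ (dep r + m) + (i - 1 : ℕ)) ≠ lamb (((r + 1 : ℕ) : ℤ) * m)) := by
      intro i
      induction i with
      | zero => intro _; simp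
      | succ i ih =>
        intro hi
        obtain ⟨e1, -⟩ := ih (by omega)
        have hT := dep_le (r + 1)
        have e2 : ∀ t, dep r + m ≤ t → t ≤ dep (r + 1) → Φ t = ((r + 1 : ℕ) : ℤ) * m := by
          intro t ht ht'
          have a1 := hmono _ t ht (by omega)
          have a2 := hmono t _ ht' hT
          rw [hdep (r + 1) hr.le] at a2
          rw [h4] at a1
          exact le_antisymm a2 a1
        have e3 := e2 (dep r + m + i) (by omega) (by omega)
        have e4 := e2 (dep r + m + i + 1) (by omega) (by omega)
        have e5 : lamb (((r + 1 : ℕ) : ℤ) * m) ≠ c (dep r + m + i) := by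
          rcases hΦ (dep r + m + i) (by omega) with ⟨_, h⟩ | ⟨h, _⟩
          · omega
          · rwa [e3] at h
        rcases hΘ (dep r + m + i) (by omega) with ⟨f1, f2⟩ | ⟨_, _, f2⟩
        · refine ⟨by rw [← add_assoc, f2, e1]; push_cast; ring, fun _ => ?_⟩
          rw [Nat.add_sub_cancel, ← e1, f1]
          exact e5.symm
        · exfalso
          have := hdist (dep r + m + i) (dep r + m + i + 1) (by omega) (by omega)
            (by rw [f2]; exact FoldEq.refl _) (by rw [e3, e4]; exact FoldEq.refl _)
          omega
    refine ⟨?_, fun i hi => ?_⟩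
    · have := (key (dep (r + 1) - (dep r + m)) (by omega)).1
      rwa [show dep r + m + (dep (r + 1) - (dep r + m)) = dep (r + 1) by omega] at this
    · have := (key (i + 1) (by omega)).2 (by omega)
      simpa using this
  have hdep0 : dep 0 = 0 := by
    by_contra h
    have h1 : Φ 1 = 0 := by
      have a1 := hmono 0 1 (by omega) (by have := dep_le 0; omega)
      have a2 := hmono 1 (dep 0) (by omega) (dep_le 0)
      rw [hdep 0 (by omega)] at a2
      rw [Φ0] at a1
      simp only [Nat.cast_zero, zero_mul] at a2
      exact le_antisymm a2 a1
    have h2 : Θ 1 = 0 := by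
      have hT : 0 < T := by have := dep_le 0; omega
      rcases hΦ 0 hT with ⟨_, e⟩ | ⟨e, _, _⟩
      · rw [h1, Φ0] at e; omega
      · rcases hΘ 0 hT with ⟨e', _⟩ | ⟨_, _, e'⟩
        · rw [Φ0, Lb.bot, ← e', Θ0, La.bot] at e; exact absurd rfl e
        · rw [e', Θ0]
    have := hdist 0 1 (by omega) (by have := dep_le 0; omega) (by rw [Θ0, h2]; exact FoldEq.refl _)
      (by rw [Φ0, h1]; exact FoldEq.refl _)
    omega
  have hdepN : dep (N - 1) + m = T := by
    obtain ⟨h1, h2, -⟩ := hrun (N - 1) (by omega)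
    by_contra hne
    have h3 : Φ (dep (N - 1) + m) = Φ T := by
      rw [h2 m le_rfl, hK, Nat.cast_sub (by omega)]; push_cast; ring
    have h4 : Φ (T - 1) = Φ T := by
      have a1 := hmono (dep (N - 1) + m) (T - 1) (by omega) (by omega)
      have a2 := hmono (T - 1) T (by omega) le_rfl
      omega
    have hT : T - 1 < T := by omega
    have h5 : Θ (T - 1) = Θ T := by
      have hs : T - 1 + 1 = T := by omega
      have s1 := hΦ (T - 1) hT
      have s2 := hΘ (T - 1) hT
      rw [hs] at s1 s2
      rcases s1 with ⟨_, e⟩ | ⟨e, _, _⟩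
      · omega
      · rcases s2 with ⟨e', e''⟩ | ⟨_, _, e'⟩
        · exfalso
          apply e
          rw [h4, hK, Lb.odd_wall (by rw [← hN]; simp), ← e',
            show Θ (T - 1) = Θ T - 1 by omega, La.congr (ΘT.sub_right 1),
            La.wall_pred (dvd_refl _), La.top]
        · exact e'.symm
    have := hdist (T - 1) T (by omega) le_rfl (by rw [h5]; exact FoldEq.refl _)
      (by rw [h4]; exact FoldEq.refl _)
    omega
  -- the ladder
  let W : Fin N → ℕ → ℤ := fun r y =>
    if Even r.1 then Θ (dep r + y) else -Θ (dep r + (m - y))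
  have We : ∀ r : Fin N, Even r.1 → ∀ y, W r y = Θ (dep r + y) := fun r hr y => if_pos hr
  have Wo : ∀ r : Fin N, ¬ Even r.1 → ∀ y, W r y = -Θ (dep r + (m - y)) := fun r hr y => if_neg hr
  let s0 : Fin N → Fin N := fun r =>
    if h : Even r.1 then ⟨r.1 - 1, by omega⟩ else ⟨r.1 + 1, by rw [Nat.even_iff] at h; omega⟩
  let s1 : Fin N → Fin N := fun r =>
    if h : Even r.1 then (if h' : r.1 + 1 < N then ⟨r.1 + 1, h'⟩ else r) else ⟨r.1 - 1, by omega⟩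
  have s0e : ∀ r : Fin N, Even r.1 → (s0 r).1 = r.1 - 1 := fun r h => by simp only [s0, dif_pos h]
  have s0o : ∀ r : Fin N, ¬ Even r.1 → (s0 r).1 = r.1 + 1 := fun r h => by simp only [s0, dif_neg h]
  have s1e : ∀ r : Fin N, Even r.1 → r.1 + 1 < N → (s1 r).1 = r.1 + 1 := fun r h h' => by
    simp only [s1, dif_pos h, dif_pos h']
  have s1N : ∀ r : Fin N, Even r.1 → ¬ r.1 + 1 < N → s1 r = r := fun r h h' => by
    simp only [s1, dif_pos h, dif_neg h']
  have s1o : ∀ r : Fin N, ¬ Even r.1 → (s1 r).1 = r.1 - 1 := fun r h => by simp only [s1, dif_neg h]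
  refine ⟨N, W, s0, s1, ⟨0, by omega⟩, ⟨N - 1, by omega⟩, ?_⟩
  have hrefl : ∀ (x : ℤ) (κ i : ℕ), i < κ → lam (-(x + κ) + i) = lam (x + (κ - 1 - i : ℕ)) := by
    intro x κ i hi
    rw [← La.sym]; congr 1; omega
  refine
    { line := La
      pos := hm
      first := Lb.bot
      last := ?_
      ne := fun y hy => ?_
      walk := fun r => ?_
      start := ?_
      fin := ?_
      inj := fun r r' h => ?_
      bot := fun r => ?_
      top := fun r => ?_
      bot_ne := fun r hr he => ?_
      top_ne := fun r hr he => ?_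
      conn := fun S h h0 h1 => ?_
      conn' := fun S h h0 h1 => ?_ }
  · rw [Nat.cast_sub hm, Nat.cast_one, Lb.wall_pred (dvd_refl _), Lb.top]
  · have := Lb.ne (y + 1 : ℕ) (Ladder.not_dvd_of_lt (by omega) (by omega))
    rwa [Nat.cast_add, Nat.cast_one, add_sub_cancel_right] at this
  · obtain ⟨h1, -, h3⟩ := hrun r r.2
    have w := ((hΘ.shift (dep r)).le (show m ≤ T - dep r by omega))
    by_cases hr : Even r.1
    · rw [show W r = fun y => Θ (dep r + y) from funext (We r hr)]
      refine w.congr (fun y hy => ?_)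
      rw [h3 y hy]
      obtain ⟨k, hk⟩ := hr
      rw [← Lb.per_mul y k]; congr 1; rw [hk]; push_cast; ring
    · rw [show W r = fun y => -Θ (dep r + (m - y)) from funext (Wo r hr)]
      refine (w.rev La).congr (fun y hy => ?_)
      rw [h3 (m - 1 - y) (by omega)]
      obtain ⟨k, hk⟩ := Nat.not_even_iff_odd.1 hr
      rw [← Lb.sym y, ← Lb.per_mul (-1 - y) (k + 1)]
      congr 1
      rw [show ((m - 1 - y : ℕ) : ℤ) = m - 1 - y by omega, hk]; push_cast; ring
  · rw [We _ (by simp)]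
    simp only [hdep0, Θ0]
    exact Int.ModEq.refl _
  · rw [We _ (by rw [Nat.even_iff]; simp only; omega)]
    simp only [hdepN]
    exact ΘT
  · -- distinct strands start at distinct places
    obtain ⟨τ, τT, τΦ, τΘ, τd⟩ : ∃ τ : Fin N → ℕ, (∀ r, τ r ≤ T) ∧
        (∀ r, Φ (τ r) = ((2 * ((r.1 + 1) / 2) : ℕ) : ℤ) * m) ∧ (∀ r, FoldEq n (W r 0) (Θ (τ r))) ∧
        ∀ r, τ r = if Even r.1 then dep r else dep r + m := by
      refine ⟨fun r => if Even r.1 then dep r else dep r + m, fun r => ?_, fun r => ?_, fun r => ?_,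
        fun r => rfl⟩
      · have := (hrun r r.2).1
        simp only; split_ifs <;> omega
      · by_cases hr : Even r.1
        · simp only [if_pos hr]
          rw [hdep _ r.2.le]; congr 2
          rw [Nat.even_iff] at hr; omega
        · simp only [if_neg hr]
          rw [(hrun r r.2).2.1 m le_rfl, ← add_one_mul]; congr 1
          rw [Nat.even_iff] at hr
          have : r.1 + 1 = 2 * ((r.1 + 1) / 2) := by omega
          exact_mod_cast this
      · by_cases hr : Even r.1
        · simp only [if_pos hr, We r hr, add_zero]; exact FoldEq.refl _
        · simp only [if_neg hr, Wo r hr, Nat.sub_zero]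
          exact Or.inr (Int.ModEq.refl _)
    have hzero : ∀ k : ℕ, FoldEq m (((2 * k : ℕ) : ℤ) * m) 0 := fun k =>
      Or.inl (modEq_iff.2 ⟨k, by push_cast; ring⟩)
    have hττ : τ r = τ r' := hdist _ _ (τT r) (τT r')
      (((τΘ r).symm.trans (Or.inl h)).trans (τΘ r'))
      (by rw [τΦ, τΦ]; exact (hzero _).trans (hzero _).symm)
    have hΦΦ : (r.1 + 1) / 2 = (r'.1 + 1) / 2 := by
      have := τΦ r
      rw [hττ, τΦ r'] at this
      have := mul_right_cancel₀ hmZ.ne' this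
      omega
    -- the letters on both sides of the bottom are different
    have hno : ∀ r r' : Fin N, Even r.1 → ¬ Even r'.1 → r.1 = r'.1 + 1 → τ r ≠ τ r' := by
      intro r r' hr hr' h1 h2
      rw [τd, τd, if_pos hr, if_neg hr'] at h2
      obtain ⟨a1, -, a3⟩ := hrun r'.1 r'.2
      obtain ⟨b1, -, b3⟩ := hrun r.1 r.2
      apply hred (dep r' + (m - 1)) (by omega)
      rw [a3 (m - 1) (by omega), show dep r' + (m - 1) + 1 = dep r + 0 by omega, b3 0 hm, h1,
        show (r'.1 : ℤ) * m + (m - 1 : ℕ) = ((r'.1 + 1 : ℕ) : ℤ) * m - 1 by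
          rw [Nat.cast_sub hm]; push_cast; ring, Lb.wall_pred (dvd_mul_left _ _)]
      simp
    rcases Nat.lt_trichotomy r.1 r'.1 with h1 | h1 | h1
    · refine absurd hττ.symm (hno r' r ?_ ?_ ?_)
      · rw [Nat.even_iff]; omega
      · rw [Nat.even_iff]; omega
      · omega
    · exact Fin.ext h1
    · refine absurd hττ (hno r r' ?_ ?_ ?_)
      · rw [Nat.even_iff]; omega
      · rw [Nat.even_iff]; omega
      · omega
  · by_cases hr : Even r.1
    · rcases Nat.eq_zero_or_pos r.1 with h0 | h0
      · have : s0 r = r := Fin.ext (by rw [s0e r hr]; omega)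
        refine ⟨0, ?_, by simp⟩
        rw [this, We r hr, h0, hdep0]
        simp [Θ0, Int.ModEq.refl]
      · have hr' : ¬ Even (s0 r).1 := by
          rw [s0e r hr]; rw [Nat.even_iff] at hr ⊢; omega
        obtain ⟨-, κ, k1, k2, k3⟩ := hgap (r.1 - 1) (by omega)
        rw [show r.1 - 1 + 1 = r.1 by omega] at k1 k2 k3
        rw [Lb.even_wall hr] at k3
        refine ⟨κ, ?_, fun i hi => ?_⟩
        · rw [Wo _ hr', We r hr, s0e r hr, Nat.sub_zero, add_zero, k2]
          ring_nf; exact Int.ModEq.refl _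
        · rw [We r hr, add_zero, k2, hrefl _ _ _ hi]
          exact k3 _ (by omega)
    · have hr1 : r.1 + 1 < N := by rw [← s0o r hr]; exact (s0 r).2
      have hr2 : Even (r.1 + 1) := by rw [Nat.even_add_one]; exact hr
      have hr' : Even (s0 r).1 := by rw [s0o r hr]; exact hr2
      obtain ⟨-, κ, k1, k2, k3⟩ := hgap r.1 hr1
      rw [Lb.even_wall hr2] at k3
      refine ⟨κ, ?_, fun i hi => ?_⟩
      · rw [We _ hr', Wo r hr, s0o r hr, Nat.sub_zero, add_zero, k2, neg_neg]
      · rw [Wo r hr, Nat.sub_zero, neg_neg]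
        exact k3 i hi
  · by_cases hr : Even r.1
    · by_cases hr1 : r.1 + 1 < N
      · have hr2 : ¬ Even (r.1 + 1) := by rw [Nat.even_add_one]; exact not_not.2 hr
        have hr' : ¬ Even (s1 r).1 := by rw [s1e r hr hr1]; exact hr2
        obtain ⟨-, κ, k1, k2, k3⟩ := hgap r.1 hr1
        rw [Lb.odd_wall hr2] at k3
        refine ⟨κ, ?_, fun i hi => ?_⟩
        · rw [Wo _ hr', We r hr, s1e r hr hr1, Nat.sub_self, add_zero, k2, neg_neg]
        · rw [We r hr]
          exact k3 i hi
      · refine ⟨0, ?_, by simp⟩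
        rw [s1N r hr hr1, We r hr, show r.1 = N - 1 by omega, hdepN, Nat.cast_zero, add_zero]
        obtain ⟨k, hk⟩ := modEq_iff.1 ΘT
        exact modEq_iff.2 ⟨-2 * k - 1, by linear_combination -2 * hk⟩
    · have h0 : 0 < r.1 := by rw [Nat.even_iff] at hr; omega
      have hr' : Even (s1 r).1 := by
        rw [s1o r hr]; rw [Nat.even_iff] at hr ⊢; omega
      obtain ⟨-, κ, k1, k2, k3⟩ := hgap (r.1 - 1) (by omega)
      rw [show r.1 - 1 + 1 = r.1 by omega] at k1 k2 k3
      rw [Lb.odd_wall hr] at k3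
      refine ⟨κ, ?_, fun i hi => ?_⟩
      · rw [We _ hr', Wo r hr, s1o r hr, Nat.sub_self, add_zero, k2]
        ring_nf; exact Int.ModEq.refl _
      · rw [Wo r hr, Nat.sub_self, add_zero, k2, hrefl _ _ _ hi]
        exact k3 _ (by omega)
  · have h1 := congrArg Fin.val he
    have h2 : r.1 ≠ 0 := fun h => hr (Fin.ext h)
    by_cases h : Even r.1
    · rw [s0e r h] at h1; omega
    · rw [s0o r h] at h1; omega
  · have h1 := congrArg Fin.val he
    have h2 : r.1 ≠ N - 1 := fun h => hr (Fin.ext h)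
    by_cases h : Even r.1
    · rw [s1e r h (by omega)] at h1; omega
    · rw [s1o r h] at h1; rw [Nat.even_iff] at h; omega
  · have key : ∀ i (hi : i < N), (⟨i, hi⟩ : Fin N) ∈ S := by
      intro i
      induction i with
      | zero => intro _; exact h
      | succ i ih =>
        intro hi
        have hm := ih (by omega)
        by_cases he : Even i
        · have := h1 _ hm
          rwa [show s1 ⟨i, by omega⟩ = ⟨i + 1, hi⟩ from Fin.ext (s1e _ he hi)] at this
        · have := h0 _ hm
          rwa [show s0 ⟨i, by omega⟩ = ⟨i + 1, hi⟩ from Fin.ext (s0o _ he)] at this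
    exact fun r => key r.1 r.2
  · have key : ∀ i, i < N → ∀ hi : N - 1 - i < N, (⟨N - 1 - i, hi⟩ : Fin N) ∈ S := by
      intro i
      induction i with
      | zero => intro _ _; exact h
      | succ i ih =>
        intro hi hi'
        have hm := ih (by omega) (by omega)
        by_cases he : Even (N - 1 - i)
        · have := h0 _ hm
          rwa [show s0 ⟨N - 1 - i, by omega⟩ = ⟨N - 1 - (i + 1), hi'⟩ from
            Fin.ext (by rw [s0e _ he]; simp only; omega)] at this
        · have := h1 _ hm
          rwa [show s1 ⟨N - 1 - i, by omega⟩ = ⟨N - 1 - (i + 1), hi'⟩ from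
            Fin.ext (by rw [s1o _ he]; simp only; omega)] at this
    intro r
    have := key (N - 1 - r.1) (by omega) (by omega)
    rwa [show (⟨N - 1 - (N - 1 - r.1), by omega⟩ : Fin N) = r from
      Fin.ext (by simp only; omega)] at this

/-- Two words that can both be read along a third one: the shapes of the two words. -/
theorem shapes_of_readable (La : FoldedLine n lam) (Lb : FoldedLine m lamb) (hnm : n ≤ m)
    (h : ∃ c T, Readable n lam c T ∧ Readable m lamb c T) :
    (∀ i < n, lamb (i : ℕ) = lam i) ∧
      ((∃ w, w 0 = 0 ∧ w m ≡ n [ZMOD 2 * n] ∧ Walk n lam (fun y => lamb y) w m) ∨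
        CommonPower n m (fun y => lamb y) ∨ AltPower n m (fun y => lamb y)) := by
  obtain ⟨N, W, s0, s1, i0, iN, L⟩ := exists_ladder La Lb h
  obtain ⟨h1, h2⟩ := L.shapes hnm
  refine ⟨h1, h2.imp_left (fun he => ?_)⟩
  obtain ⟨k, hk⟩ := modEq_iff.1 L.start
  refine ⟨fun y => W i0 y + 2 * n * (-k), by simp only [hk]; ring, ?_, (L.walk i0).add La (-k)⟩
  rw [he]
  exact Int.ModEq.trans (modEq_iff.2 ⟨-k, by ring⟩) L.fin

end

/-! ### The words of expanded even vectors -/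

/-- `Enc τ x v w σ y`: the nonempty expanded even vector `v` has the word `w`. Every entry `± 2`
yields a letter, `A` and `B` alternating with the position in `v`; between the letters of two
successive entries `± 2` the letter `C` is inserted if these entries differ or are separated by
an entry `0`. So `v` and `- v` have the same word. The first and last entries of `v` are `x` and
`y`, the first and last letters of `w` are `τ` and `σ`. -/
inductive Enc : Letter → ℤ → List ℤ → List Letter → Letter → ℤ → Prop
  | one (τ : Letter) (x : ℤ) (hτ : τ ≠ C) (hx : x = 2 ∨ x = -2) : Enc τ x [x] [τ] τ x
  | same {τ σ : Letter} {x y : ℤ} {v : List ℤ} {w : List Letter} :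
      Enc τ.swap x v w σ y → Enc τ x (x :: v) (τ :: w) σ y
  | opp {τ σ : Letter} {x y : ℤ} {v : List ℤ} {w : List Letter} :
      Enc τ.swap (-x) v w σ y → Enc τ x (x :: v) (τ :: C :: w) σ y
  | zero {τ σ : Letter} {x y : ℤ} {v : List ℤ} {w : List Letter} :
      Enc τ x v w σ y → Enc τ x (x :: 0 :: v) (τ :: C :: w) σ y

theorem Letter.swap_ne_C {τ : Letter} : τ.swap ≠ C ↔ τ ≠ C := by cases τ <;> simp [Letter.swap]

theorem Letter.swap_ne_self {τ : Letter} (h : τ ≠ C) : τ.swap ≠ τ := by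
  cases τ <;> simp_all [Letter.swap]

theorem Letter.eq_or_eq_swap {τ ρ : Letter} (h : τ ≠ C) (h' : ρ ≠ C) : ρ = τ ∨ ρ = τ.swap := by
  cases τ <;> cases ρ <;> simp_all [Letter.swap]

namespace Enc
variable {τ σ ρ : Letter} {x y z : ℤ} {v v' : List ℤ} {w w' : List Letter}

theorem left_ne (h : Enc τ x v w σ y) : τ ≠ C ∧ (x = 2 ∨ x = -2) := by
  induction h with
  | one τ x hτ hx => exact ⟨hτ, hx⟩
  | same _ ih => exact ⟨Letter.swap_ne_C.1 ih.1, ih.2⟩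
  | opp _ ih => exact ⟨Letter.swap_ne_C.1 ih.1, by omega⟩
  | zero _ ih => exact ih

theorem right_ne (h : Enc τ x v w σ y) : σ ≠ C ∧ (y = 2 ∨ y = -2) := by
  induction h with
  | one τ x hτ hx => exact ⟨hτ, hx⟩
  | same _ ih => exact ih
  | opp _ ih => exact ih
  | zero _ ih => exact ih

theorem cons_vec (h : Enc τ x v w σ y) : ∃ v', v = x :: v' := by cases h <;> exact ⟨_, rfl⟩

theorem cons_word (h : Enc τ x v w σ y) : ∃ w', w = τ :: w' := by cases h <;> exact ⟨_, rfl⟩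

theorem append_same (h : Enc τ x v w σ y) (h' : Enc σ.swap y v' w' ρ z) :
    Enc τ x (v ++ v') (w ++ w') ρ z := by
  induction h with
  | one τ x hτ hx => exact same h'
  | same _ ih => exact same (ih h')
  | opp _ ih => exact opp (ih h')
  | zero _ ih => exact zero (ih h')

theorem append_opp (h : Enc τ x v w σ y) (h' : Enc σ.swap (-y) v' w' ρ z) :
    Enc τ x (v ++ v') (w ++ C :: w') ρ z := by
  induction h with
  | one τ x hτ hx => exact opp h'
  | same _ ih => exact same (ih h')
  | opp _ ih => exact opp (ih h')
  | zero _ ih => exact zero (ih h')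

theorem append_zero (h : Enc τ x v w σ y) (h' : Enc σ y v' w' ρ z) :
    Enc τ x (v ++ 0 :: v') (w ++ C :: w') ρ z := by
  induction h with
  | one τ x hτ hx => exact zero h'
  | same _ ih => exact same (ih h')
  | opp _ ih => exact opp (ih h')
  | zero _ ih => exact zero (ih h')

theorem reverse (h : Enc τ x v w σ y) : Enc σ y v.reverse w.reverse τ x := by
  induction h with
  | one τ x hτ hx => exact one τ x hτ hx
  | @same τ σ x y v w h ih =>
    simp only [List.reverse_cons]
    refine ih.append_same ?_
    rw [Letter.swap_swap]
    exact one τ x (Letter.swap_ne_C.1 h.left_ne.1) h.left_ne.2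
  | @opp τ σ x y v w h ih =>
    simp only [List.reverse_cons, List.append_assoc, List.singleton_append]
    refine ih.append_opp ?_
    rw [Letter.swap_swap, neg_neg]
    have := h.left_ne.2
    exact one τ x (Letter.swap_ne_C.1 h.left_ne.1) (by omega)
  | @zero τ σ x y v w h ih =>
    simp only [List.reverse_cons, List.append_assoc, List.singleton_append]
    exact ih.append_zero (one τ x h.left_ne.1 h.left_ne.2)

theorem neg (h : Enc τ x v w σ y) : Enc τ (-x) (smulVec (-1) v) w σ (-y) := by
  induction h with
  | one τ x hτ hx =>
    simp only [smulVec, List.map_cons, List.map_nil, neg_one_mul]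
    exact one τ _ hτ (by omega)
  | same _ ih =>
    simp only [smulVec, List.map_cons, neg_one_mul] at ih ⊢
    exact same ih
  | opp _ ih =>
    simp only [smulVec, List.map_cons, neg_one_mul] at ih ⊢
    exact opp ih
  | zero _ ih =>
    simp only [smulVec, List.map_cons, neg_one_mul, neg_zero] at ih ⊢
    exact zero ih

theorem smul (h : Enc τ x v w σ y) {ε : ℤ} (hε : ε = 1 ∨ ε = -1) :
    Enc τ (ε * x) (smulVec ε v) w σ (ε * y) := by
  rcases hε with rfl | rfl
  · simpa [smulVec] using h
  · simpa using h.neg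

theorem swap (h : Enc τ x v w σ y) : Enc τ.swap x v (w.map Letter.swap) σ.swap y := by
  induction h with
  | one τ x hτ hx => exact one _ _ (Letter.swap_ne_C.2 hτ) hx
  | same _ ih => exact same ih
  | opp _ ih => exact opp ih
  | zero _ ih => exact zero ih

theorem chain (h : Enc τ x v w σ y) : w.IsChain (· ≠ ·) := by
  induction h with
  | one τ x hτ hx => exact List.isChain_singleton _
  | @same τ σ x y v w h ih =>
    obtain ⟨w', rfl⟩ := h.cons_word
    exact List.isChain_cons_cons.2
      ⟨(Letter.swap_ne_self (Letter.swap_ne_C.1 h.left_ne.1)).symm, ih⟩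
  | @opp τ σ x y v w h ih =>
    obtain ⟨w', rfl⟩ := h.cons_word
    exact List.isChain_cons_cons.2 ⟨Letter.swap_ne_C.1 h.left_ne.1,
      List.isChain_cons_cons.2 ⟨h.left_ne.1.symm, ih⟩⟩
  | @zero τ σ x y v w h ih =>
    obtain ⟨w', rfl⟩ := h.cons_word
    exact List.isChain_cons_cons.2 ⟨h.left_ne.1,
      List.isChain_cons_cons.2 ⟨h.left_ne.1.symm, ih⟩⟩

theorem getLast_word (h : Enc τ x v w σ y) : w.getLast? = some σ := by
  induction h with
  | one τ x hτ hx => rfl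
  | same h ih => obtain ⟨w', rfl⟩ := h.cons_word; simpa [List.getLast?_cons_cons] using ih
  | opp h ih => obtain ⟨w', rfl⟩ := h.cons_word; simpa [List.getLast?_cons_cons] using ih
  | zero h ih => obtain ⟨w', rfl⟩ := h.cons_word; simpa [List.getLast?_cons_cons] using ih

theorem parity (h : Enc τ x v w σ y) : Even v.length ↔ σ = τ.swap := by
  induction h with
  | one τ x hτ hx => simpa using (Letter.swap_ne_self hτ).symm
  | @same τ σ x y v w h ih =>
    rw [List.length_cons, Nat.even_add_one, ih, Letter.swap_swap]
    have h1 := Letter.swap_ne_C.1 h.left_ne.1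
    constructor
    · intro h2
      exact (Letter.eq_or_eq_swap h1 h.right_ne.1).resolve_left h2
    · rintro rfl; exact Letter.swap_ne_self h1
  | @opp τ σ x y v w h ih =>
    rw [List.length_cons, Nat.even_add_one, ih, Letter.swap_swap]
    have h1 := Letter.swap_ne_C.1 h.left_ne.1
    constructor
    · intro h2
      exact (Letter.eq_or_eq_swap h1 h.right_ne.1).resolve_left h2
    · rintro rfl; exact Letter.swap_ne_self h1
  | zero _ ih =>
    rw [List.length_cons, List.length_cons, Nat.even_add_one, Nat.even_add_one, not_not, ih]

theorem word_unique (h : Enc τ x v w σ y) {σ' : Letter} {y' : ℤ} (h' : Enc τ x v w' σ' y') :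
    w = w' ∧ σ = σ' ∧ y = y' := by
  induction h generalizing w' with
  | one τ x hτ hx =>
    cases h' with
    | one => exact ⟨rfl, rfl, rfl⟩
    | same h' => obtain ⟨_, h⟩ := h'.cons_vec; cases h
    | opp h' => obtain ⟨_, h⟩ := h'.cons_vec; cases h
  | same h ih =>
    have hx := h.left_ne.2
    obtain ⟨_, rfl⟩ := h.cons_vec
    cases h' with
    | same h' => obtain ⟨rfl, rfl, rfl⟩ := ih h'; exact ⟨rfl, rfl, rfl⟩
    | opp h' =>
      obtain ⟨_, e⟩ := h'.cons_vec
      have := (List.cons.inj e).1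
      omega
    | zero h' => omega
  | @opp τ σ x y v w h ih =>
    have hx := h.left_ne.2
    obtain ⟨_, rfl⟩ := h.cons_vec
    generalize hu : -x = u at *
    cases h' with
    | same h' =>
      obtain ⟨_, e⟩ := h'.cons_vec
      have := (List.cons.inj e).1
      omega
    | opp h' => obtain ⟨rfl, rfl, rfl⟩ := ih (hu ▸ h'); exact ⟨rfl, rfl, rfl⟩
    | zero h' => omega
  | zero h ih =>
    have hx := h.left_ne.2
    cases h' with
    | same h' =>
      obtain ⟨_, h⟩ := h'.cons_vec
      have := (List.cons.inj h).1
      omega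
    | opp h' =>
      obtain ⟨_, h⟩ := h'.cons_vec
      have := (List.cons.inj h).1
      omega
    | zero h' => obtain ⟨rfl, rfl, rfl⟩ := ih h'; exact ⟨rfl, rfl, rfl⟩

theorem vec_unique (h : Enc τ x v w σ y) {σ' : Letter} {y' : ℤ} (h' : Enc τ x v' w σ' y') :
    v = v' := by
  induction h generalizing v' with
  | one τ x hτ hx =>
    cases h' with
    | one => rfl
    | same h' => obtain ⟨_, h⟩ := h'.cons_word; cases h
  | @same τ σ x y v w h ih =>
    have hτ := h.left_ne.1
    obtain ⟨_, rfl⟩ := h.cons_word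
    generalize hρ : τ.swap = ρ at *
    cases h' with
    | same h' => rw [ih (hρ ▸ h')]
    | opp h' => exact absurd rfl hτ
    | zero h' => exact absurd rfl hτ
  | @opp τ σ x y v w h ih =>
    have hτ := h.left_ne.1
    cases h' with
    | same h' =>
      obtain ⟨_, e⟩ := h'.cons_word
      exact absurd (List.cons.inj e).1.symm hτ
    | opp h' => rw [ih h']
    | zero h' =>
      obtain ⟨_, rfl⟩ := h.cons_word
      obtain ⟨_, e⟩ := h'.cons_word
      exact absurd (List.cons.inj e).1 (Letter.swap_ne_self (Letter.swap_ne_C.1 hτ))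
  | @zero τ σ x y v w h ih =>
    have hτ := h.left_ne.1
    cases h' with
    | same h' =>
      obtain ⟨_, e⟩ := h'.cons_word
      exact absurd (List.cons.inj e).1.symm (Letter.swap_ne_C.2 hτ)
    | opp h' =>
      obtain ⟨_, rfl⟩ := h.cons_word
      obtain ⟨_, e⟩ := h'.cons_word
      exact absurd (List.cons.inj e).1.symm (Letter.swap_ne_self hτ)
    | zero h' => rw [ih h']

theorem exists_of_word : ∀ (w : List Letter) (τ : Letter) (x : ℤ), (τ :: w).IsChain (· ≠ ·) →
    τ ≠ C → (τ :: w).getLast? ≠ some C → (x = 2 ∨ x = -2) →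
    ∃ v σ y, Enc τ x v (τ :: w) σ y
  | [], τ, x, _, hτ, _, hx => ⟨_, _, _, one τ x hτ hx⟩
  | C :: [], τ, x, _, _, hl, _ => absurd (by simp) hl
  | C :: ρ :: w, τ, x, hc, hτ, hl, hx => by
    rw [List.isChain_cons_cons, List.isChain_cons_cons] at hc
    rw [List.getLast?_cons_cons, List.getLast?_cons_cons] at hl
    have hρ : ρ ≠ C := hc.2.1.symm
    rcases Letter.eq_or_eq_swap hτ hρ with rfl | rfl
    · obtain ⟨v, σ, y, h⟩ := exists_of_word w ρ x hc.2.2 hρ hl hx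
      exact ⟨_, _, _, zero h⟩
    · obtain ⟨v, σ, y, h⟩ := exists_of_word w _ (-x) hc.2.2 hρ hl (by omega)
      exact ⟨_, _, _, opp h⟩
  | A :: w, τ, x, hc, hτ, hl, hx => by
    rw [List.isChain_cons_cons] at hc
    rw [List.getLast?_cons_cons] at hl
    obtain ⟨v, σ, y, h⟩ := exists_of_word w A x hc.2 (by decide) hl hx
    rcases Letter.eq_or_eq_swap hτ (show A ≠ C by decide) with h' | h'
    · exact absurd h'.symm hc.1
    · exact ⟨_, _, _, same (τ := τ) (x := x) (by rw [← h']; exact h)⟩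
  | B :: w, τ, x, hc, hτ, hl, hx => by
    rw [List.isChain_cons_cons] at hc
    rw [List.getLast?_cons_cons] at hl
    obtain ⟨v, σ, y, h⟩ := exists_of_word w B x hc.2 (by decide) hl hx
    rcases Letter.eq_or_eq_swap hτ (show B ≠ C by decide) with h' | h'
    · exact absurd h'.symm hc.1
    · exact ⟨_, _, _, same (τ := τ) (x := x) (by rw [← h']; exact h)⟩

theorem isExpandedEven (h : Enc τ x v w σ y) : IsExpandedEven v := by
  have key : (∀ z ∈ v, z = -2 ∨ z = 0 ∨ z = 2) ∧ v.getLast? = some y ∧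
      ∀ (i : ℕ) (h : i + 2 < v.length), v[i + 1] = 0 →
        v[i] = v[i + 2] ∧ (v[i] = 2 ∨ v[i] = -2) := by
    induction h with
    | one τ x hτ hx =>
      refine ⟨fun z hz => ?_, rfl, fun i h => by simp at h⟩
      rw [List.mem_singleton] at hz; omega
    | @same τ σ x y v w h ih =>
      obtain ⟨h1, h2, h3⟩ := ih
      have hx := h.left_ne.2
      obtain ⟨v', rfl⟩ := h.cons_vec
      refine ⟨fun z hz => ?_, by simpa [List.getLast?_cons_cons] using h2, fun i hi h0 => ?_⟩
      · rcases List.mem_cons.1 hz with rfl | hz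
        · omega
        · exact h1 z hz
      · rcases i with _ | i
        · simp at h0; omega
        · exact h3 i (by simpa using hi) h0
    | @opp τ σ x y v w h ih =>
      obtain ⟨h1, h2, h3⟩ := ih
      have hx := h.left_ne.2
      obtain ⟨v', rfl⟩ := h.cons_vec
      refine ⟨fun z hz => ?_, by simpa [List.getLast?_cons_cons] using h2, fun i hi h0 => ?_⟩
      · rcases List.mem_cons.1 hz with rfl | hz
        · omega
        · exact h1 z hz
      · rcases i with _ | i
        · simp at h0; omega
        · exact h3 i (by simpa using hi) h0
    | @zero τ σ x y v w h ih =>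
      obtain ⟨h1, h2, h3⟩ := ih
      have hx := h.left_ne.2
      obtain ⟨v', rfl⟩ := h.cons_vec
      refine ⟨fun z hz => ?_, by simpa [List.getLast?_cons_cons] using h2, fun i hi h0 => ?_⟩
      · rcases List.mem_cons.1 hz with rfl | hz
        · omega
        rcases List.mem_cons.1 hz with rfl | hz
        · omega
        · exact h1 z hz
      · rcases i with _ | _ | i
        · exact ⟨rfl, hx⟩
        · simp at h0; omega
        · exact h3 i (by simp at hi ⊢; omega) h0
  obtain ⟨h1, h2, h3⟩ := key
  refine ⟨h1, ?_, ?_, h3⟩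
  · obtain ⟨v', rfl⟩ := h.cons_vec
    have := h.left_ne.2
    simp; omega
  · rw [h2]
    have := h.right_ne.2
    simp; omega

end Enc

theorem IsExpandedEven.tail {x y : ℤ} {v : List ℤ} (h : IsExpandedEven (x :: y :: v)) (hy : y ≠ 0) :
    IsExpandedEven (y :: v) where
  entries z hz := h.entries z (List.mem_cons_of_mem _ hz)
  first_ne := by simpa using hy
  last_ne := by simpa [List.getLast?_cons_cons] using h.last_ne
  zero_entry i hi h0 := h.zero_entry (i + 1) (by simpa using hi) h0

theorem IsExpandedEven.exists_enc : ∀ (k : ℕ) (v : List ℤ) (x : ℤ) (τ : Letter), v.length ≤ k →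
    IsExpandedEven (x :: v) → τ ≠ C → ∃ w σ y, Enc τ x (x :: v) w σ y := by
  intro k
  induction k with
  | zero =>
    intro v x τ hk h hτ
    obtain rfl : v = [] := List.eq_nil_of_length_eq_zero (by omega)
    have h1 := h.entries x (by simp)
    have h2 := h.first_ne
    simp at h2
    exact ⟨_, _, _, Enc.one τ x hτ (by omega)⟩
  | succ k ih =>
    intro v x τ hk h hτ
    have h1 := h.entries x (by simp)
    have h2 := h.first_ne
    simp only [List.head?_cons, ne_eq, Option.some.injEq] at h2
    match v, hk, h with
    | [], _, _ => exact ⟨_, _, _, Enc.one τ x hτ (by omega)⟩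
    | y :: v, hk, h =>
      have h3 := h.entries y (by simp)
      by_cases hy : y = 0
      · subst hy
        match v, hk, h with
        | [], _, h => exact absurd (by simp) h.last_ne
        | z :: v, hk, h =>
          have h4 := h.zero_entry 0 (by simp) (by simp)
          simp only [List.getElem_cons_zero, List.getElem_cons_succ] at h4
          obtain ⟨rfl, -⟩ := h4
          have h5 : IsExpandedEven (0 :: x :: v) → IsExpandedEven (x :: v) := fun h => h.tail h2
          have h6 : IsExpandedEven (x :: v) :=
            ⟨fun z hz => h.entries z (by simp at hz ⊢; tauto), by simpa using h2,
              by simpa [List.getLast?_cons_cons] using h.last_ne,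
              fun i hi h0 => h.zero_entry (i + 2) (by simpa using hi) h0⟩
          obtain ⟨w, σ, y, he⟩ := ih v x τ (by simp at hk; omega) h6 hτ
          exact ⟨_, _, _, he.zero⟩
      · obtain ⟨w, σ, u, he⟩ := ih v y τ.swap (by simpa using hk) (h.tail hy)
          (Letter.swap_ne_C.2 hτ)
        by_cases hxy : y = x
        · subst hxy; exact ⟨_, _, _, he.same⟩
        · obtain rfl : y = -x := by omega
          exact ⟨_, _, _, he.opp⟩

/-! ### Parsings as chains of tiles -/

/-- The tile `ε e` (`s = true`) or `ε e⁻¹` (`s = false`). -/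
def tileVec (e : List ℤ) (ε : ℤ) (s : Bool) : List ℤ := smulVec ε (if s then e else e.reverse)

/-- `Chain e ε₀ s₀ ε₁ s₁ c`: the vector `c` admits a parsing with respect to `e` whose first tile is
`tileVec e ε₀ s₀` and whose last tile is `tileVec e ε₁ s₁`. -/
inductive Chain (e : List ℤ) (ε₀ : ℤ) (s₀ : Bool) : ℤ → Bool → List ℤ → Prop
  | base (hε : ε₀ = 1 ∨ ε₀ = -1) : Chain e ε₀ s₀ ε₀ s₀ (tileVec e ε₀ s₀)
  | snoc {ε₁ : ℤ} {s₁ : Bool} {c : List ℤ} (h : Chain e ε₀ s₀ ε₁ s₁ c) (ε₂ r : ℤ)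
      (hε : ε₂ = 1 ∨ ε₂ = -1) (hr : r = 0 → ε₁ = ε₂) :
      Chain e ε₀ s₀ ε₂ (!s₁) (c ++ (evenVec (2 * r) ++ tileVec e ε₂ (!s₁)))

theorem smulVec_smulVec (δ ε : ℤ) (a : List ℤ) : smulVec δ (smulVec ε a) = smulVec (δ * ε) a := by
  simp [smulVec, mul_assoc, Function.comp_def]

theorem smulVec_one (a : List ℤ) : smulVec 1 a = a := by simp [smulVec]

theorem smulVec_append (ε : ℤ) (a b : List ℤ) :
    smulVec ε (a ++ b) = smulVec ε a ++ smulVec ε b := by simp [smulVec]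

theorem smulVec_reverse (ε : ℤ) (a : List ℤ) :
    (smulVec ε a).reverse = smulVec ε a.reverse := by simp [smulVec]

theorem length_smulVec (ε : ℤ) (a : List ℤ) : (smulVec ε a).length = a.length := by simp [smulVec]

theorem alternatingVec_snoc (k : ℕ) :
    alternatingVec (k + 2) = alternatingVec (k + 1) ++ [0, 2] := by
  induction k with
  | zero => rfl
  | succ k ih =>
    change 2 :: 0 :: alternatingVec (k + 2) = (2 :: 0 :: alternatingVec (k + 1)) ++ [0, 2]
    rw [ih]
    rfl

theorem alternatingVec_reverse (k : ℕ) : (alternatingVec k).reverse = alternatingVec k := by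
  induction k with
  | zero => rfl
  | succ k ih =>
    cases k with
    | zero => rfl
    | succ k => rw [alternatingVec_snoc, List.reverse_append, ih, ← alternatingVec_snoc]; rfl

theorem alternatingVec_length (k : ℕ) : (alternatingVec (k + 1)).length = 2 * k + 1 := by
  induction k with
  | zero => rfl
  | succ k ih => rw [alternatingVec, List.length_cons, List.length_cons, ih]; ring

theorem evenVec_reverse (m : ℤ) : (evenVec m).reverse = evenVec m := by
  rw [evenVec, smulVec_reverse, alternatingVec_reverse]

theorem evenVec_length_odd (m : ℤ) : Odd (evenVec m).length := by
  rw [evenVec, length_smulVec]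
  cases m.natAbs / 2 with
  | zero => exact ⟨0, rfl⟩
  | succ k => rw [alternatingVec_length]; exact ⟨k, rfl⟩

theorem evenVec_mul (δ r : ℤ) (hδ : δ = 1 ∨ δ = -1) :
    evenVec (δ * r) = smulVec δ (evenVec r) := by
  rcases hδ with rfl | rfl
  · rw [one_mul, smulVec_one]
  · rw [evenVec, evenVec, smulVec_smulVec]; simp

theorem tileVec_reverse (e : List ℤ) (ε : ℤ) (s : Bool) :
    (tileVec e ε s).reverse = tileVec e ε (!s) := by
  cases s <;> simp [tileVec, smulVec_reverse]

namespace Chain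
variable {e c : List ℤ} {ε₀ ε₁ : ℤ} {s₀ s₁ : Bool}

theorem right_ne (h : Chain e ε₀ s₀ ε₁ s₁ c) : ε₁ = 1 ∨ ε₁ = -1 := by
  cases h <;> assumption

theorem cons (h : Chain e ε₀ s₀ ε₁ s₁ c) (ε r : ℤ) (hε : ε = 1 ∨ ε = -1) (hr : r = 0 → ε = ε₀) :
    Chain e ε (!s₀) ε₁ s₁ (tileVec e ε (!s₀) ++ (evenVec (2 * r) ++ c)) := by
  induction h with
  | base hε₂ =>
    have := (base (e := e) (s₀ := !s₀) hε).snoc ε₀ r hε₂ hr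
    simpa using this
  | snoc _ ε₂ r₂ hε₂ hr₂ ih =>
    have := ih.snoc ε₂ r₂ hε₂ hr₂
    simpa [List.append_assoc] using this

theorem reverse (h : Chain e ε₀ s₀ ε₁ s₁ c) : Chain e ε₁ (!s₁) ε₀ (!s₀) c.reverse := by
  induction h with
  | base hε => rw [tileVec_reverse]; exact base hε
  | @snoc ε₁ s₁ c h ε₂ r hε hr ih =>
    rw [List.reverse_append, List.reverse_append, evenVec_reverse, tileVec_reverse,
      List.append_assoc]
    exact ih.cons ε₂ r hε (fun h => (hr h).symm)

theorem smul (h : Chain e ε₀ s₀ ε₁ s₁ c) {δ : ℤ} (hδ : δ = 1 ∨ δ = -1) :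
    Chain e (δ * ε₀) s₀ (δ * ε₁) s₁ (smulVec δ c) := by
  induction h with
  | base hε =>
    rw [tileVec, smulVec_smulVec]
    exact base (by rcases hδ with rfl | rfl <;> omega)
  | @snoc ε₁ s₁ c h ε₂ r hε hr ih =>
    rw [smulVec_append, smulVec_append, tileVec, smulVec_smulVec, ← evenVec_mul _ _ hδ,
      mul_left_comm]
    refine ih.snoc _ _ (by rcases hδ with rfl | rfl <;> omega) (fun h => ?_)
    rw [hr (by rcases hδ with rfl | rfl <;> omega)]

/-- A chain with respect to `e` is a chain with respect to any tile of `e`. -/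
theorem relabel (h : Chain e ε₀ s₀ ε₁ s₁ c) {δ : ℤ} (hδ : δ = 1 ∨ δ = -1) (t : Bool) :
    Chain (tileVec e δ t) (ε₀ * δ) (s₀ == t) (ε₁ * δ) (s₁ == t) c := by
  have key : ∀ ε s, tileVec (tileVec e δ t) (ε * δ) (s == t) = tileVec e ε s := by
    intro ε s
    have h1 : ε * δ * δ = ε := by rcases hδ with rfl | rfl <;> ring
    cases s <;> cases t <;> simp [tileVec, smulVec_smulVec, smulVec_reverse, h1]
  have key' : ∀ ε, (ε = 1 ∨ ε = -1) → ε * δ = 1 ∨ ε * δ = -1 := by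
    intro ε hε; rcases hδ with rfl | rfl <;> omega
  induction h with
  | base hε =>
    have := base (e := tileVec e δ t) (s₀ := s₀ == t) (key' _ hε)
    rwa [key] at this
  | @snoc ε₁ s₁ c h ε₂ r hε hr ih =>
    have := ih.snoc (ε₂ * δ) r (key' _ hε) (fun h => by rw [hr h])
    have hs : (!(s₁ == t)) = ((!s₁) == t) := by cases s₁ <;> cases t <;> rfl
    rwa [hs, key] at this

theorem even_length (h : Chain e ε₀ s₀ ε₁ s₁ c) (he : Even e.length) :
    Even c.length ↔ s₁ = s₀ := by
  have ht : ∀ ε s, Even (tileVec e ε s).length := by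
    intro ε s
    rw [tileVec, length_smulVec]
    cases s <;> simpa using he
  induction h with
  | base hε => simpa using ht ε₀ s₀
  | @snoc ε₁ s₁ c h ε₂ r hε hr ih =>
    have h1 := evenVec_length_odd (2 * r)
    rw [← Nat.not_even_iff_odd] at h1
    simp only [List.length_append, Nat.even_add, ih, h1, ht, iff_true]
    cases s₀ <;> cases s₁ <;> simp

end Chain

theorem decide_even_succ (j : ℕ) : decide (Even (j + 1)) = !decide (Even j) := by
  rw [← decide_not, decide_eq_decide, Nat.even_add_one]

theorem parsesWith_iff_chain {c a : List ℤ} :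
    ParsesWith c a ↔ ∃ ε₁ s₁, Chain a 1 true ε₁ s₁ c := by
  have htile : ∀ ε i, tile a ε i = tileVec a ε (decide (Even i)) := by
    intro ε i; simp [tile, tileVec]
  constructor
  · rintro ⟨k, ε, r, h0, h1, h2, rfl⟩
    have key : ∀ j ≤ k, Chain a 1 true (ε j) (decide (Even j)) (tile a (ε 0) 0 ++
        (List.range j).flatMap fun i => evenVec (2 * r i) ++ tile a (ε (i + 1)) (i + 1)) := by
      intro j
      induction j with
      | zero =>
        intro _
        have := Chain.base (e := a) (ε₀ := 1) (s₀ := true) (Or.inl rfl)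
        simpa [htile, h0] using this
      | succ j ih =>
        intro hj
        have := (ih (by omega)).snoc (ε (j + 1)) (r j) (h1 _ hj) (h2 j (by omega))
        rw [List.range_succ, List.flatMap_append, List.flatMap_singleton, ← List.append_assoc,
          htile _ (j + 1)]
        rwa [← decide_even_succ] at this
    exact ⟨_, _, key k le_rfl⟩
  · rintro ⟨ε₁, s₁, h⟩
    suffices H : ∀ {ε₀ s₀ ε₁ s₁ c}, Chain a ε₀ s₀ ε₁ s₁ c → ε₀ = 1 → s₀ = true →
        ∃ (k : ℕ) (ε : ℕ → ℤ) (r : ℕ → ℤ), s₁ = decide (Even k) ∧ ε k = ε₁ ∧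
          ε 0 = 1 ∧ (∀ i ≤ k, ε i = 1 ∨ ε i = -1) ∧ (∀ i < k, r i = 0 → ε i = ε (i + 1)) ∧
          c = tile a (ε 0) 0 ++
            (List.range k).flatMap fun i => evenVec (2 * r i) ++ tile a (ε (i + 1)) (i + 1) by
      obtain ⟨k, ε, r, -, -, h⟩ := H h rfl rfl
      exact ⟨k, ε, r, h⟩
    intro ε₀ s₀ ε₁ s₁ c h
    induction h with
    | base hε =>
      rintro rfl rfl
      exact ⟨0, fun _ => 1, fun _ => 0, by simp, rfl, rfl, fun _ _ => Or.inl rfl, by simp,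
        by simp [htile]⟩
    | @snoc ε₁ s₁ c h ε₂ r hε hr ih =>
      intro h1 h2
      obtain ⟨k, ε, r', a1, a2, a3, a4, a5, a6⟩ := ih h1 h2
      refine ⟨k + 1, fun i => if i ≤ k then ε i else ε₂, fun i => if i < k then r' i else r, ?_,
        by simp, by simpa using a3, ?_, ?_, ?_⟩
      · rw [a1, decide_even_succ]
      · intro i _
        by_cases hi : i ≤ k
        · simpa [hi] using a4 i hi
        · simpa [hi] using hε
      · intro i hi
        rcases Nat.lt_succ_iff_lt_or_eq.1 hi with h | rfl
        · simpa [h, h.le, Nat.succ_le_of_lt h] using a5 i h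
        · simpa [a2] using hr
      · rw [List.range_succ, List.flatMap_append, List.flatMap_singleton, ← List.append_assoc, a6]
        simp only [Nat.zero_le, if_true, lt_irrefl, if_false, htile _ (k + 1),
          show ¬ (k + 1 ≤ k) by omega]
        have hf : ((List.range k).flatMap fun i => evenVec (2 * if i < k then r' i else r) ++
            tile a (if i + 1 ≤ k then ε (i + 1) else ε₂) (i + 1)) =
            (List.range k).flatMap fun i => evenVec (2 * r' i) ++ tile a (ε (i + 1)) (i + 1) := by
          refine List.flatMap_congr (fun i hi => ?_)
          have hi := List.mem_range.1 hi
          simp [hi, Nat.succ_le_of_lt hi]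
        rw [a1, decide_even_succ, hf]
        simp only [List.append_assoc]

theorem VecEquiv.symm {a b : List ℤ} (h : VecEquiv a b) : VecEquiv b a := by
  obtain ⟨ε, hε, h⟩ := h
  have h1 : ε * ε = 1 := by rcases hε with rfl | rfl <;> rfl
  refine ⟨ε, hε, ?_⟩
  rcases h with rfl | rfl
  · left; rw [smulVec_smulVec, h1, smulVec_one]
  · right; rw [smulVec_reverse, smulVec_smulVec, h1, smulVec_one, List.reverse_reverse]

theorem VecEquiv.tileVec_of {a b : List ℤ} (h : VecEquiv a b) :
    ∃ ε s, (ε = 1 ∨ ε = -1) ∧ a = tileVec b ε s := by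
  obtain ⟨ε, hε, rfl | rfl⟩ := h
  · exact ⟨ε, true, hε, rfl⟩
  · exact ⟨ε, false, hε, rfl⟩

theorem vecEquiv_tileVec (a : List ℤ) {ε : ℤ} (s : Bool) (hε : ε = 1 ∨ ε = -1) :
    VecEquiv (tileVec a ε s) a := by
  cases s
  · exact ⟨ε, hε, Or.inr rfl⟩
  · exact ⟨ε, hε, Or.inl rfl⟩

theorem tileVec_tileVec (a : List ℤ) (δ ε : ℤ) (s t : Bool) :
    tileVec (tileVec a δ t) ε s = tileVec a (ε * δ) (s == t) := by
  cases s <;> cases t <;> simp [tileVec, smulVec_smulVec, smulVec_reverse]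

theorem VecEquiv.trans {a b c : List ℤ} (h : VecEquiv a b) (h' : VecEquiv b c) : VecEquiv a c := by
  obtain ⟨ε, s, hε, rfl⟩ := h.tileVec_of
  obtain ⟨δ, t, hδ, rfl⟩ := h'.tileVec_of
  rw [tileVec_tileVec]
  exact vecEquiv_tileVec _ _ (by rcases hδ with rfl | rfl <;> omega)

theorem VecEquiv.refl (a : List ℤ) : VecEquiv a a := ⟨1, Or.inl rfl, Or.inl (smulVec_one a).symm⟩

theorem VecEquiv.length_eq {a b : List ℤ} (h : VecEquiv a b) : a.length = b.length := by
  obtain ⟨ε, hε, rfl | rfl⟩ := h <;> simp [length_smulVec]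

/-- A representative of the class of `c` may be replaced by `c` itself. -/
theorem ClassParsesWith.exists_parsesWith {c a : List ℤ} (h : ClassParsesWith c a)
    (hc : Even c.length) (ha : Even a.length) : ∃ a', VecEquiv a' a ∧ ParsesWith c a' := by
  obtain ⟨c', a', hc', ha', hp⟩ := h
  obtain ⟨ε₁, s₁, h⟩ := parsesWith_iff_chain.1 hp
  have ha2 : Even a'.length := by rw [ha'.length_eq]; exact ha
  have hs : s₁ = true := (h.even_length ha2).1 (by rw [hc'.length_eq]; exact hc)
  subst hs
  obtain ⟨ε, s, hε, rfl⟩ := hc'.symm.tileVec_of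
  have hsq : ∀ δ : ℤ, (δ = 1 ∨ δ = -1) → δ * δ = 1 := by
    rintro δ (rfl | rfl) <;> rfl
  cases s
  · -- `c` is a multiple of the reverse
    have h1 := (h.reverse.smul hε).relabel (δ := ε * ε₁)
      (by have := h.right_ne; rcases hε with rfl | rfl <;> omega) false
    rw [hsq _ (by have := h.right_ne; rcases hε with rfl | rfl <;> omega)] at h1
    refine ⟨_, (vecEquiv_tileVec a' false ?_).trans ha',
      parsesWith_iff_chain.2 ⟨_, _, by simpa [tileVec, smulVec_reverse] using h1⟩⟩
    have := h.right_ne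
    rcases hε with rfl | rfl <;> omega
  · have h1 := (h.smul hε).relabel (δ := ε) hε true
    rw [mul_one, hsq _ hε] at h1
    exact ⟨_, (vecEquiv_tileVec a' true hε).trans ha',
      parsesWith_iff_chain.2 ⟨_, _, by simpa [tileVec] using h1⟩⟩

/-! ### The words of connectors -/

/-- The word `X C X C … C X` in which `X` occurs `k + 1` times. -/
def altLetters (X : Letter) : ℕ → List Letter
  | 0 => [X]
  | k + 1 => X :: C :: altLetters X k

/-- The word between the letters of two successive entries `y` and `z`, which are equal up to sign
and not separated by an entry `0`. -/
def sepWord (y z : ℤ) : List Letter := if z = y then [] else [C]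

/-- `Conn σ y r x k`: the word `k` encodes the connector `evenVec (2 r)` between a tile whose last
entry is `y`, with the letter `σ`, and a tile whose first entry is `x`, with the same letter. -/
def Conn (σ : Letter) (y r x : ℤ) (k : List Letter) : Prop :=
  ∀ ⦃τ x₀ u w u' w' ρ z⦄, Enc τ x₀ u w σ y → Enc σ x u' w' ρ z →
    Enc τ x₀ (u ++ (evenVec (2 * r) ++ u')) (w ++ (k ++ w')) ρ z

theorem altLetters_cons (X : Letter) (k : ℕ) : ∃ t, altLetters X k = X :: t := by
  cases k <;> exact ⟨_, rfl⟩

theorem altLetters_snoc (X : Letter) (k : ℕ) :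
    altLetters X (k + 1) = altLetters X k ++ [C, X] := by
  induction k with
  | zero => rfl
  | succ k ih =>
    change X :: C :: altLetters X (k + 1) = (X :: C :: altLetters X k) ++ [C, X]
    rw [ih]
    rfl

theorem altLetters_reverse (X : Letter) (k : ℕ) : (altLetters X k).reverse = altLetters X k := by
  induction k with
  | zero => rfl
  | succ k ih => rw [altLetters_snoc, List.reverse_append, ih, ← altLetters_snoc]; rfl

theorem mem_altLetters {X Y : Letter} {k : ℕ} (h : Y ∈ altLetters X k) : Y = X ∨ Y = C := by
  induction k with
  | zero => exact Or.inl (by simpa [altLetters] using h)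
  | succ k ih =>
    simp only [altLetters, List.mem_cons] at h
    tauto

theorem Enc.append_sep {τ σ ρ : Letter} {x y z t : ℤ} {v v' : List ℤ} {w w' : List Letter}
    (h : Enc τ x v w σ y) (h' : Enc σ.swap z v' w' ρ t) (hz : z = y ∨ z = -y) :
    Enc τ x (v ++ v') (w ++ (sepWord y z ++ w')) ρ t := by
  unfold sepWord
  split_ifs with hzy
  · subst hzy
    exact h.append_same h'
  · obtain rfl := hz.resolve_left hzy
    exact h.append_opp h'

theorem enc_alternatingVec {X : Letter} (hX : X ≠ C) (k : ℕ) :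
    Enc X 2 (alternatingVec (k + 1)) (altLetters X k) X 2 := by
  induction k with
  | zero => exact Enc.one X 2 hX (Or.inl rfl)
  | succ k ih => exact ih.zero

theorem enc_evenVec {X : Letter} (hX : X ≠ C) (k : ℕ) {s : ℤ} (hs : s = 1 ∨ s = -1) :
    Enc X (s * 2) (evenVec (2 * (s * (k + 1)))) (altLetters X k) X (s * 2) := by
  have h1 : (2 * (s * (k + 1) : ℤ)).sign = s := by
    rcases hs with rfl | rfl
    · exact Int.sign_eq_one_of_pos (by omega)
    · exact Int.sign_eq_neg_one_of_neg (by omega)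
  have h2 : (2 * (s * (k + 1) : ℤ)).natAbs / 2 = k + 1 := by
    rcases hs with rfl | rfl <;> omega
  rw [evenVec, h1, h2]
  exact (enc_alternatingVec hX k).smul hs

theorem conn_zero (σ : Letter) (y : ℤ) : Conn σ y 0 y [C] := by
  intro τ x₀ u w u' w' ρ z h h'
  exact h.append_zero h'

theorem conn_of_sign {σ : Letter} (hσ : σ ≠ C) (k : ℕ) {s y x : ℤ} (hs : s = 1 ∨ s = -1)
    (hy : y = 2 ∨ y = -2) (hx : x = 2 ∨ x = -2) :
    Conn σ y (s * (k + 1)) x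
      (sepWord y (s * 2) ++ (altLetters σ.swap k ++ sepWord (s * 2) x)) := by
  intro τ x₀ u w u' w' ρ z h h'
  have h1 := enc_evenVec (Letter.swap_ne_C.2 hσ) k hs
  have h2 := h1.append_sep (by rw [Letter.swap_swap]; exact h') (by rcases hs with rfl | rfl <;> omega)
  have h3 := h.append_sep h2 (by rcases hs with rfl | rfl <;> omega)
  simpa [List.append_assoc] using h3

/-- Every connector has a word. -/
theorem exists_conn_word {σ : Letter} (hσ : σ ≠ C) {y x : ℤ} (r : ℤ) (hy : y = 2 ∨ y = -2)
    (hx : x = y ∨ x = -y) (hr : r = 0 → x = y) : ∃ k, σ ∉ k ∧ Conn σ y r x k := by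
  have hsep : ∀ y z, σ ∉ sepWord y z := by
    intro y z; unfold sepWord; split_ifs <;> simp [hσ]
  by_cases h0 : r = 0
  · subst h0
    obtain rfl := hr rfl
    exact ⟨[C], by simpa using hσ, conn_zero _ _⟩
  · have h1 : r = r.sign * ((r.natAbs - 1 : ℕ) + 1) := by
      rcases lt_or_gt_of_ne h0 with h | h
      · rw [Int.sign_eq_neg_one_of_neg h]; omega
      · rw [Int.sign_eq_one_of_pos h]; omega
    rw [h1]
    refine ⟨_, ?_, conn_of_sign hσ _ ?_ hy (by omega)⟩
    · simp only [List.mem_append, not_or]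
      refine ⟨hsep _ _, fun h => ?_, hsep _ _⟩
      rcases mem_altLetters h with h | h
      · exact Letter.swap_ne_self hσ h.symm
      · exact hσ h
    · rcases lt_or_gt_of_ne h0 with h | h
      · exact Or.inr (Int.sign_eq_neg_one_of_neg h)
      · exact Or.inl (Int.sign_eq_one_of_pos h)

/-- A reduced word without the letter `σ` alternates between `C` and the other letter. -/
theorem exists_altLetters {σ : Letter} (hσ : σ ≠ C) (k : List Letter) (h : σ ∉ k)
    (hc : k.IsChain (· ≠ ·)) (h0 : k ≠ []) :
    k = [C] ∨ ∃ (p q : Bool) (j : ℕ), k = (if p then [] else [C]) ++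
      (altLetters σ.swap j ++ if q then [] else [C]) := by
  induction k with
  | nil => exact absurd rfl h0
  | cons a t ih =>
    have ha : a = C ∨ a = σ.swap := by
      by_cases ha : a = C
      · exact Or.inl ha
      · refine Or.inr ((Letter.eq_or_eq_swap hσ ha).resolve_left ?_)
        rintro rfl; simp at h
    rcases t with _ | ⟨b, t⟩
    · rcases ha with rfl | rfl
      · exact Or.inl rfl
      · exact Or.inr ⟨true, true, 0, rfl⟩
    · rw [List.isChain_cons_cons] at hc
      rcases ih (by simp at h ⊢; tauto) hc.2 (by simp) with h1 | ⟨p, q, j, h1⟩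
      · rw [h1]
        obtain rfl : b = C := (List.cons.inj h1).1
        obtain rfl := ha.resolve_left hc.1
        exact Or.inr ⟨true, false, 0, rfl⟩
      · obtain ⟨s, hs⟩ := altLetters_cons σ.swap j
        rcases ha with rfl | rfl
        · cases p
          · simp at h1; exact absurd h1.1.symm hc.1
          · exact Or.inr ⟨false, q, j, by rw [h1]; rfl⟩
        · cases p
          · exact Or.inr ⟨true, q, j + 1, by rw [h1]; rfl⟩
          · simp [hs] at h1; exact absurd h1.1.symm hc.1

/-- Every nonempty reduced word without the letter `σ` encodes a connector; if the word is a
palindrome, then the tiles on both sides of the connector have the same sign. -/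
theorem exists_conn {σ : Letter} (hσ : σ ≠ C) {y : ℤ} (hy : y = 2 ∨ y = -2) (k : List Letter)
    (h : σ ∉ k) (hc : k.IsChain (· ≠ ·)) (h0 : k ≠ []) :
    ∃ r x, (x = y ∨ x = -y) ∧ (r = 0 → x = y) ∧ (k.reverse = k → x = y) ∧ Conn σ y r x k := by
  rcases exists_altLetters hσ k h hc h0 with rfl | ⟨p, q, j, rfl⟩
  · exact ⟨0, y, Or.inl rfl, fun _ => rfl, fun _ => rfl, conn_zero _ _⟩
  · obtain ⟨s, hs, hsy⟩ : ∃ s : ℤ, (s = 1 ∨ s = -1) ∧ s * 2 = if p then y else -y := by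
      rcases hy with rfl | rfl <;> cases p
      exacts [⟨-1, by simp⟩, ⟨1, by simp⟩, ⟨1, by simp⟩, ⟨-1, by simp⟩]
    have hx : ∃ x : ℤ, x = if q then s * 2 else -(s * 2) := ⟨_, rfl⟩
    obtain ⟨x, hx⟩ := hx
    have hy0 : -y ≠ y := by omega
    have h1 : sepWord y (s * 2) = if p then [] else [C] := by
      rw [sepWord, hsy]; cases p <;> simp [hy0]
    have h2 : sepWord (s * 2) x = if q then [] else [C] := by
      have : -(s * 2) ≠ s * 2 := by omega
      rw [sepWord, hx]; cases q <;> simp [this]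
    refine ⟨s * (j + 1), x, ?_, ?_, ?_, ?_⟩
    · cases p <;> cases q <;> simp at hsy hx <;> omega
    · intro h3
      rcases hs with rfl | rfl <;> omega
    · intro hp
      have : p = q := by
        obtain ⟨t, ht⟩ := altLetters_cons σ.swap j
        cases p <;> cases q <;> simp [altLetters_reverse] at hp ⊢
        · rw [ht] at hp
          exact Letter.swap_ne_C.2 hσ (List.cons.inj hp).1
        · rw [ht] at hp
          exact Letter.swap_ne_C.2 hσ (List.cons.inj hp).1.symm
      subst this
      cases p <;> simp at hsy hx <;> omega
    · have hx2 : x = 2 ∨ x = -2 := by cases p <;> cases q <;> simp at hsy hx <;> omega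
      have := conn_of_sign hσ j hs hy hx2
      rwa [h1, h2] at this

/-! ### The words of chains -/

/-- The last letter of a tile; the first letter is the last letter of the reversed tile. -/
def endLetter (s : Bool) : Letter := if s then B else A

/-- The word of a tile. -/
def tileWord (z : List Letter) (s : Bool) : List Letter := if s then z else z.reverse

/-- `WordChain z s w`: the word `w` is a sequence of tiles `z` and `z⁻¹`, starting with `z` and
ending with `tileWord z s`, and separated by words without the last letter of the tile before
them. -/
inductive WordChain (z : List Letter) : Bool → List Letter → Prop
  | base : WordChain z true z
  | snoc {s : Bool} {u k : List Letter} (h : WordChain z s u) (hk : endLetter s ∉ k) :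
      WordChain z (!s) (u ++ (k ++ tileWord z (!s)))

section
variable {e c : List ℤ} {z w : List Letter} {x y ε₁ : ℤ} {s : Bool}

theorem Enc.tile (h : Enc A x e z B y) {ε : ℤ} (hε : ε = 1 ∨ ε = -1) (s : Bool) :
    Enc (endLetter (!s)) (ε * if s then x else y) (tileVec e ε s) (tileWord z s) (endLetter s)
      (ε * if s then y else x) := by
  cases s
  · exact h.reverse.smul hε
  · exact h.smul hε

/-- The word of a chain of tiles is a chain of the words of the tiles. -/
theorem Chain.exists_word (he : Enc A x e z B y) (h : Chain e 1 true ε₁ s c) :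
    ∃ w, WordChain z s w ∧ Enc A x c w (endLetter s) (ε₁ * if s then y else x) := by
  induction h with
  | base hε => exact ⟨z, .base, by simpa [endLetter, tileWord] using he.tile hε true⟩
  | @snoc ε₁ s c h ε₂ r hε hr ih =>
    obtain ⟨w, hw, hc⟩ := ih
    have ht := he.tile hε (!s)
    have h1 := h.right_ne
    rw [Bool.not_not] at ht
    have hif : (if (!s) = true then x else y) = if s then y else x := by cases s <;> rfl
    rw [hif] at ht
    obtain ⟨k, hk, hconn⟩ := exists_conn_word hc.right_ne.1 (x := ε₂ * if s then y else x) r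
      hc.right_ne.2 (by rcases hε with rfl | rfl <;> rcases h1 with rfl | rfl <;> cases s <;> simp)
      (fun h => by rw [hr h])
    exact ⟨_, hw.snoc hk, hconn hc ht⟩

/-- A reduced chain of words is the word of a chain of tiles. -/
theorem WordChain.exists_vec (he : Enc A x e z B y) (h : WordChain z s w)
    (hw : w.IsChain (· ≠ ·)) : ∃ ε₁ c, Chain e 1 true ε₁ s c ∧
      Enc A x c w (endLetter s) (ε₁ * if s then y else x) := by
  induction h with
  | base =>
    refine ⟨1, _, .base (Or.inl rfl), ?_⟩
    simpa [endLetter, tileWord] using he.tile (Or.inl rfl) true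
  | @snoc s u k h hk ih =>
    obtain ⟨hu, hkt, hjoin⟩ := List.isChain_append.1 hw
    obtain ⟨ε₁, c, hc, hE⟩ := ih hu
    have ht := he.tile (ε := 1) (Or.inl rfl) (!s)
    have hk0 : k ≠ [] := by
      rintro rfl
      obtain ⟨t, ht⟩ := ht.cons_word
      rw [Bool.not_not] at ht
      exact hjoin (endLetter s) (by rw [hE.getLast_word]; rfl) (endLetter s) (by simp [ht]) rfl
    obtain ⟨r, x', hx', hr, -, hconn⟩ :=
      exists_conn hE.right_ne.1 hE.right_ne.2 k hk (List.isChain_append.1 hkt).1 hk0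
    have h1 := hc.right_ne
    obtain ⟨ε₂, hε₂, rfl⟩ : ∃ ε₂ : ℤ, (ε₂ = 1 ∨ ε₂ = -1) ∧ x' = ε₂ * if s then y else x := by
      rcases hx' with rfl | rfl
      · exact ⟨ε₁, h1, rfl⟩
      · exact ⟨-ε₁, by omega, by ring⟩
    have hy0 := hE.right_ne.2
    have ht := he.tile hε₂ (!s)
    have hif : (if (!s) = true then x else y) = if s then y else x := by cases s <;> rfl
    rw [Bool.not_not, hif] at ht
    refine ⟨_, _, hc.snoc ε₂ r hε₂ (fun h => ?_), hconn hE ht⟩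
    have := hr h
    by_contra hne
    have h3 : ε₂ = -ε₁ := by omega
    rw [h3, neg_mul] at this
    omega

end

/-! ### The folded line of a word -/

/-- The labelling of the line that unfolds the word `z`. -/
def lineOf (z : List Letter) (i : ℤ) : Letter :=
  if (i % (2 * z.length)).toNat < z.length then z.getD (i % (2 * z.length)).toNat C
  else z.getD (2 * z.length - 1 - (i % (2 * z.length)).toNat) C

section
variable {z : List Letter}

theorem lineOf_eq {i : ℤ} {r : ℕ} (h : i ≡ r [ZMOD 2 * z.length]) (hr : r < 2 * z.length) :
    lineOf z i = if r < z.length then z.getD r C else z.getD (2 * z.length - 1 - r) C := by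
  have : i % (2 * z.length) = r := by
    rw [h, Int.emod_eq_of_lt (by omega) (by omega)]
  rw [lineOf, this, Int.toNat_natCast]

theorem lineOf_natCast {i : ℕ} (h : i < z.length) : lineOf z i = z.getD i C := by
  rw [lineOf_eq (Int.ModEq.refl _) (by omega), if_pos h]

theorem exists_modEq_lt {n : ℕ} (hn : 0 < n) (i : ℤ) : ∃ r : ℕ, i ≡ r [ZMOD 2 * n] ∧ r < 2 * n := by
  have h0 := Int.emod_nonneg i (b := 2 * n) (by omega)
  have h1 := Int.emod_lt_of_pos i (b := 2 * n) (by omega)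
  refine ⟨(i % (2 * n)).toNat, ?_, by omega⟩
  rw [Int.toNat_of_nonneg h0]
  exact (Int.mod_modEq _ _).symm

theorem List.IsChain.getD_ne (h : z.IsChain (· ≠ ·)) {i : ℕ} (hi : i + 1 < z.length) :
    z.getD i C ≠ z.getD (i + 1) C := by
  rw [List.getD_eq_getElem _ _ (by omega), List.getD_eq_getElem _ _ hi]
  exact List.isChain_iff_getElem.1 h i hi

theorem foldedLine_lineOf {t : List Letter} (hz : z = A :: t) (hl : z.getLast? = some B)
    (hc : z.IsChain (· ≠ ·)) : FoldedLine z.length (lineOf z) := by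
  have hpos : 0 < z.length := by simp [hz]
  have hlast : z.getD (z.length - 1) C = B := by
    rw [List.getLast?_eq_getElem?] at hl
    simp [hl]
  refine ⟨hpos, fun i => ?_, fun i => ?_, ?_, ?_, fun i hi => ?_⟩
  · obtain ⟨r, h, hr⟩ := exists_modEq_lt hpos i
    have h' : i + 2 * z.length ≡ r [ZMOD 2 * z.length] := by simpa [Int.ModEq] using h
    rw [lineOf_eq h hr, lineOf_eq h' hr]
  · obtain ⟨r, h, hr⟩ := exists_modEq_lt hpos i
    have h' : -1 - i ≡ (2 * z.length - 1 - r : ℕ) [ZMOD 2 * z.length] := by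
      have h1 : ((2 * z.length - 1 - r : ℕ) : ℤ) = -1 - r + 2 * z.length := by omega
      rw [h1]
      exact (Int.ModEq.rfl.sub h).trans (by simp [Int.ModEq])
    rw [lineOf_eq h hr, lineOf_eq h' (by omega)]
    by_cases h2 : r < z.length
    · rw [if_pos h2, if_neg (by omega)]; congr 1; omega
    · rw [if_neg h2, if_pos (by omega)]
  · have := lineOf_natCast hpos
    rw [Nat.cast_zero] at this
    rw [this, hz]; rfl
  · rw [lineOf_eq (Int.ModEq.refl _) (by omega), if_neg (by omega), ← hlast]
    congr 1; omega
  · obtain ⟨r, h, hr⟩ := exists_modEq_lt hpos i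
    have hr' : ¬ (z.length : ℤ) ∣ r := fun hd => hi ((FoldedLine.dvd_of_modEq h).2 hd)
    have h0 : r ≠ 0 := by rintro rfl; simp at hr'
    have hn : r ≠ z.length := by rintro rfl; simp at hr'
    have h' : i - 1 ≡ (r - 1 : ℕ) [ZMOD 2 * z.length] := by
      rw [Nat.cast_sub (by omega), Nat.cast_one]; exact h.sub_right 1
    rw [lineOf_eq h hr, lineOf_eq h' (by omega)]
    by_cases h2 : r < z.length
    · rw [if_pos h2, if_pos (by omega)]
      have := hc.getD_ne (i := r - 1) (by omega)
      rwa [Nat.sub_add_cancel (by omega)] at this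
    · rw [if_neg h2, if_neg (by omega)]
      have := hc.getD_ne (i := 2 * z.length - 1 - r) (by omega)
      rw [show 2 * z.length - 1 - r + 1 = 2 * z.length - 1 - (r - 1) by omega] at this
      exact this.symm

/-! ### Chains of words and paths -/

/-- The word `w` can be read along a path from `u` to `v`. -/
inductive FPath (n : ℕ) (lam : ℤ → Letter) : List Letter → ℤ → ℤ → Prop
  | nil (u : ℤ) : FPath n lam [] u u
  | cons {x : Letter} {w : List Letter} {u v t : ℤ} (h : FStep n lam x u v)
      (h' : FPath n lam w v t) : FPath n lam (x :: w) u t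

namespace FPath
variable {n : ℕ} {lam : ℤ → Letter} {w w' : List Letter} {u v t : ℤ}

theorem append (h : FPath n lam w u v) (h' : FPath n lam w' v t) : FPath n lam (w ++ w') u t := by
  induction h with
  | nil => exact h'
  | cons h _ ih => exact cons h (ih h')

theorem exists_fun (h : FPath n lam w u v) : ∃ x : ℕ → ℤ, x 0 = u ∧ x w.length = v ∧
    ∀ t < w.length, FStep n lam (w.getD t C) (x t) (x (t + 1)) := by
  induction h with
  | nil u => exact ⟨fun _ => u, rfl, rfl, by simp⟩
  | @cons y w u v t h _ ih =>
    obtain ⟨x, h0, h1, h2⟩ := ih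
    refine ⟨fun i => if i = 0 then u else x (i - 1), by simp, by simpa using h1, fun i hi => ?_⟩
    rcases i with _ | i
    · simpa [h0] using h
    · simpa using h2 i (by simpa using hi)

theorem pause (hd : (n : ℤ) ∣ u) (hw : lam u ∉ w) : FPath n lam w u u := by
  induction w with
  | nil => exact nil u
  | cons x w ih =>
    simp only [List.mem_cons, not_or] at hw
    exact cons (Or.inr (Or.inr ⟨hw.1, hd, rfl⟩)) (ih hw.2)

theorem right (w : List Letter) (u : ℤ) (h : ∀ i < w.length, lam (u + i) = w.getD i C) :
    FPath n lam w u (u + w.length) := by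
  induction w generalizing u with
  | nil => simpa using nil u
  | cons x w ih =>
    refine cons (Or.inl ⟨by simpa using h 0 (by simp), rfl⟩) ?_
    have := ih (u + 1) (fun i hi => by
      have := h (i + 1) (by simpa using hi)
      rw [← show (u + 1) + (i : ℤ) = u + ((i + 1 : ℕ) : ℤ) by push_cast; ring] at this
      simpa using this)
    convert this using 1
    simp; ring

theorem left (w : List Letter) (u : ℤ) (h : ∀ i < w.length, lam (u - 1 - i) = w.getD i C) :
    FPath n lam w u (u - w.length) := by
  induction w generalizing u with
  | nil => simpa using nil u
  | cons x w ih =>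
    refine cons (Or.inr (Or.inl ⟨by simpa using h 0 (by simp), rfl⟩)) ?_
    have := ih (u - 1) (fun i hi => by
      have := h (i + 1) (by simpa using hi)
      rw [← show (u - 1) - 1 - (i : ℤ) = u - 1 - ((i + 1 : ℕ) : ℤ) by push_cast; ring] at this
      simpa using this)
    convert this using 1
    simp; ring

end FPath

theorem getD_reverse {i : ℕ} (h : i < z.length) :
    z.reverse.getD i C = z.getD (z.length - 1 - i) C := by
  rw [List.getD_eq_getElem _ _ (by simpa using h), List.getD_eq_getElem _ _ (by omega),
    List.getElem_reverse]

/-- A chain of the word `z` can be read by a path that passes through the word forwards and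
backwards in turns. -/
theorem WordChain.readable (L : FoldedLine z.length (lineOf z)) {w : List Letter}
    (h : WordChain z true w) :
    Readable z.length (lineOf z) (fun t => w.getD t C) w.length := by
  have key : ∀ s u, WordChain z s u →
      FPath z.length (lineOf z) u 0 (if s then z.length else 0) := by
    intro s u hu
    induction hu with
    | base =>
      simpa using FPath.right (n := z.length) z 0
        (fun i hi => by rw [zero_add]; exact lineOf_natCast hi)
    | @snoc s u k h hk ih =>
      refine ih.append ?_
      cases s
      · refine (FPath.pause (by simp) (by simpa [L.bot, endLetter] using hk)).append ?_
        simpa [tileWord] using FPath.right (n := z.length) z 0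
          (fun i hi => by rw [zero_add]; exact lineOf_natCast hi)
      · refine (FPath.pause (by simp) (by simpa [L.top, endLetter] using hk)).append ?_
        have := FPath.left (n := z.length) (lam := lineOf z) z.reverse z.length (fun i hi => by
          rw [List.length_reverse] at hi
          rw [getD_reverse hi, ← lineOf_natCast (by omega)]
          congr 1; omega)
        simpa [tileWord] using this
  obtain ⟨x, h0, h1, h2⟩ := (key true w h).exists_fun
  exact ⟨x, h0, by rw [h1]; rfl, h2⟩

/-- A walk on the line of `z` passes through copies of `z` and `z⁻¹` in turns, separated by
pauses at the walls. -/
theorem wordChain_of_walk (L : FoldedLine z.length (lineOf z)) {w : List Letter} {x : ℕ → ℤ}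
    (hbot : w.getD 0 C = A) (htop : w.getLast? = some B) (h0 : x 0 = 0)
    (hx : x w.length ≡ z.length [ZMOD 2 * z.length])
    (h : Walk z.length (lineOf z) (fun t => w.getD t C) x w.length) : WordChain z true w := by
  have hpos := L.pos
  have hlam : ∀ (s : Bool) (i : ℕ) (u : ℤ), i < z.length →
      u ≡ (if s then i else z.length + i) [ZMOD 2 * z.length] →
      lineOf z u = (tileWord z s).getD i C := by
    intro s i u hi hu
    cases s
    · rw [if_neg (by simp)] at hu
      rw [lineOf_eq (r := z.length + i) (by push_cast; exact hu) (by omega), if_neg (by omega),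
        tileWord, if_neg (by simp), getD_reverse hi]
      congr 1; omega
    · rw [if_pos rfl] at hu
      rw [lineOf_eq hu (by omega), if_pos hi]; rfl
  have hlen : ∀ s, (tileWord z s).length = z.length := by intro s; cases s <;> simp [tileWord]
  have key : ∀ t ≤ w.length, ∃ (s : Bool) (u : List Letter) (i : ℕ), i < z.length ∧
      x t ≡ (if s then i else z.length + i) [ZMOD 2 * z.length] ∧
      w.take t = u ++ (tileWord z s).take i ∧
      ((u = [] ∧ s = true) ∨
        ∃ p k, WordChain z (!s) p ∧ u = p ++ k ∧ endLetter (!s) ∉ k) := by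
    intro t
    induction t with
    | zero =>
      intro _
      exact ⟨true, [], 0, hpos, by simp [h0], by simp, Or.inl ⟨rfl, rfl⟩⟩
    | succ t ih =>
      intro ht
      obtain ⟨s, u, i, hi, hxt, htake, hu⟩ := ih (by omega)
      have hsucc : w.take (t + 1) = w.take t ++ [w.getD t C] := by
        rw [List.take_add_one, List.getD_eq_getElem _ _ (by omega),
          List.getElem?_eq_getElem (by omega)]; rfl
      have hl := hlam s i (x t) hi hxt
      have hstep := h t (by omega)
      dsimp only [Stp] at hstep
      rcases hstep with ⟨h1, h2⟩ | ⟨h1, h2, h3⟩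
      · have hsucc' : w.take (t + 1) = u ++ (tileWord z s).take (i + 1) := by
          rw [hsucc, htake, List.append_assoc, ← h1, hl]
          congr 1
          rw [List.take_add_one, List.getD_eq_getElem _ _ (by rw [hlen]; exact hi),
            List.getElem?_eq_getElem (by rw [hlen]; exact hi)]; rfl
        have hx' : x (t + 1) ≡ (if s then (i : ℤ) else z.length + i) + 1 [ZMOD 2 * z.length] := by
          rw [h2]; exact hxt.add_right 1
        by_cases hi' : i + 1 < z.length
        · refine ⟨s, u, i + 1, hi', ?_, hsucc', hu⟩
          cases s
          · simpa [add_assoc] using hx'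
          · simpa using hx'
        · have hin : i + 1 = z.length := by omega
          refine ⟨!s, w.take (t + 1), 0, hpos, ?_, by simp,
            Or.inr ⟨w.take (t + 1), [], ?_, by simp, by simp⟩⟩
          · refine hx'.trans ?_
            cases s
            · simp only [Bool.false_eq_true, if_false, Bool.not_false, if_true, Nat.cast_zero]
              rw [show (z.length : ℤ) + i + 1 = 2 * z.length by omega]
              simp [Int.ModEq]
            · simp only [Bool.not_true, Bool.false_eq_true, if_false, if_true, Nat.cast_zero]
              rw [show (i : ℤ) + 1 = z.length + 0 by omega]
          · rw [hsucc', hin, List.take_of_length_le (hlen s).le, Bool.not_not]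
            rcases hu with ⟨rfl, rfl⟩ | ⟨p, k, hp, rfl, hk⟩
            · exact WordChain.base
            · have := hp.snoc hk
              rwa [Bool.not_not, ← List.append_assoc] at this
      · obtain rfl : i = 0 := by
          have h4 := (FoldedLine.dvd_of_modEq hxt).1 h2
          have h5 : (z.length : ℤ) ∣ i := by
            cases s
            · simpa using h4
            · simpa using h4
          exact Nat.eq_zero_of_dvd_of_lt (by exact_mod_cast h5) hi
        rw [List.take_zero, List.append_nil] at htake
        have hs : lineOf z (x t) = endLetter (!s) := by
          cases s
          · rw [L.congr (y := z.length) (by simpa using hxt), L.top]; rfl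
          · rw [L.congr (y := 0) (by simpa using hxt), L.bot]; rfl
        rcases hu with ⟨rfl, rfl⟩ | ⟨p, k, hp, rfl, hk⟩
        · -- the first letter cannot be a pause
          rcases List.take_eq_nil_iff.1 htake with h5 | h5
          · subst h5
            rw [hs] at h1
            exact absurd hbot.symm h1
          · simp [h5] at ht
        · refine ⟨s, p ++ (k ++ [w.getD t C]), 0, hpos, by rw [h3]; exact hxt, ?_,
            Or.inr ⟨p, _, hp, rfl, ?_⟩⟩
          · rw [hsucc, htake]; simp
          · rw [hs] at h1
            simp only [List.mem_append, List.mem_singleton, not_or]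
            exact ⟨hk, h1⟩
  obtain ⟨s, u, i, hi, hxt, htake, hu⟩ := key _ le_rfl
  have h1 := hxt.symm.trans hx
  have hlt : ∀ a b : ℤ, 0 ≤ a → a < 2 * z.length → 0 ≤ b → b < 2 * z.length →
      a ≡ b [ZMOD 2 * z.length] → a = b := by
    intro a b ha ha' hb hb' hab
    rwa [Int.ModEq, Int.emod_eq_of_lt ha ha', Int.emod_eq_of_lt hb hb'] at hab
  cases s
  · simp only [Bool.false_eq_true, if_false] at h1
    have := hlt _ _ (by omega) (by omega) (by omega) (by omega) h1
    obtain rfl : i = 0 := by omega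
    rw [List.take_length, List.take_zero, List.append_nil] at htake
    rcases hu with ⟨-, h⟩ | ⟨p, k, hp, rfl, hk⟩
    · simp at h
    · rcases List.eq_nil_or_concat k with rfl | ⟨k, y, rfl⟩
      · rw [htake, List.append_nil]; exact hp
      · rw [htake, List.concat_eq_append, ← List.append_assoc] at htop
        simp at htop
        simp [endLetter, htop] at hk
  · simp only [if_true] at h1
    have := hlt _ _ (by omega) (by omega) (by omega) (by omega) h1
    omega

end

/-! ### Words with a common period -/

/-- The letters `b s, …, b (s + k - 1)`. -/
def seg (b : ℕ → Letter) (s k : ℕ) : List Letter := (List.range k).map fun i => b (s + i)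

section
variable {b b' : ℕ → Letter}

theorem length_seg (b : ℕ → Letter) (s k : ℕ) : (seg b s k).length = k := by simp [seg]

theorem seg_add (b : ℕ → Letter) (s p q : ℕ) :
    seg b s (p + q) = seg b s p ++ seg b (s + p) q := by
  simp [seg, List.range_add, Function.comp_def, add_assoc]

theorem seg_congr {s s' k : ℕ} (h : ∀ i < k, b (s + i) = b' (s' + i)) :
    seg b s k = seg b' s' k :=
  List.map_congr_left fun i hi => h i (List.mem_range.1 hi)

theorem seg_reverse {s s' k : ℕ} (h : ∀ i < k, b (s + i) = b' (s' + (k - 1 - i))) :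
    seg b s k = (seg b' s' k).reverse := by
  apply List.ext_getElem
  · simp [seg]
  · intro i h1 h2
    rw [length_seg] at h1
    simp [seg, h i h1]

theorem notMem_seg {x : Letter} {s k : ℕ} (h : ∀ i < k, b (s + i) ≠ x) : x ∉ seg b s k := by
  simp only [seg, List.mem_map, List.mem_range, not_exists, not_and]
  exact h

theorem seg_getD (w : List Letter) : w = seg (fun t => w.getD t C) 0 w.length := by
  apply List.ext_getElem
  · simp [seg]
  · intro i h1 h2
    simp [seg, h1]

theorem seg_mul {d : ℕ} (h : ∀ y, b (y + d) = b y) (p k : ℕ) :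
    seg b 0 (p * d + k) = (List.replicate p (seg b 0 d)).flatten ++ seg b 0 k := by
  induction p with
  | zero => simp
  | succ p ih =>
    rw [show (p + 1) * d + k = d + (p * d + k) by ring, seg_add, List.replicate_succ,
      List.flatten_cons, List.append_assoc, ← ih]
    congr 1
    refine seg_congr (fun i _ => ?_)
    rw [← h (0 + i)]; congr 1; ring

theorem seg_mul_period {d : ℕ} (hd : 0 < d) {m : ℕ} (h : ∀ y, y + d < m → b (y + d) = b y) :
    ∀ y < m, b y = b (y % d) := by
  intro y
  induction y using Nat.strong_induction_on with
  | _ y ih =>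
    intro hy
    by_cases hyd : y < d
    · rw [Nat.mod_eq_of_lt hyd]
    · have h1 := h (y - d) (by omega)
      rw [Nat.sub_add_cancel (by omega)] at h1
      rw [h1, ih (y - d) (by omega) (by omega), ← Nat.mod_eq_sub_mod (by omega)]

end

theorem powerVec_zero (e : List ℤ) (m n : ℤ) : powerVec e m n 0 = e := by simp [powerVec]

theorem powerVec_succ (e : List ℤ) (m n : ℤ) (p : ℕ) : powerVec e m n (p + 1) =
    e ++ (evenVec m ++ (e.reverse ++ (evenVec n ++ powerVec e m n p))) := by
  simp [powerVec, List.replicate_succ]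

/-- The vectors `a` and `b` are powers with the same tile and the same connectors. -/
def CommonVec (a b : List ℤ) : Prop :=
  ∃ (e : SEven) (r s : ℤ) (p q : ℕ), 0 < p ∧ 0 < q ∧
    a = powerVec e.1 (2 * r) (2 * s) p ∧ b = powerVec e.1 (2 * r) (2 * s) q

theorem CommonVec.symm {a b : List ℤ} (h : CommonVec a b) : CommonVec b a := by
  obtain ⟨e, r, s, p, q, hp, hq, ha, hb⟩ := h
  exact ⟨e, r, s, q, p, hq, hp, hb, ha⟩

section
variable {a b e : List ℤ} {wa wb z k h : List Letter} {x y ya yb r s : ℤ} {n m : ℕ}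
  {f : ℕ → Letter}

theorem Enc.powerVec (he : Enc A x e z B y) (hk : Conn B y r y k) (hh : Conn A x s x h) (p : ℕ) :
    Enc A x (powerVec e (2 * r) (2 * s) p)
      ((List.replicate p (z ++ (k ++ (z.reverse ++ h)))).flatten ++ z) B y := by
  induction p with
  | zero => simpa [powerVec_zero] using he
  | succ p ih =>
    have h1 := hh he.reverse ih
    have := hk he h1
    rw [powerVec_succ, List.replicate_succ, List.flatten_cons]
    simpa [List.append_assoc] using this

theorem CommonPower.commonVec (ha : Enc A x a (seg f 0 n) B ya) (hb : Enc A x b (seg f 0 m) B yb)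
    (hnm : n ≤ m) (h : CommonPower n m f) : CommonVec a b := by
  obtain ⟨d, g, q, M, M', hq, hqg, hgd, hn, hm, hM, hM', hper, hpal, hpal', hA, hB, hlast⟩ := h
  have hd : 0 < d := by omega
  have hdm : d < m := by rw [hm]; nlinarith
  have hmod := seg_mul_period hd hper
  set f' : ℕ → Letter := fun y => f (y % d) with hf'
  have hff : ∀ y < d, f' y = f y := fun y hy => by rw [hf']; dsimp only; rw [Nat.mod_eq_of_lt hy]
  have hper' : ∀ y, f' (y + d) = f' y := fun y => by simp [hf']
  have hsa : seg f 0 n = seg f' 0 n := seg_congr fun i hi => by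
    rw [zero_add]; exact hmod i (by omega)
  have hsb : seg f 0 m = seg f' 0 m := seg_congr fun i hi => by
    rw [zero_add]; exact hmod i (by omega)
  have hblock : seg f' 0 d = seg f' 0 q ++ (seg f' q (g - 2 * q) ++
      ((seg f' 0 q).reverse ++ seg f' g (d - g))) := by
    have h1 : seg f' (g - q) q = (seg f' 0 q).reverse := seg_reverse fun i hi => by
      rw [hff _ (by omega), hff _ (by omega), hpal _ (by omega)]; congr 1; omega
    rw [← h1]
    conv_lhs => rw [show d = q + (g - 2 * q + (q + (d - g))) by omega]
    rw [seg_add, seg_add, seg_add, show 0 + q + (g - 2 * q) = g - q by omega, zero_add,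
      show g - q + q = g by omega]
  rw [hsa, hn, seg_mul hper'] at ha
  rw [hsb, hm, seg_mul hper'] at hb
  -- the first block is a reduced word
  have hred : (seg f' 0 d).IsChain (· ≠ ·) := by
    have := hb.chain
    rw [show M' = M' - 1 + 1 by omega, List.replicate_succ, List.flatten_cons,
      List.append_assoc] at this
    exact (List.isChain_append.1 this).1
  rw [hblock] at hred
  obtain ⟨hz, hred, -⟩ := List.isChain_append.1 hred
  obtain ⟨hk, hred, -⟩ := List.isChain_append.1 hred
  obtain ⟨-, hh, -⟩ := List.isChain_append.1 hred
  obtain ⟨t, ht⟩ : ∃ t, seg f' 0 q = A :: t := by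
    obtain ⟨t', ht'⟩ := hb.cons_word
    rw [show M' = M' - 1 + 1 by omega, List.replicate_succ, List.flatten_cons, hblock] at ht'
    rcases hz0 : seg f' 0 q with _ | ⟨u, t⟩
    · have := length_seg f' 0 q
      rw [hz0, List.length_nil] at this
      omega
    · rw [hz0] at ht'
      exact ⟨t, by rw [(List.cons.inj ht').1]⟩
  have hzl : (seg f' 0 q).getLast? = some B := by
    rw [show q = q - 1 + 1 by omega, seg_add, List.getLast?_append]
    simp [seg, hff _ (show q - 1 < d by omega), hlast]
  obtain ⟨e, σ, y, he⟩ := Enc.exists_of_word t A x (ht ▸ hz) (by decide)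
    (by rw [← ht, hzl]; decide) ha.left_ne.2
  rw [← ht] at he
  obtain rfl : B = σ := by
    have := he.getLast_word
    rw [hzl] at this
    exact Option.some.inj this
  obtain ⟨r, x', -, -, hx', hconn⟩ := exists_conn (σ := B) (by decide) he.right_ne.2
    (seg f' q (g - 2 * q)) (notMem_seg fun i hi => by
      rw [hff _ (by omega)]; exact hB _ (by omega) (by omega)) hk
    (List.ne_nil_of_length_pos (by rw [length_seg]; omega))
  obtain rfl := hx' (seg_reverse fun i hi => by
    rw [hff _ (by omega), hff _ (by omega), hpal _ (by omega)]; congr 1; omega).symm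
  obtain ⟨s, x', -, -, hx', hconn'⟩ := exists_conn (σ := A) (by decide) he.left_ne.2
    (seg f' g (d - g)) (notMem_seg fun i hi => by
      rw [hff _ (by omega)]; exact hA _ (by omega) (by omega)) hh
    (List.ne_nil_of_length_pos (by rw [length_seg]; omega))
  obtain rfl := hx' (seg_reverse fun i hi => by
    rw [hff _ (by omega), hff _ (by omega), hpal' _ (by omega)]; congr 1; omega).symm
  rw [hblock] at ha hb
  refine ⟨⟨e, he.isExpandedEven, he.parity.2 rfl⟩, r, s, M, M', hM, hM', ?_, ?_⟩
  · exact ha.vec_unique (he.powerVec hconn hconn' M)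
  · exact hb.vec_unique (he.powerVec hconn hconn' M')

theorem seg_altLetters {X : Letter} {s j : ℕ}
    (hf : ∀ i < 2 * j + 1, f (s + i) = if Even i then X else C) :
    seg f s (2 * j + 1) = altLetters X j := by
  induction j with
  | zero => simpa [seg, altLetters] using hf 0 (by omega)
  | succ j ih =>
    rw [altLetters_snoc, ← ih (fun i hi => hf i (by omega)),
      show 2 * (j + 1) + 1 = 2 * j + 1 + 2 by ring, seg_add]
    congr 1
    have h1 := hf (2 * j + 1) (by omega)
    have h2 := hf (2 * j + 1 + 1) (by omega)
    rw [if_neg (by simp)] at h1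
    rw [if_pos (by rw [Nat.even_iff]; omega)] at h2
    rw [← add_assoc] at h2
    simp only [seg, List.range_succ, List.range_zero, List.map_cons, List.map_nil,
      List.nil_append, List.singleton_append, add_zero]
    rw [h1, h2]

theorem seg_altLetters_add {X : Letter} {s κ ε : ℕ} (hε : ε ≤ 1) (hκ : 0 < κ) (hodd : Odd (κ + ε))
    (hf : ∀ i < κ, f (s + i) = if Even i then X else C) :
    seg f s κ = altLetters X ((κ - 1) / 2) ++ List.replicate ε C := by
  obtain ⟨j, hj⟩ := hodd
  rcases Nat.le_one_iff_eq_zero_or_eq_one.1 hε with rfl | rfl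
  · rw [show κ = 2 * j + 1 by omega, seg_altLetters fun i hi => hf i (by omega)]
    simp
  · have h1 := hf (κ - 1) (by omega)
    rw [if_neg (by rw [Nat.even_iff]; omega)] at h1
    rw [show κ = 2 * (j - 1) + 1 + 1 by omega, seg_add,
      seg_altLetters fun i hi => hf i (by omega), show (2 * (j - 1) + 1 + 1 - 1) / 2 = j - 1 by omega]
    rw [show κ - 1 = 2 * (j - 1) + 1 by omega, ← add_assoc] at h1
    simpa [seg, ← add_assoc] using h1

theorem AltPower.commonVec (ha : Enc A x a (seg f 0 n) B ya) (hb : Enc A x b (seg f 0 m) B yb)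
    (hnm : n ≤ m) (h : AltPower n m f) : CommonVec a b := by
  obtain ⟨κ, ℓ, ε, M, M', hκ, hℓ, hε, hoκ, hoℓ, hn, hm, hf⟩ := h
  have hn0 : 0 < n := by
    obtain ⟨t, ht⟩ := ha.cons_word
    have := congrArg List.length ht
    rw [length_seg] at this
    simp at this; omega
  set f' : ℕ → Letter := fun y => altWord κ (κ + ℓ) y with hf'
  have hsa : seg f 0 n = seg f' 0 n := seg_congr fun i hi => hf _ (by omega)
  have hsb : seg f 0 m = seg f' 0 m := seg_congr fun i hi => hf _ (by omega)
  have hper' : ∀ y, f' (y + (κ + ℓ)) = f' y := fun y => by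
    have := altWord_add κ (κ + ℓ) y 1
    simpa [hf'] using this
  have hlt : ∀ i < κ + ℓ, f' i = if i < κ then (if Even i then A else C) else
      (if Even ((i : ℤ) - κ) then B else C) := fun i hi => by
    have := altWord_of_lt (κ := κ) (δ := κ + ℓ) (r := i) 0 (by omega) (by omega)
    rw [mul_zero, zero_add] at this
    simp only [hf', this, Nat.cast_lt, Int.even_coe_nat]
  have h1 : seg f' 0 κ = altLetters A ((κ - 1) / 2) ++ List.replicate ε C :=
    seg_altLetters_add hε hκ hoκ fun i hi => by rw [zero_add, hlt i (by omega), if_pos hi]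
  have h2 : seg f' κ ℓ = altLetters B ((ℓ - 1) / 2) ++ List.replicate ε C :=
    seg_altLetters_add hε hℓ hoℓ fun i hi => by
      rw [hlt _ (by omega), if_neg (by omega)]
      simp only [Nat.cast_add, add_sub_cancel_left, Int.even_coe_nat]
  have h3 : seg f' κ (ℓ - ε) = altLetters B ((ℓ - 1) / 2) := by
    have h4 : seg f' κ ℓ = seg f' κ (ℓ - ε) ++ seg f' (κ + (ℓ - ε)) ε := by
      rw [← seg_add]; congr 1
      have := hoℓ.pos
      obtain ⟨j, hj⟩ := hoℓ
      omega
    rw [h4] at h2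
    exact (List.append_inj' h2 (by rw [length_seg, List.length_replicate])).1
  have hεℓ : ε ≤ ℓ := by omega
  -- the connector between blocks of the letters `A` and `B` changes the sign if `ε = 1`
  obtain ⟨u, hu, hux⟩ : ∃ u : ℤ, (u = 1 ∨ u = -1) ∧ u * 2 = x := by
    rcases ha.left_ne.2 with rfl | rfl
    exacts [⟨1, by simp⟩, ⟨-1, by simp⟩]
  obtain ⟨v, hv, hvu⟩ : ∃ v : ℤ, (v = 1 ∨ v = -1) ∧ v = if ε = 0 then u else -u := by
    refine ⟨_, ?_, rfl⟩
    split_ifs <;> omega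
  have hsep : sepWord (u * 2) (v * 2) = List.replicate ε C ∧
      sepWord (v * 2) (u * 2) = List.replicate ε C := by
    rcases Nat.le_one_iff_eq_zero_or_eq_one.1 hε with rfl | rfl
    · simp at hvu; simp [sepWord, hvu]
    · simp at hvu
      rw [sepWord, sepWord, if_neg (by omega), if_neg (by omega)]
      exact ⟨rfl, rfl⟩
  set i := (κ - 1) / 2
  set j := (ℓ - 1) / 2
  have key : ∀ p, Enc A x (powerVec [] (2 * (u * (i + 1))) (2 * (v * (j + 1))) (p + 1))
      (seg f' 0 (p * (κ + ℓ) + (κ + (ℓ - ε)))) B (v * 2) := by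
    have hE1 := enc_evenVec (X := A) (by decide) i hu
    have hE2 := enc_evenVec (X := B) (by decide) j hv
    intro p
    rw [seg_mul hper', seg_add f' 0 κ ℓ, seg_add f' 0 κ (ℓ - ε), zero_add, h1, h3, h2]
    have hb0 : Enc A x (evenVec (2 * (u * (i + 1))) ++ evenVec (2 * (v * (j + 1))))
        (altLetters A i ++ (List.replicate ε C ++ altLetters B j)) B (v * 2) := by
      rw [← hux, ← hsep.1]
      exact hE1.append_sep hE2 (by omega)
    induction p with
    | zero => simpa [powerVec] using hb0
    | succ p ih =>
      have := hb0.append_sep (z := u * 2) (by rw [hux]; exact ih) (by omega)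
      rw [hsep.2] at this
      rw [powerVec_succ]
      simpa [List.replicate_succ, List.append_assoc] using this
  have hpos : ∀ M k : ℕ, 0 < k → k + ε = M * (κ + ℓ) →
      0 < M ∧ k = (M - 1) * (κ + ℓ) + (κ + (ℓ - ε)) := by
    intro M k hk hkM
    rcases M with _ | M
    · omega
    · refine ⟨by omega, ?_⟩
      rw [Nat.add_sub_cancel]
      rw [Nat.succ_mul] at hkM
      omega
  obtain ⟨hM, hn'⟩ := hpos M n hn0 hn
  obtain ⟨hM', hm'⟩ := hpos M' m (by omega) hm
  rw [hsa, hn'] at ha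
  rw [hsb, hm'] at hb
  refine ⟨⟨[], ⟨by simp, by simp, by simp, by simp⟩, by simp⟩, u * (i + 1), v * (j + 1), M, M',
    hM, hM', ?_, ?_⟩
  · have := ha.vec_unique (key (M - 1))
    rwa [Nat.sub_add_cancel hM] at this
  · have := hb.vec_unique (key (M' - 1))
    rwa [Nat.sub_add_cancel hM'] at this

/-! ### Two vectors below a common one -/

theorem parsesWith_or_commonVec_of_le (ha : Enc A x a wa B ya) (hb : Enc A x b wb B yb)
    (hnm : wa.length ≤ wb.length) {w : List Letter} (h1 : WordChain wa true w)
    (h2 : WordChain wb true w) : ParsesWith b a ∨ CommonVec a b := by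
  have hL : ∀ {v y u}, Enc A x v u B y → FoldedLine u.length (lineOf u) := fun h => by
    obtain ⟨t, ht⟩ := h.cons_word
    exact foldedLine_lineOf ht h.getLast_word h.chain
  have La := hL ha
  have Lb := hL hb
  obtain ⟨hpre, hsh⟩ := shapes_of_readable La Lb hnm ⟨_, _, h1.readable La, h2.readable Lb⟩
  have hwb : wb = seg (fun y => lineOf wb y) 0 wb.length := by
    conv_lhs => rw [seg_getD wb]
    refine seg_congr fun i hi => ?_
    simp only [zero_add]
    exact (lineOf_natCast hi).symm
  have hwa : wa = seg (fun y => lineOf wb y) 0 wa.length := by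
    conv_lhs => rw [seg_getD wa]
    refine seg_congr fun i hi => ?_
    simp only [zero_add]
    have := hpre i (by omega)
    rw [this]
    exact (lineOf_natCast hi).symm
  have ha' := ha
  have hb' := hb
  rw [hwa] at ha'
  rw [hwb] at hb'
  rcases hsh with ⟨p, hp0, hpm, hp⟩ | h | h
  · left
    have hc : WordChain wa true wb := by
      refine wordChain_of_walk La ?_ hb.getLast_word hp0 hpm (fun y hy => ?_)
      · obtain ⟨t, ht⟩ := hb.cons_word
        rw [ht]; rfl
      · have := hp y hy
        simp only [lineOf_natCast hy] at this
        exact this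
    obtain ⟨ε₁, c, hc, hE⟩ := hc.exists_vec ha hb.chain
    obtain rfl := hE.vec_unique hb
    exact parsesWith_iff_chain.2 ⟨_, _, hc⟩
  · exact Or.inr (h.commonVec ha' hb' hnm)
  · exact Or.inr (h.commonVec ha' hb' hnm)

end

theorem Chain.exists_append {e c : List ℤ} {ε₁ : ℤ} {s : Bool} (h : Chain e 1 true ε₁ s c) :
    ∃ t, c = e ++ t := by
  induction h with
  | base => exact ⟨[], by simp [tileVec, smulVec_one]⟩
  | snoc _ _ _ _ _ ih =>
    obtain ⟨t, rfl⟩ := ih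
    exact ⟨_, List.append_assoc _ _ _⟩

theorem SEven.exists_enc (a : SEven) {x : ℤ} {t : List ℤ} (h : a.1 = x :: t) :
    ∃ w y, Enc A x a.1 w B y := by
  obtain ⟨a, ha, hev⟩ := a
  dsimp only at h ⊢
  subst h
  obtain ⟨w, σ, y, h⟩ := IsExpandedEven.exists_enc _ _ _ A le_rfl ha (by decide)
  obtain rfl := h.parity.1 hev
  exact ⟨w, y, h⟩

/-- The comparison of two vectors of which a common vector is built: one of them is built from the
other one, or they are powers with the same tile and the same connectors. -/
theorem ParsesWith.compare {c : List ℤ} {a b : SEven} (hc : Even c.length) (ha0 : a.1 ≠ [])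
    (hb0 : b.1 ≠ []) (ha : ParsesWith c a.1) (hb : ParsesWith c b.1) :
    ParsesWith b.1 a.1 ∨ ParsesWith a.1 b.1 ∨ CommonVec a.1 b.1 := by
  obtain ⟨ε, s, ha⟩ := parsesWith_iff_chain.1 ha
  obtain ⟨δ, t, hb⟩ := parsesWith_iff_chain.1 hb
  obtain rfl := (ha.even_length a.2.2).1 hc
  obtain rfl := (hb.even_length b.2.2).1 hc
  obtain ⟨x, ta, hxa⟩ := List.exists_cons_of_ne_nil ha0
  obtain ⟨x', tb, hxb⟩ := List.exists_cons_of_ne_nil hb0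
  obtain rfl : x = x' := by
    obtain ⟨u, hu⟩ := ha.exists_append
    obtain ⟨u', hu'⟩ := hb.exists_append
    rw [hu, hxa, hxb] at hu'
    exact (List.cons.inj hu').1
  obtain ⟨wa, ya, ea⟩ := a.exists_enc hxa
  obtain ⟨wb, yb, eb⟩ := b.exists_enc hxb
  obtain ⟨w, hwa, hca⟩ := ha.exists_word ea
  obtain ⟨w', hwb, hcb⟩ := hb.exists_word eb
  obtain ⟨rfl, -, -⟩ := hca.word_unique hcb
  rcases le_total wa.length wb.length with h | h
  · rcases parsesWith_or_commonVec_of_le ea eb h hwa hwb with h | h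
    exacts [Or.inl h, Or.inr (Or.inr h)]
  · rcases parsesWith_or_commonVec_of_le eb ea h hwb hwa with h | h
    exacts [Or.inr (Or.inl h), Or.inr (Or.inr h.symm)]

/-! ### The fractions of expanded even vectors -/

/-- The product of the matrices of the maps `t ↦ 1 / (x + t)`, over the entries `x`. -/
def cfMat : List ℤ → Matrix (Fin 2) (Fin 2) ℤ
  | [] => 1
  | x :: a => !![0, 1; 1, x] * cfMat a

theorem cfMat_append (a b : List ℤ) : cfMat (a ++ b) = cfMat a * cfMat b := by
  induction a with
  | nil => simp [cfMat]
  | cons x a ih => rw [List.cons_append, cfMat, ih, cfMat, mul_assoc]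

theorem cfMat_reverse (a : List ℤ) : cfMat a.reverse = (cfMat a).transpose := by
  induction a with
  | nil => simp [cfMat]
  | cons x a ih =>
    rw [List.reverse_cons, cfMat_append, ih]
    conv_rhs => rw [cfMat, Matrix.transpose_mul]
    congr 1
    ext i j
    fin_cases i <;> fin_cases j <;> simp [cfMat]

theorem det_cfMat (a : List ℤ) : (cfMat a).det = (-1) ^ a.length := by
  induction a with
  | nil => simp [cfMat]
  | cons x a ih => rw [cfMat, Matrix.det_mul, ih, List.length_cons, pow_succ, Matrix.det_fin_two]; simp

theorem cfMat_cons (x : ℤ) (a : List ℤ) :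
    cfMat (x :: a) 0 1 = cfMat a 1 1 ∧ cfMat (x :: a) 1 1 = cfMat a 0 1 + x * cfMat a 1 1 := by
  rw [cfMat, Matrix.mul_apply, Matrix.mul_apply, Fin.sum_univ_two, Fin.sum_univ_two]
  simp

theorem contFrac_neg (a : List ℤ) : contFrac (smulVec (-1) a) = -contFrac a := by
  induction a with
  | nil => simp [smulVec, contFrac]
  | cons x a ih =>
    rw [smulVec] at ih
    rw [smulVec, List.map_cons, contFrac, ih, contFrac]
    push_cast
    rw [← one_div_neg_eq_neg_one_div]
    congr 1; ring

section
variable {τ σ ρ : Letter} {x y u : ℤ} {v v' : List ℤ} {w w' : List Letter}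

namespace Enc

theorem contFrac_eq (h : Enc τ x v w σ y) : |cfMat v 0 1| < |cfMat v 1 1| ∧
    0 < x * (cfMat v 0 1 * cfMat v 1 1) ∧ contFrac v = cfMat v 0 1 / cfMat v 1 1 := by
  have step : ∀ x P Q : ℤ, x = 2 ∨ x = -2 → |P| < |Q| →
      |Q| < |P + x * Q| ∧ 0 < x * (Q * (P + x * Q)) ∧
        (1 / ((x : ℚ) + P / Q)) = Q / (P + x * Q : ℤ) := by
    intro x P Q hx h
    have hQ : Q ≠ 0 := by rintro rfl; simp at h; exact absurd (abs_nonneg P) (by omega)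
    have h1 : |Q| < |P + x * Q| := by
      rcases hx with rfl | rfl <;> rcases abs_cases P with h1 | h1 <;>
        rcases abs_cases Q with h2 | h2 <;> rw [lt_abs] <;> omega
    refine ⟨h1, ?_, ?_⟩
    · have h2 : P ^ 2 < Q ^ 2 := sq_lt_sq.2 h
      rcases hx with rfl | rfl <;> nlinarith [sq_nonneg (P + Q), sq_nonneg (P - Q)]
    · have hQ' : (Q : ℚ) ≠ 0 := by exact_mod_cast hQ
      rw [show (x : ℚ) + P / Q = (P + x * Q : ℤ) / Q by field_simp; push_cast; ring, one_div_div]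
  induction h with
  | one τ x hτ hx =>
    obtain ⟨h1, h2⟩ := cfMat_cons x []
    rw [h1, h2]
    simp only [cfMat, Matrix.one_apply, contFrac]
    rcases hx with rfl | rfl <;> norm_num
  | @same τ σ x y v w h ih =>
    obtain ⟨h1, h2⟩ := cfMat_cons x v
    rw [h1, h2, contFrac, ih.2.2]
    exact step x _ _ h.left_ne.2 ih.1
  | @opp τ σ x y v w h ih =>
    obtain ⟨h1, h2⟩ := cfMat_cons x v
    rw [h1, h2, contFrac, ih.2.2]
    exact step x _ _ (by have := h.left_ne.2; omega) ih.1
  | @zero τ σ x y v w h ih =>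
    obtain ⟨h1, h2⟩ := cfMat_cons x (0 :: v)
    obtain ⟨h3, h4⟩ := cfMat_cons 0 v
    rw [h1, h2, h3, h4, contFrac, contFrac, ih.2.2, zero_mul, add_zero]
    obtain ⟨i1, i2, -⟩ := ih
    have hx := h.left_ne.2
    generalize cfMat v 0 1 = P at *
    generalize cfMat v 1 1 = Q at *
    have hP : P ≠ 0 := by rintro rfl; simp at i2
    have hP' : (P : ℚ) ≠ 0 := by exact_mod_cast hP
    have h2 : 0 < P ^ 2 := by positivity
    refine ⟨?_, ?_, ?_⟩
    · apply sq_lt_sq.1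
      rcases hx with rfl | rfl <;> nlinarith
    · rcases hx with rfl | rfl <;> nlinarith
    · rw [Int.cast_zero, zero_add, one_div_div,
        show (x : ℚ) + Q / P = (Q + x * P : ℤ) / P by field_simp; push_cast; ring, one_div_div]

theorem contFrac_bounds (h : Enc τ x v w σ y) : |contFrac v| < 1 ∧ 0 < x * contFrac v := by
  obtain ⟨h1, h2, h3⟩ := h.contFrac_eq
  rw [h3]
  have hQ : cfMat v 1 1 ≠ 0 := by intro h; simp [h] at h2
  have hQ' : (cfMat v 1 1 : ℚ) ≠ 0 := by exact_mod_cast hQ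
  constructor
  · rw [abs_div, div_lt_one (abs_pos.2 hQ')]
    exact_mod_cast h1
  · have h4 : (0 : ℚ) < x * (cfMat v 0 1 * cfMat v 1 1) := by exact_mod_cast h2
    have h5 : (x : ℚ) * (cfMat v 0 1 / cfMat v 1 1) =
        x * (cfMat v 0 1 * cfMat v 1 1) / (cfMat v 1 1 : ℚ) ^ 2 := by field_simp
    rw [h5]
    positivity

/-- The fraction of an expanded even vector determines the vector. -/
theorem eq_of_contFrac (h : Enc τ x v w σ y) {x' : ℤ} (h' : Enc τ x' v' w' ρ u)
    (he : contFrac v = contFrac v') : v = v' := by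
  have hinv : ∀ (x : ℤ) (s t : ℚ), 1 / ((x : ℚ) + s) = 1 / (x + t) → s = t := by
    intro x s t h
    rw [one_div, one_div, inv_inj] at h
    linarith
  have hz : ∀ {τ x v w σ y}, Enc τ x v w σ y → 1 < |contFrac (0 :: v)| := by
    intro τ x v w σ y h
    obtain ⟨h1, h2⟩ := h.contFrac_bounds
    have h0 : contFrac v ≠ 0 := by intro h; simp [h] at h2
    rw [contFrac, Int.cast_zero, zero_add, abs_div, abs_one, lt_div_iff₀ (abs_pos.2 h0)]
    linarith
  have hx : x = x' := by
    have h1 := h.contFrac_bounds.2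
    have h2 := h'.contFrac_bounds.2
    rw [← he] at h2
    rcases h.left_ne.2 with rfl | rfl <;> rcases h'.left_ne.2 with rfl | rfl
    · rfl
    · push_cast at h1 h2; linarith
    · push_cast at h1 h2; linarith
    · rfl
  subst hx
  induction h generalizing v' w' with
  | one τ x hτ hx =>
    cases h' with
    | one => rfl
    | same h' =>
      have := hinv _ _ _ he
      have := h'.contFrac_bounds.2
      simp_all [contFrac]
    | opp h' =>
      have := hinv _ _ _ he
      have := h'.contFrac_bounds.2
      simp_all [contFrac]
    | zero h' =>
      have := hinv _ _ _ he
      have h3 := hz h'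
      rw [← this] at h3
      norm_num [contFrac] at h3
  | same h ih =>
    have hb := h.contFrac_bounds
    cases h' with
    | one =>
      have := hinv _ _ _ he
      rw [this] at hb
      simp [contFrac] at hb
    | same h' => rw [ih (hinv _ _ _ he) h']
    | opp h' =>
      have := h'.contFrac_bounds.2
      rw [← hinv _ _ _ he] at this
      push_cast at this
      linarith [hb.2]
    | zero h' =>
      have := hz h'
      rw [hinv _ _ _ he] at hb
      linarith [hb.1]
  | opp h ih =>
    have hb := h.contFrac_bounds
    cases h' with
    | one =>
      have := hinv _ _ _ he
      rw [this] at hb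
      simp [contFrac] at hb
    | same h' =>
      have := h'.contFrac_bounds.2
      rw [← hinv _ _ _ he] at this
      push_cast at hb
      linarith [hb.2]
    | opp h' => rw [ih (hinv _ _ _ he) h']
    | zero h' =>
      have := hz h'
      rw [hinv _ _ _ he] at hb
      linarith [hb.1]
  | zero h ih =>
    have hb := hz h
    cases h' with
    | one =>
      have := hinv _ _ _ he
      rw [this] at hb
      norm_num [contFrac] at hb
    | same h' =>
      have := h'.contFrac_bounds.1
      rw [← hinv _ _ _ he] at this
      linarith
    | opp h' =>
      have := h'.contFrac_bounds.1
      rw [← hinv _ _ _ he] at this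
      linarith
    | zero h' => rw [ih (hinv 0 _ _ (hinv _ _ _ he)) h']

/-- Reversing a vector of even length inverts the numerator of its fraction, up to sign. -/
theorem num_den (h : Enc τ x v w σ y) (hev : Even v.length) :
    (contFrac v.reverse).den = (contFrac v).den ∧ |(contFrac v).num| < (contFrac v).den ∧
      |(contFrac v.reverse).num| < (contFrac v).den ∧
      (contFrac v).num * (contFrac v.reverse).num ≡ -1 [ZMOD (contFrac v).den] := by
  obtain ⟨h1, h2, h3⟩ := h.contFrac_eq
  obtain ⟨k1, k2, k3⟩ := h.reverse.contFrac_eq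
  have hdet := det_cfMat v
  rw [hev.neg_one_pow, Matrix.det_fin_two] at hdet
  rw [cfMat_reverse, Matrix.transpose_apply, Matrix.transpose_apply] at k1 k3
  generalize cfMat v 0 0 = R at *
  generalize cfMat v 0 1 = P at *
  generalize cfMat v 1 0 = S at *
  generalize cfMat v 1 1 = Q at *
  obtain ⟨s, hs, hsQ⟩ : ∃ s : ℤ, (s = 1 ∨ s = -1) ∧ 0 < s * Q := by
    rcases lt_trichotomy Q 0 with h | h | h
    · exact ⟨-1, by simp, by omega⟩
    · simp [h] at h2
    · exact ⟨1, by simp, by omega⟩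
  have hss : s * s = 1 := by rcases hs with rfl | rfl <;> rfl
  have hs0 : (s : ℚ) ≠ 0 := by rcases hs with rfl | rfl <;> norm_num
  have hfrac : ∀ T : ℤ, (∃ a b, a * T + b * Q = 1) →
      ((T : ℚ) / Q).num = s * T ∧ (((T : ℚ) / Q).den : ℤ) = s * Q := by
    rintro T ⟨a, b, hab⟩
    have hcop : (s * T).natAbs.Coprime (s * Q).natAbs := by
      rw [← Int.isCoprime_iff_nat_coprime]
      exact ⟨s * a, s * b, by linear_combination hss * (a * T + b * Q) + hab⟩
    have : (T : ℚ) / Q = (s * T : ℤ) / (s * Q : ℤ) := by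
      push_cast; rw [mul_div_mul_left _ _ hs0]
    rw [this]
    exact ⟨Rat.num_div_eq_of_coprime hsQ hcop, Rat.den_div_eq_of_coprime hsQ hcop⟩
  obtain ⟨n1, d1⟩ := hfrac P ⟨-S, R, by linear_combination hdet⟩
  obtain ⟨n2, d2⟩ := hfrac S ⟨-P, R, by linear_combination hdet⟩
  have hQ : s * Q = |Q| := by
    rcases hs with rfl | rfl
    · rw [one_mul, abs_of_pos (by omega)]
    · rw [neg_one_mul, abs_of_neg (by omega)]
  have hT : ∀ T, |s * T| = |T| := fun T => by rcases hs with rfl | rfl <;> simp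
  rw [h3, k3, n1, n2, d1, hT, hT]
  refine ⟨by exact_mod_cast d2.trans d1.symm, hQ ▸ h1, hQ ▸ k1, ?_⟩
  · refine Int.modEq_iff_dvd.2 ⟨-(s * R), ?_⟩
    linear_combination (R * Q - P * S) * hss + hdet

end Enc

end

theorem Int.eq_of_modEq_of_even {p p' q : ℤ} (hp : Even p) (hp' : Even p') (hq : Odd q)
    (h : |p| < q) (h' : |p'| < q) (hm : p' ≡ p [ZMOD q]) : p' = p := by
  obtain ⟨k, hk⟩ := hm.dvd
  have h1 : Even (q * k) := hk ▸ hp.sub hp'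
  obtain ⟨j, rfl⟩ := (Int.even_mul.1 h1).resolve_left (Int.not_even_iff_odd.2 hq)
  rw [abs_lt] at h h'
  have : j = 0 := by
    by_contra h0
    rcases lt_or_gt_of_ne h0 with h0 | h0 <;> nlinarith
  subst this
  omega

/-- The class of a vector of `SEven` is determined by its knot. -/
theorem vecEquiv_of_knotOf_eq {c c' : SEven} (h : knotOf c = knotOf c') : VecEquiv c'.1 c.1 := by
  obtain ⟨hden, h⟩ : KnotEquiv _ _ := Quotient.exact h
  dsimp only at hden h
  have hempty : ∀ c : SEven, c.1 ≠ [] → (contFrac c.1).den ≠ 1 := by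
    intro c hc hd
    obtain ⟨x, t, hx⟩ := List.exists_cons_of_ne_nil hc
    obtain ⟨w, y, he⟩ := c.exists_enc hx
    have h1 := (he.num_den c.2.2).2.1
    rw [hd, Nat.cast_one, Int.abs_lt_one_iff] at h1
    have h2 := he.contFrac_bounds.2
    rw [Rat.num_eq_zero.1 h1] at h2
    simp at h2
  by_cases hc : c.1 = []
  · by_cases hc' : c'.1 = []
    · rw [hc, hc']; exact VecEquiv.refl _
    · rw [hc] at hden
      exact absurd hden (hempty c' hc')
  have hc' : c'.1 ≠ [] := by
    intro hc'
    rw [hc'] at hden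
    exact hempty c hc hden.symm
  obtain ⟨x, t, hx⟩ := List.exists_cons_of_ne_nil hc
  obtain ⟨w, y, he⟩ := c.exists_enc hx
  obtain ⟨x', t', hx'⟩ := List.exists_cons_of_ne_nil hc'
  obtain ⟨w', y', he'⟩ := c'.exists_enc hx'
  have hpar : ∀ v : List ℤ, IsExpandedEven v → Even v.length →
      Even (contFrac v).num ∧ Odd (contFrac v).den := by
    rintro v hv ⟨n, hn⟩
    exact contFrac_parity n v hn hv.entries hv.last_ne hv.zero_entry
  obtain ⟨hp, hq⟩ := hpar _ c.2.1 c.2.2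
  obtain ⟨hp', -⟩ := hpar _ c'.2.1 c'.2.2
  obtain ⟨hr, -⟩ := hpar _ he.reverse.isExpandedEven (by simpa using c.2.2)
  obtain ⟨d1, b1, b2, hm⟩ := he.num_den c.2.2
  have b3 := (he'.num_den c'.2.2).2.1
  rw [hden] at b3
  have hq' : Odd ((contFrac c.1).den : ℤ) := by exact_mod_cast hq
  -- the numerator is that of a given representative
  have key : ∀ (v : List ℤ) {τ : Letter} {x y : ℤ} {w : List Letter} {σ : Letter}, τ ≠ C →
      Enc τ x v w σ y → (contFrac v).den = (contFrac c.1).den →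
      Even (contFrac v).num → |(contFrac v).num| < (contFrac c.1).den →
      (contFrac c'.1).num ≡ (contFrac v).num [ZMOD (contFrac c.1).den] → c'.1 = v := by
    intro v τ x y w σ hτ hv hd hev hb hmod
    have hnum := Int.eq_of_modEq_of_even hev hp' hq' hb b3 hmod
    have hval : contFrac c'.1 = contFrac v := Rat.ext hnum (by rw [hden, hd])
    rcases Letter.eq_or_eq_swap hτ (show A ≠ C by decide) with hA | hA
    · exact he'.eq_of_contFrac (hA ▸ hv) hval
    · exact he'.eq_of_contFrac (hA ▸ hv.swap) hval
  have hneg : ∀ v : List ℤ, (contFrac (smulVec (-1) v)).den = (contFrac v).den ∧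
      (contFrac (smulVec (-1) v)).num = -(contFrac v).num := by
    intro v; rw [contFrac_neg]; exact ⟨Rat.neg_den _, Rat.neg_num _⟩
  have hσ := he.right_ne.1
  rcases h with h | h | h | h
  · exact ⟨1, Or.inl rfl, Or.inl (by rw [smulVec_one]; exact key _ (by decide) he rfl hp b1 h)⟩
  · refine ⟨-1, Or.inr rfl, Or.inl (key _ (by decide) he.neg (hneg _).1 ?_ ?_ ?_)⟩
    · rw [(hneg _).2]; exact hp.neg
    · rwa [(hneg _).2, abs_neg]
    · rwa [(hneg _).2]
  · refine ⟨-1, Or.inr rfl, Or.inr (key _ hσ he.reverse.neg ((hneg _).1.trans d1) ?_ ?_ ?_)⟩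
    · rw [(hneg _).2]; exact hr.neg
    · rwa [(hneg _).2, abs_neg]
    · rw [(hneg _).2]
      have h1 := h.mul_right (contFrac c.1.reverse).num
      have h2 := hm.mul_right (contFrac c'.1).num
      have h3 := h1.symm.trans ((by ring_nf; rfl : _ ≡ _ [ZMOD _]).trans h2)
      have h4 := h3.neg
      simpa using h4.symm
  · refine ⟨1, Or.inl rfl, Or.inr ?_⟩
    rw [smulVec_one]
    refine key _ hσ he.reverse d1 hr b2 ?_
    have h1 := h.mul_right (contFrac c.1.reverse).num
    have h2 := hm.mul_right (contFrac c'.1).num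
    have h3 := h1.symm.trans ((by ring_nf; rfl : _ ≡ _ [ZMOD _]).trans h2)
    have h4 := h3.neg
    simpa using h4.symm

/-! ### Powers of a tile -/

section
variable {e f t t' : List ℤ} {m n μ ν r s r' : ℤ} {p q : ℕ}

/-- A connector is determined by any vector that it starts, unless it is followed by `0`. -/
theorem evenVec_append_inj (ht : t.head? ≠ some 0) (ht' : t'.head? ≠ some 0)
    (h : evenVec (2 * r) ++ t = evenVec (2 * r') ++ t') : r = r' ∧ t = t' := by
  have alt : ∀ {u : ℤ} (i j : ℕ), smulVec u (alternatingVec (i + 1)) ++ t =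
      smulVec u (alternatingVec (j + 1)) ++ t' → i = j := by
    intro u i
    induction i with
    | zero =>
      rintro (_ | j) h
      · rfl
      · simp [smulVec, alternatingVec] at h
        simp [h] at ht
    | succ i ih =>
      rintro (_ | j) h
      · simp [smulVec, alternatingVec] at h
        simp [← h] at ht'
      · rw [ih j (by simpa [smulVec, alternatingVec] using h)]
  have hform : ∀ r : ℤ, r ≠ 0 → ∃ i : ℕ, (r = r.sign * (i + 1)) ∧
      evenVec (2 * r) = smulVec r.sign (alternatingVec (i + 1)) := by
    intro r hr
    have hi : r.natAbs = r.natAbs - 1 + 1 := by omega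
    refine ⟨r.natAbs - 1, ?_, ?_⟩
    · have := Int.sign_mul_natAbs r
      rw [hi] at this
      push_cast at this
      exact this.symm
    · rw [evenVec, Int.sign_mul, ← hi, show Int.sign 2 = 1 from rfl, one_mul,
        show (2 * r).natAbs / 2 = r.natAbs by omega]
  have hhead : ∀ i : ℕ, ∃ l, alternatingVec (i + 1) = 2 :: l := by
    rintro (_ | i) <;> exact ⟨_, rfl⟩
  have key : r = r' := by
    by_cases h0 : r = 0
    · by_cases h0' : r' = 0
      · rw [h0, h0']
      · obtain ⟨i, -, hi⟩ := hform r' h0'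
        obtain ⟨l, hl⟩ := hhead i
        rw [hi, h0, hl] at h
        simp [evenVec, smulVec, alternatingVec] at h
        exact absurd h.1 h0'
    · obtain ⟨i, hr, hi⟩ := hform r h0
      obtain ⟨l, hl⟩ := hhead i
      by_cases h0' : r' = 0
      · rw [hi, h0', hl] at h
        simp [evenVec, smulVec, alternatingVec] at h
        exact absurd h.1 h0
      · obtain ⟨j, hr', hj⟩ := hform r' h0'
        obtain ⟨l', hl'⟩ := hhead j
        rw [hi, hj] at h
        have hs : r.sign = r'.sign := by
          have := h
          rw [hl, hl'] at this
          simpa [smulVec] using (List.cons.inj this).1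
        rw [hs] at h hr
        rw [hr, hr', alt i j h, Int.sign_mul, Int.sign_sign]
        rw [Int.sign_eq_one_of_pos (show (0 : ℤ) < j + 1 by omega), mul_one]
  subst key
  exact ⟨rfl, List.append_cancel_left h⟩

theorem evenVec_head (h : r ≠ 0) (t : List ℤ) : (evenVec (2 * r) ++ t).head? ≠ some 0 := by
  intro h'
  have h1 : evenVec (2 * r) ≠ [] := by
    intro h1
    have := evenVec_length_odd (2 * r)
    simp [h1] at this
  obtain ⟨x, l, hl⟩ := List.exists_cons_of_ne_nil h1
  rw [hl] at h'
  simp at h'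
  subst h'
  have := (evenVec_append_inj (r := r) (r' := 0) (t := []) (t' := [] ) (by simp) (by simp))
  rcases l with _ | ⟨y, l⟩
  · exact h (this (by rw [hl]; simp [evenVec, smulVec, alternatingVec])).1
  · rw [evenVec] at hl
    generalize (2 * r).natAbs / 2 = k at hl
    rcases k with _ | _ | k
    · simp [smulVec, alternatingVec] at hl
    · simp [smulVec, alternatingVec] at hl
    · simp [smulVec, alternatingVec] at hl
      exact h hl.1

theorem powerVec_add (e : List ℤ) (m n : ℤ) (p q : ℕ) : powerVec e m n (p + q) =
    (List.replicate p (e ++ evenVec m ++ e.reverse ++ evenVec n)).flatten ++ powerVec e m n q := by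
  rw [powerVec, powerVec, List.replicate_add, List.flatten_append, List.append_assoc]

theorem powerVec_add_add_one (e : List ℤ) (m n : ℤ) (p q : ℕ) : powerVec e m n (p + q + 1) =
    powerVec e m n p ++ (evenVec m ++ (e.reverse ++ (evenVec n ++ powerVec e m n q))) := by
  induction p with
  | zero => rw [zero_add, powerVec_succ, powerVec_zero]
  | succ p ih =>
    rw [show p + 1 + q + 1 = p + q + 1 + 1 by ring, powerVec_succ, ih, powerVec_succ e m n p]
    simp only [List.append_assoc]

theorem powerVec_reverse (e : List ℤ) (m n : ℤ) (p : ℕ) :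
    (powerVec e m n p).reverse = powerVec e.reverse n m p := by
  induction p with
  | zero => rw [powerVec_zero, powerVec_zero]
  | succ p ih =>
    have := powerVec_add_add_one e.reverse n m p 0
    rw [powerVec_zero, add_zero] at this
    rw [this, powerVec_succ]
    simp [List.reverse_append, evenVec_reverse, ih]

theorem powerVec_reverse_append (e : List ℤ) (m n : ℤ) (p q : ℕ) :
    powerVec e.reverse n m p ++ (evenVec n ++ powerVec e m n q) =
      e.reverse ++ (evenVec n ++ powerVec e m n (p + q)) := by
  induction p with
  | zero => rw [powerVec_zero, zero_add]
  | succ p ih =>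
    rw [powerVec_succ, show p + 1 + q = p + q + 1 by ring, powerVec_succ e]
    simp only [List.append_assoc, ih, List.reverse_reverse]

/-- A power of a power, with the same connectors, is a power. -/
theorem powerVec_powerVec (e : List ℤ) (m n : ℤ) (p q : ℕ) :
    powerVec (powerVec e m n p) m n q = powerVec e m n (2 * p * q + p + q) := by
  induction q with
  | zero => rw [powerVec_zero, mul_zero, zero_add, add_zero]
  | succ q ih =>
    rw [powerVec_succ, ih, powerVec_reverse, powerVec_reverse_append, ← powerVec_add_add_one]
    congr 1; ring

theorem length_powerVec (e : List ℤ) (m n : ℤ) (p : ℕ) : (powerVec e m n p).length =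
    p * (2 * e.length + (evenVec m).length + (evenVec n).length) + e.length := by
  induction p with
  | zero => simp [powerVec_zero]
  | succ p ih => rw [powerVec_succ]; simp [ih]; ring

theorem length_powerVec_lt (e : List ℤ) (m n : ℤ) :
    (powerVec e m n p).length < (powerVec e m n q).length ↔ p < q := by
  have := (evenVec_length_odd m).pos
  rw [length_powerVec, length_powerVec, Nat.add_lt_add_iff_right]
  exact Nat.mul_lt_mul_right (by omega)

/-- A power parses with respect to its tile. -/
theorem parsesWith_powerVec (f : List ℤ) (r s : ℤ) (p : ℕ) :
    ParsesWith (powerVec f (2 * r) (2 * s) p) f := by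
  refine parsesWith_iff_chain.2 ⟨1, true, ?_⟩
  induction p with
  | zero =>
    have := Chain.base (e := f) (s₀ := true) (ε₀ := 1) (Or.inl rfl)
    simpa [powerVec_zero, tileVec, smulVec_one] using this
  | succ p ih =>
    have h1 := (ih.snoc 1 r (Or.inl rfl) (fun _ => rfl)).snoc 1 s (Or.inl rfl) (fun _ => rfl)
    have h2 := powerVec_add_add_one f (2 * r) (2 * s) p 0
    rw [powerVec_zero, add_zero] at h2
    rw [h2]
    simpa [tileVec, smulVec_one, List.append_assoc] using h1

/-- The tile `e` neither starts nor ends with `0`, and if it is empty then the connectors `2 r` and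
`2 s` do not vanish. So the entry that follows a connector in a power of `e` is never `0`. -/
structure RegularTile (e : List ℤ) (r s : ℤ) : Prop where
  head : e.head? ≠ some 0
  last : e.getLast? ≠ some 0
  left : e = [] → r ≠ 0
  right : e = [] → s ≠ 0

namespace RegularTile

theorem head_append (h : RegularTile e r s) (t : List ℤ) :
    (e ++ (evenVec (2 * r) ++ t)).head? ≠ some 0 := by
  rcases he : e with _ | ⟨x, l⟩
  · exact evenVec_head (h.left he) t
  · have := h.head
    rw [he] at this
    simpa using this

theorem reverse (h : RegularTile e r s) : RegularTile e.reverse s r :=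
  ⟨by simpa using h.last, by simpa using h.head, fun he => h.right (by simpa using he),
    fun he => h.left (by simpa using he)⟩

theorem of_isExpandedEven (he : IsExpandedEven e)
    (h : IsExpandedEven (powerVec e (2 * r) (2 * s) (p + 1))) : RegularTile e r s := by
  have h0 : evenVec (2 * 0) = [0] := by simp [evenVec, smulVec, alternatingVec]
  refine ⟨he.first_ne, he.last_ne, ?_, ?_⟩
  · rintro rfl rfl
    have := h.first_ne
    rw [powerVec_succ, h0] at this
    simp at this
  · rintro rfl rfl
    have := h.last_ne
    have h2 := powerVec_add_add_one [] (2 * r) (2 * 0) p 0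
    rw [add_zero, powerVec_zero, h0] at h2
    rw [h2] at this
    simp at this

end RegularTile

/-- A chain of tiles `f` that starts a power of `f` is a power, possibly up to one more tile. -/
theorem Chain.eq_powerVec {u : List ℤ} {ε : ℤ} {b : Bool} (hf : RegularTile f r s) (hf0 : f ≠ [])
    (h : Chain f 1 true ε b u) (hu : u <+: powerVec f (2 * r) (2 * s) q) :
    ∃ k, u = powerVec f (2 * r) (2 * s) k ++
      if b then [] else evenVec (2 * r) ++ f.reverse := by
  have hlen : ∀ ε b, (tileVec f ε b).length = f.length := by
    intro ε b; rw [tileVec, length_smulVec]; cases b <;> simp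
  have hhead : ∀ {ε : ℤ} (b : Bool) (t : List ℤ), (ε = 1 ∨ ε = -1) →
      (tileVec f ε b ++ t).head? ≠ some 0 := by
    intro ε b t hε
    have h1 : (if b then f else f.reverse).head? ≠ some 0 := by
      cases b
      · simpa using hf.last
      · exact hf.head
    have h2 : (if b then f else f.reverse) ≠ [] := by cases b <;> simpa using hf0
    obtain ⟨x, l, hl⟩ := List.exists_cons_of_ne_nil h2
    rw [hl] at h1
    rw [tileVec, hl]
    rcases hε with rfl | rfl <;> simpa [smulVec] using h1
  have htile : ∀ {ε : ℤ} (b : Bool) {x y : ℤ} {t t' : List ℤ}, (ε = 1 ∨ ε = -1) →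
      t'.head? ≠ some 0 → evenVec (2 * x) ++ (tileVec f ε b ++ t) = evenVec (2 * y) ++ t' →
      evenVec (2 * x) = evenVec (2 * y) ∧ tileVec f ε b ++ t = t' := by
    intro ε b x y t t' hε ht' h
    obtain ⟨h1, h2⟩ := evenVec_append_inj (hhead b t hε) ht' h
    exact ⟨by rw [h1], h2⟩
  induction h with
  | base =>
    exact ⟨0, by simp [powerVec_zero, tileVec, smulVec_one]⟩
  | @snoc ε b u h ε₂ x hε hr ih =>
    obtain ⟨k, hk⟩ := ih ((List.prefix_append _ _).trans hu)
    obtain ⟨t, ht⟩ := hu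
    have hkq : k < q := by
      rw [← length_powerVec_lt f (2 * r) (2 * s), ← ht, hk]
      have := (evenVec_length_odd (2 * x)).pos
      simp only [List.length_append]
      omega
    obtain ⟨z, rfl⟩ := Nat.exists_eq_add_of_lt hkq
    rw [powerVec_add_add_one, hk] at ht
    simp only [List.append_assoc] at ht
    have ht := List.append_cancel_left ht
    cases b
    · simp only [Bool.false_eq_true, if_false, List.append_assoc] at ht
      have ht := List.append_cancel_left (List.append_cancel_left ht)
      obtain ⟨y, hy⟩ : ∃ y, powerVec f (2 * r) (2 * s) z = f ++ y := by
        rcases z with _ | z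
        · exact ⟨[], by simp [powerVec_zero]⟩
        · exact ⟨_, powerVec_succ _ _ _ _⟩
      rw [hy] at ht
      obtain ⟨h1, h2⟩ := htile _ hε (by
        have := hhead (ε := 1) true y (Or.inl rfl)
        simpa [tileVec, smulVec_one] using this) ht
      have h3 := (List.append_inj h2 (hlen _ _)).1
      refine ⟨k + 1, ?_⟩
      have h4 := powerVec_add_add_one f (2 * r) (2 * s) k 0
      rw [powerVec_zero, add_zero] at h4
      rw [h1, h3, h4, hk]
      simp
    · simp only [if_true, List.nil_append] at ht
      obtain ⟨h1, h2⟩ := htile _ hε (by simpa using hf.reverse.head_append _) ht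
      have h3 := (List.append_inj h2 (by rw [hlen]; simp)).1
      refine ⟨k, ?_⟩
      rw [h1, h3, hk]
      simp

/-- If a power of `f` starts and ends a power of a shorter power `e` of `f`, then the connectors of
both powers agree. -/
theorem connectors_eq {x y : ℕ} {m n : ℤ} (hf : RegularTile f r s)
    (he : RegularTile (powerVec f (2 * r) (2 * s) x) m n) (hxy : x < y)
    (h1 : powerVec f (2 * r) (2 * s) y <+:
      powerVec (powerVec f (2 * r) (2 * s) x) (2 * m) (2 * n) (p + 1))
    (h2 : powerVec f (2 * r) (2 * s) y <:+
      powerVec (powerVec f (2 * r) (2 * s) x) (2 * m) (2 * n) (p + 1)) : m = r ∧ n = s := by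
  obtain ⟨z, rfl⟩ := Nat.exists_eq_add_of_lt hxy
  obtain ⟨t, ht⟩ := h1
  obtain ⟨t', ht'⟩ := h2
  constructor
  · rw [powerVec_add_add_one, powerVec_succ] at ht
    simp only [List.append_assoc] at ht
    refine (evenVec_append_inj ?_ ?_ (List.append_cancel_left ht)).1.symm
    · exact hf.reverse.head_append _
    · exact he.reverse.head_append _
  · rw [show x + z + 1 = z + x + 1 by ring, powerVec_add_add_one] at ht'
    have h3 := powerVec_add_add_one (powerVec f (2 * r) (2 * s) x) (2 * m) (2 * n) p 0
    rw [powerVec_zero, add_zero] at h3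
    rw [h3] at ht'
    simp only [← List.append_assoc] at ht'
    have h4 := congrArg List.reverse (List.append_cancel_right ht')
    simp only [List.reverse_append, evenVec_reverse, List.append_assoc, List.reverse_reverse] at h4
    refine (evenVec_append_inj ?_ ?_ h4).1.symm
    · exact hf.head_append _
    · exact he.head_append _

end

/-! ### The shortest tile -/

theorem isExpandedEven_nil : IsExpandedEven [] := ⟨by simp, by simp, by simp, by simp⟩

theorem alternatingVec_getD_odd (k i : ℕ) : (alternatingVec k).getD (2 * i + 1) 0 = 0 := by
  induction k using Nat.strong_induction_on generalizing i with
  | _ k ih =>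
    match k with
    | 0 => simp [alternatingVec]
    | 1 => simp [alternatingVec]
    | k + 2 =>
      rcases i with _ | i
      · rfl
      · exact ih (k + 1) (by omega) i

theorem evenVec_getD_odd (m : ℤ) {i : ℕ} (hi : Odd i) : (evenVec m).getD i 0 = 0 := by
  obtain ⟨j, rfl⟩ := hi
  have := alternatingVec_getD_odd (m.natAbs / 2) j
  rw [evenVec, smulVec]
  rw [List.getD_eq_getElem?_getD] at this ⊢
  rw [List.getElem?_map]
  cases h : (alternatingVec (m.natAbs / 2))[2 * j + 1]? with
  | none => rfl
  | some y => rw [h] at this; simp only [Option.getD_some] at this; simp [this]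

section
variable {e f v : List ℤ} {m n r s : ℤ} {p q : ℕ}

/-- An expanded even vector of even length that starts and ends a power of the empty tile is such a
power itself. A cut inside a connector would be next to an entry `0` of the vector. -/
theorem eq_powerVec_nil (hv : IsExpandedEven v) (hev : Even v.length) (hs : s ≠ 0)
    (h1 : v <+: powerVec [] (2 * r) (2 * s) p) (h2 : v <:+ powerVec [] (2 * r) (2 * s) p) :
    ∃ k, v = powerVec [] (2 * r) (2 * s) k := by
  obtain ⟨M, hM⟩ : ∃ M, M = evenVec (2 * r) := ⟨_, rfl⟩
  obtain ⟨N, hN⟩ : ∃ N, N = evenVec (2 * s) := ⟨_, rfl⟩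
  have hMz : ∀ i, Odd i → M.getD i 0 = 0 := fun i hi => hM ▸ evenVec_getD_odd _ hi
  have hNz : ∀ i, Odd i → N.getD i 0 = 0 := fun i hi => hN ▸ evenVec_getD_odd _ hi
  have hMo : Odd M.length := hM ▸ evenVec_length_odd _
  have hNo : Odd N.length := hN ▸ evenVec_length_odd _
  have hadd : ∀ k q, powerVec [] (2 * r) (2 * s) (k + q) =
      powerVec [] (2 * r) (2 * s) k ++ powerVec [] (2 * r) (2 * s) q := by
    intro k q
    rw [powerVec_add]; simp [powerVec]
  have hlen : ∀ k, (powerVec [] (2 * r) (2 * s) k).length = k * (M.length + N.length) := by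
    intro k; rw [length_powerVec, hM, hN]; simp
  -- the entries of the power
  have hget : ∀ k i, k < p → i < M.length + N.length →
      (powerVec [] (2 * r) (2 * s) p).getD (k * (M.length + N.length) + i) 0 =
        (M ++ N).getD i 0 := by
    intro k i hk hi
    obtain ⟨q, rfl⟩ := Nat.exists_eq_add_of_lt hk
    rw [add_assoc, hadd, List.getD_append_right _ _ _ _ (by rw [hlen]; omega), hlen,
      Nat.add_sub_cancel_left, powerVec_succ, ← hM, ← hN]
    simp only [List.reverse_nil, List.nil_append]
    rw [← List.append_assoc, List.getD_append _ _ _ _ (by simpa using hi)]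
  have hl1 := h1.length_le
  rw [hlen] at hl1
  obtain ⟨t, ht⟩ := h1
  obtain ⟨t', ht'⟩ := h2
  have hN0 := hNo.pos
  have hpos : 0 < M.length + N.length := by omega
  obtain ⟨k, ρ, hvl, hρ⟩ : ∃ k ρ, v.length = k * (M.length + N.length) + ρ ∧
      ρ < M.length + N.length :=
    ⟨v.length / (M.length + N.length), v.length % (M.length + N.length),
      (Nat.div_add_mod' _ _).symm, Nat.mod_lt _ hpos⟩
  by_cases hρ0 : ρ = 0
  · have hkp : k ≤ p := Nat.le_of_mul_le_mul_right (by omega) hpos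
    obtain ⟨q, rfl⟩ := Nat.exists_eq_add_of_le hkp
    rw [hadd] at ht
    exact ⟨k, (List.append_inj ht (by rw [hlen, hvl, hρ0, add_zero])).1⟩
  exfalso
  have hkp : k < p := Nat.lt_of_mul_lt_mul_right (a := M.length + N.length) (by omega)
  have htl : t'.length = (p - k - 1) * (M.length + N.length) + (M.length + N.length - ρ) := by
    have h3 := congrArg List.length ht'
    rw [List.length_append, hlen, hvl] at h3
    obtain ⟨q, rfl⟩ := Nat.exists_eq_add_of_lt hkp
    rw [show k + q + 1 - k - 1 = q by omega]
    have h4 : (k + q + 1) * (M.length + N.length) =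
      k * (M.length + N.length) + q * (M.length + N.length) + (M.length + N.length) := by ring
    omega
  have hpre : ∀ i < v.length, v.getD i 0 = (powerVec [] (2 * r) (2 * s) p).getD i 0 := by
    intro i hi
    rw [← ht, List.getD_append _ _ _ _ hi]
  have hsuf : ∀ i, v.getD i 0 = (powerVec [] (2 * r) (2 * s) p).getD (t'.length + i) 0 := by
    intro i
    rw [← ht', List.getD_append_right _ _ _ _ (by omega), Nat.add_sub_cancel_left]
  have hρe : Even ρ := by
    have h3 : Even (k * (M.length + N.length)) := (hMo.add_odd hNo).mul_left _
    rw [hvl] at hev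
    exact (Nat.even_add.1 hev).1 h3
  -- the first entry of `v` lies in a connector `M`
  have hρN : N.length < ρ := by
    by_contra hcon
    have h3 : v.getD 0 0 = 0 := by
      rw [hsuf 0, htl, add_zero, hget _ _ (by omega) (by omega),
        List.getD_append_right _ _ _ _ (by omega)]
      refine hNz _ ?_
      rw [show M.length + N.length - ρ - M.length = N.length - ρ by omega]
      rw [Nat.odd_iff] at hNo ⊢
      rw [Nat.even_iff] at hρe
      omega
    rcases v with _ | ⟨x, v⟩
    · simp at hvl; omega
    · have := hv.first_ne
      simp at this h3
      exact this h3
  -- so an entry of `v` is both the first one of a connector `N` and an entry `0` of `M`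
  have h3 : v.getD (ρ - N.length) 0 = N.getD 0 0 := by
    rw [hsuf, htl, add_assoc, hget _ _ (by omega) (by omega),
      List.getD_append_right _ _ _ _ (by omega)]
    congr 1; omega
  have h4 : v.getD (ρ - N.length) 0 = 0 := by
    have h5 := hget 0 (ρ - N.length) (by omega) (by omega)
    rw [zero_mul, zero_add] at h5
    rw [hpre _ (by omega), h5, List.getD_append _ _ _ _ (by omega)]
    exact hMz _ (Nat.Even.sub_odd hρN.le hρe hNo)
  rw [h4] at h3
  have h6 := evenVec_head hs []
  rw [List.append_nil, ← hN] at h6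
  obtain ⟨x, l, hl⟩ := List.exists_cons_of_ne_nil (List.ne_nil_of_length_pos hNo.pos)
  rw [hl] at h3 h6
  simp at h3 h6
  exact h6 h3.symm

theorem prefix_of_parsesWith (h : ParsesWith v e) : e <+: v := by
  obtain ⟨ε, b, h⟩ := parsesWith_iff_chain.1 h
  obtain ⟨t, rfl⟩ := h.exists_append
  exact ⟨t, rfl⟩

theorem prefix_powerVec (e : List ℤ) (m n : ℤ) (p : ℕ) : e <+: powerVec e m n p := by
  rcases p with _ | p
  · rw [powerVec_zero]
  · exact ⟨_, (powerVec_succ e m n p).symm⟩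

theorem suffix_powerVec (e : List ℤ) (m n : ℤ) (p : ℕ) : e <:+ powerVec e m n p := ⟨_, rfl⟩

/-- If the vector `v` is a power of the shortest possible tile `e`, then all tiles of which `v` is a
power are powers of `e` with the same connectors. -/
theorem eq_powerVec_of_minimal {e e' : SEven} {r' s' : ℤ} {p p' : ℕ}
    (hv : IsExpandedEven v) (h : v = powerVec e.1 (2 * r) (2 * s) (p + 1))
    (hmin : ∀ (f : SEven) (x y : ℤ) (q : ℕ), v = powerVec f.1 (2 * x) (2 * y) (q + 1) →
      e.1.length ≤ f.1.length)
    (h' : v = powerVec e'.1 (2 * r') (2 * s') (p' + 1)) :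
    r' = r ∧ s' = s ∧ ∃ k, e'.1 = powerVec e.1 (2 * r) (2 * s) k := by
  have hreg : RegularTile e.1 r s := .of_isExpandedEven e.2.1 (h ▸ hv)
  have hreg' : RegularTile e'.1 r' s' := .of_isExpandedEven e'.2.1 (h' ▸ hv)
  have hpre : e'.1 <+: v := h' ▸ prefix_powerVec _ _ _ _
  have hsuf : e'.1 <:+ v := h' ▸ suffix_powerVec _ _ _ _
  have hlt : e'.1.length < v.length := by
    have := (length_powerVec_lt e'.1 (2 * r') (2 * s') (p := 0) (q := p' + 1)).2 (by omega)
    rwa [powerVec_zero, ← h'] at this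
  -- it suffices that `e'` is a power of `e`
  suffices hk : ∃ k, e'.1 = powerVec e.1 (2 * r) (2 * s) k by
    obtain ⟨k, hk⟩ := hk
    have hkp : k < p + 1 := by
      rw [← length_powerVec_lt e.1 (2 * r) (2 * s), ← hk, ← h]
      exact hlt
    rw [hk] at h' hreg'
    obtain ⟨h1, h2⟩ := connectors_eq hreg hreg' hkp (p := p')
      (by rw [← h, ← h']) (by rw [← h, ← h'])
    exact ⟨h1, h2, k, hk⟩
  have hle := hmin e' r' s' p' h'
  by_cases he : e.1 = []
  · rw [he] at h hreg ⊢
    exact eq_powerVec_nil e'.2.1 e'.2.2 (hreg.right rfl) (h ▸ hpre) (h ▸ hsuf)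
  have he' : e'.1 ≠ [] := fun h0 => he (List.eq_nil_of_length_eq_zero (by
    rw [h0, List.length_nil] at hle; omega))
  have hself : e.1.length = e'.1.length → ∃ k, e'.1 = powerVec e.1 (2 * r) (2 * s) k := by
    intro hl
    refine ⟨0, ?_⟩
    rw [powerVec_zero]
    have h1 : e.1 <+: v := h ▸ prefix_powerVec _ _ _ _
    exact (List.prefix_of_prefix_length_le hpre h1 hl.ge).eq_of_length hl.symm
  have hvev : Even v.length := by
    rw [h, length_powerVec]
    refine Even.add ?_ e.2.2
    refine Even.mul_left ?_ _
    rw [add_assoc]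
    exact (even_two_mul _).add ((evenVec_length_odd _).add_odd (evenVec_length_odd _))
  rcases ParsesWith.compare hvev he he' (h ▸ parsesWith_powerVec _ _ _ _)
    (h' ▸ parsesWith_powerVec _ _ _ _) with hc | hc | ⟨f, x, y, i, j, hi, hj, hei, hej⟩
  · obtain ⟨ε, b, hc⟩ := parsesWith_iff_chain.1 hc
    obtain rfl := (hc.even_length e.2.2).1 e'.2.2
    obtain ⟨k, hk⟩ := hc.eq_powerVec hreg he (h ▸ hpre)
    exact ⟨k, by simpa using hk⟩
  · exact hself (le_antisymm hle (prefix_of_parsesWith hc).length_le)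
  · rcases lt_trichotomy i j with hij | hij | hij
    · -- then `v` is a power of the shorter tile `f`
      exfalso
      have hregf : RegularTile f.1 x y := by
        obtain ⟨i, rfl⟩ := Nat.exists_eq_add_of_lt hi
        rw [zero_add] at hei
        exact .of_isExpandedEven f.2.1 (hei ▸ e.2.1)
      rw [hei] at h hreg
      obtain ⟨rfl, rfl⟩ := connectors_eq hregf hreg hij (p := p)
        (by rw [← h, ← hej]; exact hpre) (by rw [← h, ← hej]; exact hsuf)
      rw [powerVec_powerVec] at h
      have h1 := hmin f r s (2 * i * (p + 1) + i + p) (by rw [h]; rfl)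
      have h2 := (length_powerVec_lt f.1 (2 * r) (2 * s) (p := 0) (q := i)).2 hi
      rw [powerVec_zero, ← hei] at h2
      omega
    · exact hself (by rw [hei, hej, hij])
    · have := (length_powerVec_lt f.1 (2 * x) (2 * y)).2 hij
      rw [← hei, ← hej] at this
      omega

end

/-! ### Powers as elements of `SEven` -/

theorem exists_enc_powerVec_nil {r s : ℤ} (hr : r ≠ 0) (hs : s ≠ 0) (p : ℕ) :
    ∃ w, Enc A (r.sign * 2) (powerVec [] (2 * r) (2 * s) (p + 1)) w B (s.sign * 2) := by
  have hsign : ∀ r : ℤ, r ≠ 0 → (r.sign = 1 ∨ r.sign = -1) ∧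
      r.sign * ((r.natAbs - 1 : ℕ) + 1) = r := by
    intro r hr
    rcases lt_or_gt_of_ne hr with h | h
    · rw [Int.sign_eq_neg_one_of_neg h]; omega
    · rw [Int.sign_eq_one_of_pos h]; omega
  obtain ⟨hr1, hr2⟩ := hsign r hr
  obtain ⟨hs1, hs2⟩ := hsign s hs
  have h1 := enc_evenVec (X := A) (by decide) (r.natAbs - 1) hr1
  have h2 := enc_evenVec (X := B) (by decide) (s.natAbs - 1) hs1
  rw [hr2] at h1
  rw [hs2] at h2
  have h3 := h1.append_sep h2 (by omega)
  induction p with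
  | zero => exact ⟨_, by simpa [powerVec] using h3⟩
  | succ p ih =>
    obtain ⟨w, hw⟩ := ih
    have := h3.append_sep hw (by omega)
    rw [powerVec_succ]
    exact ⟨_, by simpa only [List.reverse_nil, List.nil_append, List.append_assoc] using this⟩

theorem isExpandedEven_powerVec {r s : ℤ} (e : SEven) (h : RegularTile e.1 r s) (p : ℕ) :
    IsExpandedEven (powerVec e.1 (2 * r) (2 * s) p) ∧
      Even (powerVec e.1 (2 * r) (2 * s) p).length := by
  by_cases he : e.1 = []
  · rw [he]
    rcases p with _ | p
    · rw [powerVec_zero]; exact ⟨isExpandedEven_nil, by simp⟩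
    · obtain ⟨w, hw⟩ := exists_enc_powerVec_nil (h.left he) (h.right he) p
      exact ⟨hw.isExpandedEven, hw.parity.2 rfl⟩
  · obtain ⟨x, t, hx⟩ := List.exists_cons_of_ne_nil he
    obtain ⟨w, y, hE⟩ := e.exists_enc hx
    obtain ⟨k, -, hk⟩ := exists_conn_word (σ := B) (by decide) r hE.right_ne.2 (Or.inl rfl)
      (fun _ => rfl)
    obtain ⟨k', -, hk'⟩ := exists_conn_word (σ := A) (by decide) s hE.left_ne.2 (Or.inl rfl)
      (fun _ => rfl)
    have := hE.powerVec hk hk' p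
    exact ⟨this.isExpandedEven, this.parity.2 rfl⟩

theorem SEven.of_vecEquiv {a : List ℤ} (b : SEven) (h : VecEquiv a b.1) :
    IsExpandedEven a ∧ Even a.length := by
  refine ⟨?_, by rw [h.length_eq]; exact b.2.2⟩
  obtain ⟨ε, hε, h⟩ := h
  by_cases hb : b.1 = []
  · have : a = [] := by rcases h with rfl | rfl <;> simp [hb, smulVec]
    rw [this]; exact isExpandedEven_nil
  · obtain ⟨x, t, hx⟩ := List.exists_cons_of_ne_nil hb
    obtain ⟨w, y, hE⟩ := b.exists_enc hx
    rcases h with rfl | rfl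
    · exact (hE.smul hε).isExpandedEven
    · exact (hE.reverse.smul hε).isExpandedEven

/-! ### The order on knots -/

theorem orsGe_iff (c a : SEven) : ORSGe (knotOf c) (knotOf a) ↔ ClassParsesWith c.1 a.1 := by
  constructor
  · rintro ⟨c', a', hc, ha, c'', a'', hc'', ha'', h⟩
    exact ⟨c'', a'', hc''.trans (vecEquiv_of_knotOf_eq hc), ha''.trans (vecEquiv_of_knotOf_eq ha), h⟩
  · exact fun h => ⟨c, a, rfl, rfl, h⟩

/-- Every vector with entries `-2`, `0` and `2` is a sequence of connectors. -/
theorem parsesWith_nil {c : List ℤ} (h : ∀ x ∈ c, x = -2 ∨ x = 0 ∨ x = 2) : ParsesWith c [] := by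
  refine parsesWith_iff_chain.2 ?_
  induction c using List.reverseRecOn with
  | nil => exact ⟨1, true, by simpa [tileVec, smulVec] using Chain.base (e := []) (Or.inl rfl)⟩
  | append_singleton c x ih =>
    obtain ⟨ε, b, hc⟩ := ih (fun y hy => h y (by simp [hy]))
    have hx := h x (by simp)
    refine ⟨ε, !b, ?_⟩
    have h1 := hc.snoc ε (x / 2) hc.right_ne (fun _ => rfl)
    have h2 : evenVec (2 * (x / 2)) = [x] := by
      rcases hx with rfl | rfl | rfl <;> simp [evenVec, smulVec, alternatingVec]
    have h3 : tileVec [] ε (!b) = [] := by simp [tileVec, smulVec]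
    rwa [h2, h3, List.append_nil] at h1

/-- The order on the powers of a tile is divisibility of the numbers of tiles. -/
theorem dvd_of_classParsesWith {e : List ℤ} {r s : ℤ} {p q : ℕ}
    (hp : Even (powerVec e (2 * r) (2 * s) p).length)
    (hq : IsExpandedEven (powerVec e (2 * r) (2 * s) q) ∧
      Even (powerVec e (2 * r) (2 * s) q).length) (hq0 : 0 < q)
    (h : ClassParsesWith (powerVec e (2 * r) (2 * s) p) (powerVec e (2 * r) (2 * s) q)) :
    2 * q + 1 ∣ 2 * p + 1 := by
  have hinj : ∀ {i j}, (powerVec e (2 * r) (2 * s) i).length =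
      (powerVec e (2 * r) (2 * s) j).length → i = j := by
    intro i j h
    rcases lt_trichotomy i j with hij | hij | hij
    · have := (length_powerVec_lt e (2 * r) (2 * s)).2 hij; omega
    · exact hij
    · have := (length_powerVec_lt e (2 * r) (2 * s)).2 hij; omega
  obtain ⟨a', ha', h⟩ := h.exists_parsesWith hp hq.2
  have hpre := prefix_of_parsesWith h
  have hqp : q ≤ p := by
    by_contra hcon
    have := (length_powerVec_lt e (2 * r) (2 * s)).2 (not_le.1 hcon)
    have := hpre.length_le
    rw [ha'.length_eq] at this
    omega
  have hpre' : powerVec e (2 * r) (2 * s) q <+: powerVec e (2 * r) (2 * s) p := by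
    rcases hqp.eq_or_lt with rfl | hqp
    · exact List.prefix_rfl
    · obtain ⟨z, rfl⟩ := Nat.exists_eq_add_of_lt hqp
      exact ⟨_, (powerVec_add_add_one _ _ _ _ _).symm⟩
  obtain rfl : a' = powerVec e (2 * r) (2 * s) q :=
    (List.prefix_of_prefix_length_le hpre hpre' ha'.length_eq.le).eq_of_length ha'.length_eq
  have hne : powerVec e (2 * r) (2 * s) q ≠ [] := by
    intro h0
    have := (length_powerVec_lt e (2 * r) (2 * s)).2 hq0
    rw [h0] at this
    simp at this
  obtain ⟨ε, b, hc⟩ := parsesWith_iff_chain.1 h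
  obtain rfl := (hc.even_length hq.2).1 hp
  obtain ⟨k, hk⟩ := hc.eq_powerVec (r := r) (s := s) (q := p)
    ⟨hq.1.first_ne, hq.1.last_ne, fun h => absurd h hne, fun h => absurd h hne⟩ hne (by
      rw [powerVec_powerVec]
      have : p ≤ 2 * q * p + q + p := by omega
      rcases this.eq_or_lt with h | h
      · rw [← h]
      · obtain ⟨z, hz⟩ := Nat.exists_eq_add_of_lt h
        rw [hz]
        exact ⟨_, (powerVec_add_add_one _ _ _ _ _).symm⟩)
  rw [powerVec_powerVec, if_pos rfl, List.append_nil] at hk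
  have := hinj (congrArg List.length hk)
  exact ⟨2 * k + 1, by rw [this]; ring⟩

/-- Incomparable vectors of which a common one is built are powers with the same tile and the same
connectors, if there are at least two of them. -/
theorem exists_common_tile {ι : Type} {a : ι → SEven} {c : SEven} {i₀ j₀ : ι} (hij : i₀ ≠ j₀)
    (ha : ∀ i, ParsesWith c.1 (a i).1)
    (hinc : ∀ i j, i ≠ j → ¬ ParsesWith (a i).1 (a j).1) :
    ∃ (e : SEven) (r s : ℤ), ∀ i, ∃ p, (a i).1 = powerVec e.1 (2 * r) (2 * s) p := by
  have hne : ∀ i, (a i).1 ≠ [] := by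
    intro i h
    obtain ⟨j, hj⟩ : ∃ j, j ≠ i := by
      by_cases h : i₀ = i
      · exact ⟨j₀, by rintro rfl; exact hij h⟩
      · exact ⟨i₀, h⟩
    exact hinc j i hj (h ▸ parsesWith_nil (a j).2.1.entries)
  have hcommon : ∀ i j, i ≠ j → CommonVec (a i).1 (a j).1 := by
    intro i j h
    rcases ParsesWith.compare c.2.2 (hne i) (hne j) (ha i) (ha j) with h' | h' | h'
    · exact absurd h' (hinc j i h.symm)
    · exact absurd h' (hinc i j h)
    · exact h'
  -- the shortest tile of which `a i₀` is a power
  have hex : ∃ k, ∃ (e : SEven) (r s : ℤ) (p : ℕ), e.1.length = k ∧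
      (a i₀).1 = powerVec e.1 (2 * r) (2 * s) (p + 1) := by
    obtain ⟨e, r, s, p, q, hp, -, h, -⟩ := hcommon i₀ j₀ hij
    exact ⟨_, e, r, s, p - 1, rfl, by rw [Nat.sub_add_cancel hp]; exact h⟩
  classical
  obtain ⟨e, r, s, p, hlen, h⟩ := Nat.find_spec hex
  have hmin : ∀ (f : SEven) (x y : ℤ) (q : ℕ),
      (a i₀).1 = powerVec f.1 (2 * x) (2 * y) (q + 1) → e.1.length ≤ f.1.length := by
    intro f x y q hf
    rw [hlen]
    exact Nat.find_min' hex ⟨f, x, y, q, rfl, hf⟩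
  refine ⟨e, r, s, fun i => ?_⟩
  by_cases hi : i = i₀
  · exact ⟨_, hi ▸ h⟩
  · obtain ⟨e', r', s', p', q', hp', -, h', h''⟩ := hcommon i₀ i (Ne.symm hi)
    obtain ⟨rfl, rfl, k, hk⟩ := eq_powerVec_of_minimal (p' := p' - 1) (a i₀).2.1 h hmin
      (by rw [Nat.sub_add_cancel hp']; exact h')
    exact ⟨_, by rw [h'', hk, powerVec_powerVec]⟩

/-! ### Incomparable knots with a common upper bound -/

theorem theorem4 (l : ℕ) (a : Fin l → SEven) :
    ((∀ i j : Fin l, i ≠ j → ¬ ORSGe (knotOf (a i)) (knotOf (a j))) ∧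
      ∃ J : TwoBridgeKnot, ∀ i : Fin l, ORSGe J (knotOf (a i))) ↔
    ∃ (e : SEven) (m n : ℤ) (p : Fin l → ℕ),
      Even m ∧ Even n ∧
      (∀ i : Fin l, VecEquiv (powerVec e.1 m n (p i)) (a i).1) ∧
      ∀ i j : Fin l, i ≠ j → ¬ (2 * p i + 1 ∣ 2 * p j + 1) := by
  have hrefl : ∀ c : SEven, ORSGe (knotOf c) (knotOf c) := fun c =>
    (orsGe_iff c c).2 ⟨_, _, VecEquiv.refl _, VecEquiv.refl _,
      by simpa [powerVec_zero] using parsesWith_powerVec c.1 0 0 0⟩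
  by_cases hl : ∃ i j : Fin l, i ≠ j
  swap
  · -- at most one knot: both conditions hold
    push Not at hl
    obtain ⟨e, he⟩ : ∃ e : SEven, ∀ i, a i = e := by
      by_cases hi : Nonempty (Fin l)
      · exact ⟨a hi.some, fun i => by rw [hl i hi.some]⟩
      · exact ⟨⟨[], isExpandedEven_nil, by simp⟩, fun i => absurd ⟨i⟩ hi⟩
    refine iff_of_true ⟨fun i j h => absurd (hl i j) h, knotOf e, fun i => ?_⟩
      ⟨e, 0, 0, fun _ => 0, by simp, by simp, fun i => ?_, fun i j h => absurd (hl i j) h⟩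
    · rw [he]; exact hrefl e
    · rw [he, powerVec_zero]; exact VecEquiv.refl _
  obtain ⟨i₀, j₀, hij⟩ := hl
  constructor
  · rintro ⟨hinc, J, hJ⟩
    obtain ⟨c, rfl⟩ : ∃ c, J = knotOf c := by
      obtain ⟨c, -, h, -⟩ := hJ i₀
      exact ⟨c, h⟩
    have hrep : ∀ i, ∃ b : SEven, VecEquiv b.1 (a i).1 ∧ ParsesWith c.1 b.1 := by
      intro i
      obtain ⟨b, hb, h⟩ := ((orsGe_iff _ _).1 (hJ i)).exists_parsesWith c.2.2 (a i).2.2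
      exact ⟨⟨b, (a i).of_vecEquiv hb⟩, hb, h⟩
    choose b hb hcb using hrep
    have hinc' : ∀ i j, i ≠ j → ¬ ParsesWith (b i).1 (b j).1 := fun i j h h' =>
      hinc i j h ((orsGe_iff _ _).2 ⟨_, _, hb i, hb j, h'⟩)
    obtain ⟨e, r, s, he⟩ := exists_common_tile hij hcb hinc'
    choose p hp using he
    refine ⟨e, 2 * r, 2 * s, p, even_two_mul r, even_two_mul s, fun i => hp i ▸ hb i,
      fun i j h hd => ?_⟩
    obtain ⟨k, hk⟩ := hd
    obtain ⟨q, rfl⟩ : Odd k := by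
      have : Odd ((2 * p i + 1) * k) := hk ▸ odd_two_mul_add_one _
      exact (Nat.odd_mul.1 this).2
    have hpj : p j = 2 * p i * q + p i + q := by
      have : (2 * p i + 1) * (2 * q + 1) = 2 * (2 * p i * q + p i + q) + 1 := by ring
      omega
    refine hinc' j i h.symm ?_
    rw [hp j, hp i, hpj, ← powerVec_powerVec]
    exact parsesWith_powerVec _ _ _ _
  · rintro ⟨e, m, n, p, ⟨r, rfl⟩, ⟨s, rfl⟩, ha, hdvd⟩
    rw [← two_mul, ← two_mul] at ha
    have hS := fun i => (a i).of_vecEquiv (ha i)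
    have hp0 : ∀ i, 0 < p i := by
      intro i
      rw [Nat.pos_iff_ne_zero]
      intro h0
      obtain ⟨j, hj⟩ : ∃ j, i ≠ j := by
        by_cases h : i = i₀
        · exact ⟨j₀, by rintro rfl; exact hij h.symm⟩
        · exact ⟨i₀, h⟩
      exact hdvd i j hj (by simp [h0])
    refine ⟨fun i j h h' => ?_, ?_⟩
    · obtain ⟨c, b, hc, hb, h'⟩ := (orsGe_iff _ _).1 h'
      exact hdvd j i h.symm (dvd_of_classParsesWith (hS i).2 (hS j) (hp0 j)
        ⟨c, b, hc.trans (ha i).symm, hb.trans (ha j).symm, h'⟩)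
    · obtain ⟨P, hP⟩ : Odd (∏ i, (2 * p i + 1)) :=
        Finset.prod_induction _ Odd (fun _ _ => Odd.mul) odd_one
          (fun i _ => odd_two_mul_add_one (p i))
      have hreg : RegularTile e.1 r s := by
        have := (hS i₀).1
        rw [← Nat.sub_add_cancel (hp0 i₀)] at this
        exact .of_isExpandedEven e.2.1 this
      refine ⟨knotOf ⟨_, isExpandedEven_powerVec e hreg P⟩, fun i => (orsGe_iff _ _).2
        ⟨_, _, VecEquiv.refl _, ha i, ?_⟩⟩
      obtain ⟨k, hk⟩ := Finset.dvd_prod_of_mem (fun i => 2 * p i + 1) (Finset.mem_univ i)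
      obtain ⟨q, rfl⟩ : Odd k := by
        have : Odd ((2 * p i + 1) * k) := by rw [← hk, hP]; exact odd_two_mul_add_one _
        exact (Nat.odd_mul.1 this).2
      have hPq : P = 2 * p i * q + p i + q := by
        have h1 : (2 * p i + 1) * (2 * q + 1) = 2 * (2 * p i * q + p i + q) + 1 := by ring
        rw [hP, h1] at hk
        omega
      dsimp only
      rw [hPq, ← powerVec_powerVec]
      exact parsesWith_powerVec _ _ _ _
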